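/- Let $p\ge 3$ be odd, $q\in\mathbb C$ a primitive $p$-th root of unity, and $q^{1/2}$ the square root of $q$ with $(q^{1/2})^p=-1$. Put $[n]=\frac{q^n-q^{-n}}{q-q^{-1}}$ and $[n]!=[1]\cdots[n]$. Let $U_q(e(1,1))$ be the complex Hopf algebra generated by $p_\pm,\kappa$ with $p_+p_-=p_-p_+$, $p_\pm\kappa=q^{\mp1}\kappa p_\pm$, $\kappa^p=1$, $\Delta(p_\pm)=p_\pm\otimes\kappa+\kappa^{-1}\otimes p_\pm$, $\Delta(\kappa)=\kappa\otimes\kappa$, $\varepsilon(p_\pm)=0$, $\varepsilon(\kappa)=1$; put $P_\pm=p_\pm^p$. Let $A(E(1,1|p))$ be the algebra generated by $\eta_\pm,\delta$ with $\eta_-\eta_+=q^2\eta_+\eta_-$, $\eta_\pm\delta=q^2\delta\eta_\pm$, $\delta^p=1$, $\eta_\pm^p=0$, with $\Delta(\eta_\pm)=\eta_\pm\otimes1+\delta^{\pm1}\otimes\eta_\pm$, $\Delta(\delta)=\delta\otimes\delta$, $\varepsilon(\eta_\pm)=0$, $\varepsilon(\delta)=1$. Let $A(E_q(1,1))=A(E(1,1|p))\otimes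 C^\infty(\mathbb R^2)$, with $z_\pm$ the coordinate functions on $\mathbb R^2$, counit $\varepsilon(af)=\varepsilon(a)f(0)$ and coproduct (with values in the completion $A(E(1,1|p))^{\otimes2}\otimes C^\infty(\mathbb R^2\times\mathbb R^2)$) $\Delta(af)=\Delta(a)\Delta(f)$, where, with $Z_\pm=z_\pm\otimes1+1\otimes z_\pm$, $$\Delta(f)=f(Z)+\frac{\partial f}{\partial z_+}(Z)B_++\frac{\partial f}{\partial z_-}(Z)B_-+\frac{\partial^2 f}{\partial z_+\partial z_-}(Z)B_+B_-,\qquad B_\pm=(-1)^{\frac{p+1}2}\sum_{n=1}^{p-1}\frac{q^{\pm n^2}}{[p-n]![n]!}\,\eta_\pm^{p-n}\delta^{\pm n}\otimes\eta_\pm^n .$$ Put $\zeta(k)=\frac1p\sum_{n=0}^{p-1}q^{-nk}\delta^n$. There is exactly one duality pairing $\langle\cdot,\cdot\rangle$ of $U_q(e(1,1))$ and $A(E_q(1,1))$ (a bilinear form for which products are dual to coproducts and units to counits) with $\langle\kappa,\delta\rangle=q$, $\langle p_\pm,\eta_\pm\rangle=i\,q^{\pm1/2}$, $\langle p_\pm,\delta\rangle=\langle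 p_\pm,\eta_\mp\rangle=\langle\kappa,\eta_\pm\rangle=0$, and $\langle\kappa,f\rangle=f(0)$, $\langle p_\pm,f\rangle=0$ for $f\in C^\infty(\mathbb R^2)$. For $t,s\in\mathbb N$ and $n,m,k\in[0,p-1]$ the monomials $P_+^tP_-^sp_+^np_-^m\kappa^k$ form a linear basis of $U_q(e(1,1))$, the monomials $z_+^tz_-^s\eta_+^n\eta_-^m\zeta(k)$ form a linear basis of the subspace of $A(E_q(1,1))$ of elements polynomial in $z_\pm$, and $$\langle P_+^tP_-^sp_+^np_-^m\kappa^k,\ z_+^{t'}z_-^{s'}\eta_+^{n'}\eta_-^{m'}\zeta(k')\rangle=i^{\,n+m+t+s}\,q^{\frac{n-m}2-nm}\,t!\,s!\,[n]!\,[m]!\;\delta_{nn'}\delta_{mm'}\delta_{tt'}\delta_{ss'}\,\delta_{k+n+m,\,k'\,({\rm mod}\ p)} .$$ Consequently the universal $T$-matrix $T=\sum_aX^a\otimes x_a$, where $\{X^a\}$ and $\{x_a\}$ are dual linear bases of $U_q(e(1,1))$ and of that subspace (dual bases exist, and the sum is the same for all of them), taken in the completion of $U_q(e(1,1))\otimes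 A(E_q(1,1))$ by formal power series in $z_\pm$ with coefficients in $U_q(e(1,1))\otimes A(E(1,1|p))$, is $$T=e^{-iP_+\otimes z_+-iP_-\otimes z_-}\;e_+^{\,i\epsilon_+\otimes\eta_+}\;e_-^{\,i\epsilon_-\otimes\eta_-}\;D(\kappa,\delta),$$ where $e_\pm^x=\sum_{m=0}^{p-1}\frac{q^{\pm m(m-1)/2}}{[m]!}x^m$, $\ \epsilon_\pm=-q^{\mp1/2}p_\pm\kappa^{-1}$ and $D(\kappa,\delta)=\frac1p\sum_{m,k=0}^{p-1}q^{-mk}\kappa^m\otimes\delta^k$. -/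

import Mathlib

open TensorProduct
open scoped ContDiff

noncomputable section

namespace QPoincare

/-! ### The noncommutative binomial formula at a root of unity -/

/-- Gaussian binomial coefficients, by Pascal recursion. -/
def gaussBinom (w : ℂ) : ℕ → ℕ → ℂ
  | _, 0 => 1
  | 0, _ + 1 => 0
  | n + 1, k + 1 => gaussBinom w n k + w ^ (k + 1) * gaussBinom w n (k + 1)

theorem gaussBinom_zero_right (w : ℂ) (n : ℕ) : gaussBinom w n 0 = 1 := by
  cases n <;> rfl

theorem gaussBinom_of_lt (w : ℂ) : ∀ n k : ℕ, n < k → gaussBinom w n k = 0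
  | 0, k + 1, _ => rfl
  | n + 1, k + 1, h => by
      rw [gaussBinom, gaussBinom_of_lt w n k (by omega), gaussBinom_of_lt w n (k + 1) (by omega)]
      simp

/-- The product `(1 - w)(1 - w²)⋯(1 - wⁿ)`. -/
def qPoch (w : ℂ) (n : ℕ) : ℂ := ∏ i ∈ Finset.range n, (1 - w ^ (i + 1))

theorem gaussBinom_mul (w : ℂ) : ∀ a b : ℕ,
    gaussBinom w (a + b) a * qPoch w a * qPoch w b = qPoch w (a + b)
  | 0, b => by simp [gaussBinom_zero_right, qPoch]
  | a + 1, 0 => by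
      have h1 := gaussBinom_mul w a 0
      rw [add_zero] at h1 ⊢
      rw [gaussBinom, gaussBinom_of_lt w a (a + 1) (by omega)]
      have h2 : qPoch w (a + 1) = qPoch w a * (1 - w ^ (a + 1)) := Finset.prod_range_succ _ _
      rw [h2]
      linear_combination (1 - w ^ (a + 1)) * h1
  | a + 1, b + 1 => by
      have h1 := gaussBinom_mul w a (b + 1)
      have h2 := gaussBinom_mul w (a + 1) b
      have e1 : a + 1 + (b + 1) = (a + (b + 1)) + 1 := by omega
      have e2 : a + 1 + b = a + (b + 1) := by omega
      rw [e2] at h2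
      rw [e1, gaussBinom]
      have h3 : qPoch w (a + 1) = qPoch w a * (1 - w ^ (a + 1)) := Finset.prod_range_succ _ _
      have h4 : qPoch w (b + 1) = qPoch w b * (1 - w ^ (b + 1)) := Finset.prod_range_succ _ _
      have h5 : qPoch w (a + (b + 1) + 1) =
        qPoch w (a + (b + 1)) * (1 - w ^ (a + (b + 1) + 1)) := Finset.prod_range_succ _ _
      rw [h5]
      have e3 : w ^ (a + (b + 1) + 1) = w ^ (a + 1) * w ^ (b + 1) := by rw [← pow_add]; congr 1; omega
      rw [e3]
      rw [h4] at h1 ⊢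
      rw [h3] at h2 ⊢
      linear_combination (1 - w ^ (a + 1)) * h1 + w ^ (a + 1) * (1 - w ^ (b + 1)) * h2
  termination_by a b => a + b

theorem gaussBinom_prim {w : ℂ} {p : ℕ} (hw : IsPrimitiveRoot w p) {k : ℕ} (h0 : 0 < k)
    (hk : k < p) : gaussBinom w p k = 0 := by
  have h := gaussBinom_mul w k (p - k)
  rw [Nat.add_sub_cancel' hk.le] at h
  have hne : ∀ j, j < p → qPoch w j ≠ 0 := by
    intro j hj
    refine Finset.prod_ne_zero_iff.mpr fun i hi => ?_
    rw [Finset.mem_range] at hi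
    exact sub_ne_zero.mpr (hw.pow_ne_one_of_pos_of_lt (by omega) (by omega)).symm
  have hz : qPoch w p = 0 := by
    refine Finset.prod_eq_zero (i := p - 1) (Finset.mem_range.mpr (by omega)) ?_
    rw [Nat.sub_add_cancel (by omega), hw.pow_eq_one, sub_self]
  rw [hz, mul_assoc] at h
  exact (mul_eq_zero.mp h).resolve_right (mul_ne_zero (hne k hk) (hne _ (by omega)))

theorem add_pow_qcomm {R : Type*} [Ring R] [Algebra ℂ R] {w : ℂ} {x y : R}
    (h : x * y = w • (y * x)) (n : ℕ) :
    (x + y) ^ n = ∑ k ∈ Finset.range (n + 1), gaussBinom w n k • (y ^ k * x ^ (n - k)) := by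
  have hx : ∀ k : ℕ, x * y ^ k = w ^ k • (y ^ k * x) := by
    intro k
    induction k with
    | zero => simp
    | succ k ih =>
      rw [pow_succ, ← mul_assoc, ih, smul_mul_assoc, mul_assoc, h, mul_smul_comm, smul_smul,
        ← mul_assoc, pow_succ]
  induction n with
  | zero => simp [gaussBinom_zero_right]
  | succ n ih =>
    rw [pow_succ', ih, add_mul, Finset.mul_sum, Finset.mul_sum]
    have h1 : ∀ k ∈ Finset.range (n + 1), x * gaussBinom w n k • (y ^ k * x ^ (n - k)) =
        (w ^ k * gaussBinom w n k) • (y ^ k * x ^ (n + 1 - k)) := by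
      intro k hk
      rw [Finset.mem_range] at hk
      rw [mul_smul_comm, ← mul_assoc, hx, smul_mul_assoc, smul_smul, mul_assoc, ← pow_succ',
        mul_comm, show n - k + 1 = n + 1 - k by omega]
    have h2 : ∀ k ∈ Finset.range (n + 1), y * gaussBinom w n k • (y ^ k * x ^ (n - k)) =
        gaussBinom w n k • (y ^ (k + 1) * x ^ (n + 1 - (k + 1))) := by
      intro k _
      rw [mul_smul_comm, ← mul_assoc, ← pow_succ', Nat.add_sub_add_right]
    rw [Finset.sum_congr rfl h1, Finset.sum_congr rfl h2, Finset.sum_range_succ' _ (n + 1)]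
    have h3 : ∀ k ∈ Finset.range (n + 1),
        gaussBinom w (n + 1) (k + 1) • (y ^ (k + 1) * x ^ (n + 1 - (k + 1))) =
        gaussBinom w n k • (y ^ (k + 1) * x ^ (n + 1 - (k + 1))) +
        (w ^ (k + 1) * gaussBinom w n (k + 1)) • (y ^ (k + 1) * x ^ (n + 1 - (k + 1))) := by
      intro k _
      rw [← add_smul, gaussBinom]
    rw [Finset.sum_congr rfl h3, Finset.sum_add_distrib]
    have h4 := Finset.sum_range_succ'
      (fun k => (w ^ k * gaussBinom w n k) • (y ^ k * x ^ (n + 1 - k))) (n + 1)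
    rw [Finset.sum_range_succ, gaussBinom_of_lt w n (n + 1) (by omega), mul_zero, zero_smul,
      add_zero] at h4
    rw [h4]
    simp only [gaussBinom_zero_right]
    simp only [pow_zero, one_mul, one_smul]
    abel

theorem add_pow_prim {R : Type*} [Ring R] [Algebra ℂ R] {w : ℂ} {x y : R} {p : ℕ} (hp : 0 < p)
    (hw : IsPrimitiveRoot w p) (h : x * y = w • (y * x)) : (x + y) ^ p = x ^ p + y ^ p := by
  obtain ⟨m, rfl⟩ : ∃ m, p = m + 1 := ⟨p - 1, by omega⟩
  rw [add_pow_qcomm h, Finset.sum_range_succ, Finset.sum_range_succ', Finset.sum_eq_zero]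
  · have h1 := gaussBinom_mul w (m + 1) 0
    have h2 : gaussBinom w (m + 1) (m + 1) = 1 := by
      have : ∀ n, gaussBinom w n n = 1 := by
        intro n
        induction n with
        | zero => rfl
        | succ n ih => rw [gaussBinom, ih, gaussBinom_of_lt w n (n + 1) (by omega)]; simp
      exact this _
    rw [h2, gaussBinom_zero_right]
    simp
  · intro k hk
    rw [Finset.mem_range] at hk
    rw [gaussBinom_prim hw (by omega) (by omega), zero_smul]

/-! ### Quantum integers -/

/-- `[n] = (qⁿ - q⁻ⁿ) / (q - q⁻¹)`. -/
def qInt (q : ℂ) (n : ℕ) : ℂ := (q ^ n - q⁻¹ ^ n) / (q - q⁻¹)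

/-- `[n]! = [1][2]⋯[n]`. -/
def qFact (q : ℂ) (n : ℕ) : ℂ := ∏ i ∈ Finset.range n, qInt q (i + 1)

/-! ### The quantum algebra `U_q(e(1,1))` -/

/-- The generators `p₊, p₋, κ`. -/
inductive UGen
  | pPlus
  | pMinus
  | kap

/-- The defining relations of `U_q(e(1,1))`. -/
inductive URel (q : ℂ) (p : ℕ) : FreeAlgebra ℂ UGen → FreeAlgebra ℂ UGen → Prop
  | comm : URel q p (FreeAlgebra.ι ℂ UGen.pPlus * FreeAlgebra.ι ℂ UGen.pMinus)
      (FreeAlgebra.ι ℂ UGen.pMinus * FreeAlgebra.ι ℂ UGen.pPlus)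
  | plus_kap : URel q p (FreeAlgebra.ι ℂ UGen.pPlus * FreeAlgebra.ι ℂ UGen.kap)
      (q⁻¹ • (FreeAlgebra.ι ℂ UGen.kap * FreeAlgebra.ι ℂ UGen.pPlus))
  | minus_kap : URel q p (FreeAlgebra.ι ℂ UGen.pMinus * FreeAlgebra.ι ℂ UGen.kap)
      (q • (FreeAlgebra.ι ℂ UGen.kap * FreeAlgebra.ι ℂ UGen.pMinus))
  | kap_pow : URel q p (FreeAlgebra.ι ℂ UGen.kap ^ p) 1

/-- The algebra `U_q(e(1,1))` at the root of unity `q` of order `p`. -/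
def U (q : ℂ) (p : ℕ) : Type := RingQuot (URel q p)

instance (q : ℂ) (p : ℕ) : Ring (U q p) := inferInstanceAs (Ring (RingQuot (URel q p)))

instance (q : ℂ) (p : ℕ) : Algebra ℂ (U q p) :=
  inferInstanceAs (Algebra ℂ (RingQuot (URel q p)))

namespace U

variable (q : ℂ) (p : ℕ)

/-- The class of a generator. -/
def gen (g : UGen) : U q p := RingQuot.mkAlgHom ℂ (URel q p) (FreeAlgebra.ι ℂ g)

def pPlus : U q p := gen q p UGen.pPlus
def pMinus : U q p := gen q p UGen.pMinus
def kap : U q p := gen q p UGen.kap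

/-- `κ⁻¹`, which is `κᵖ⁻¹` because `κᵖ = 1`. -/
def kapInv : U q p := kap q p ^ (p - 1)

/-- `P₊ = p₊ᵖ`. -/
def PPlus : U q p := pPlus q p ^ p
/-- `P₋ = p₋ᵖ`. -/
def PMinus : U q p := pMinus q p ^ p

theorem comm : pPlus q p * pMinus q p = pMinus q p * pPlus q p := by
  have h := RingQuot.mkAlgHom_rel ℂ (URel.comm (q := q) (p := p))
  rw [map_mul, map_mul] at h
  exact h

theorem plus_kap : pPlus q p * kap q p = q⁻¹ • (kap q p * pPlus q p) := by
  have h := RingQuot.mkAlgHom_rel ℂ (URel.plus_kap (q := q) (p := p))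
  rw [map_smul, map_mul, map_mul] at h
  exact h

theorem minus_kap : pMinus q p * kap q p = q • (kap q p * pMinus q p) := by
  have h := RingQuot.mkAlgHom_rel ℂ (URel.minus_kap (q := q) (p := p))
  rw [map_smul, map_mul, map_mul] at h
  exact h

theorem kap_pow : kap q p ^ p = 1 := by
  have h := RingQuot.mkAlgHom_rel ℂ (URel.kap_pow (q := q) (p := p))
  rw [map_pow, map_one] at h
  exact h

variable {q p}

theorem kapInv_mul (hp : 0 < p) : kapInv q p * kap q p = 1 := by
  rw [kapInv, ← pow_succ, Nat.sub_add_cancel hp, kap_pow]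

theorem mul_kapInv (hp : 0 < p) : kap q p * kapInv q p = 1 := by
  rw [kapInv, ← pow_succ', Nat.sub_add_cancel hp, kap_pow]

/-- The universal property of the presentation. -/
def lift {B : Type*} [Ring B] [Algebra ℂ B] (a b k : B) (h1 : a * b = b * a)
    (h2 : a * k = q⁻¹ • (k * a)) (h3 : b * k = q • (k * b)) (h4 : k ^ p = 1) :
    U q p →ₐ[ℂ] B :=
  RingQuot.liftAlgHom ℂ ⟨FreeAlgebra.lift ℂ fun g => UGen.rec a b k g, by
    rintro x y (_ | _ | _ | _) <;> simp [h1, h2, h3, h4]⟩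

theorem lift_gen {B : Type*} [Ring B] [Algebra ℂ B] (a b k : B) (h1 : a * b = b * a)
    (h2 : a * k = q⁻¹ • (k * a)) (h3 : b * k = q • (k * b)) (h4 : k ^ p = 1) (g : UGen) :
    lift (q := q) (p := p) a b k h1 h2 h3 h4 (gen q p g) = UGen.rec a b k g := by
  rw [lift, gen]
  refine (RingQuot.liftAlgHom_mkAlgHom_apply _ _ _ _).trans ?_
  simp

theorem comul_aux1 (hp : 0 < p) (hq : q ≠ 0) :
    (pPlus q p ⊗ₜ[ℂ] kap q p + kapInv q p ⊗ₜ[ℂ] pPlus q p) *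
      (pMinus q p ⊗ₜ[ℂ] kap q p + kapInv q p ⊗ₜ[ℂ] pMinus q p) =
    (pMinus q p ⊗ₜ[ℂ] kap q p + kapInv q p ⊗ₜ[ℂ] pMinus q p) *
      (pPlus q p ⊗ₜ[ℂ] kap q p + kapInv q p ⊗ₜ[ℂ] pPlus q p) := by
  have e1 : pPlus q p * kapInv q p = q • (kapInv q p * pPlus q p) := by
    calc pPlus q p * kapInv q p
        = kapInv q p * (kap q p * pPlus q p) * kapInv q p := by
          rw [← mul_assoc, kapInv_mul hp, one_mul]
      _ = q • (kapInv q p * (q⁻¹ • (kap q p * pPlus q p)) * kapInv q p) := by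
          rw [mul_smul_comm, smul_mul_assoc, smul_smul, mul_inv_cancel₀ hq, one_smul]
      _ = _ := by rw [← plus_kap, mul_assoc, mul_assoc, mul_kapInv hp, mul_one]
  have e2 : pMinus q p * kapInv q p = q⁻¹ • (kapInv q p * pMinus q p) := by
    calc pMinus q p * kapInv q p
        = kapInv q p * (kap q p * pMinus q p) * kapInv q p := by
          rw [← mul_assoc, kapInv_mul hp, one_mul]
      _ = q⁻¹ • (kapInv q p * (q • (kap q p * pMinus q p)) * kapInv q p) := by
          rw [mul_smul_comm, smul_mul_assoc, smul_smul, inv_mul_cancel₀ hq, one_smul]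
      _ = _ := by rw [← minus_kap, mul_assoc, mul_assoc, mul_kapInv hp, mul_one]
  simp only [add_mul, mul_add, Algebra.TensorProduct.tmul_mul_tmul, comm, e1, e2, plus_kap,
    minus_kap, TensorProduct.smul_tmul', TensorProduct.tmul_smul]
  abel

/-- The coproduct: `Δ(p±) = p± ⊗ κ + κ⁻¹ ⊗ p±`, `Δ(κ) = κ ⊗ κ`. -/
def comul (hp : 0 < p) (hq : q ≠ 0) : U q p →ₐ[ℂ] U q p ⊗[ℂ] U q p :=
  lift (pPlus q p ⊗ₜ kap q p + kapInv q p ⊗ₜ pPlus q p)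
    (pMinus q p ⊗ₜ kap q p + kapInv q p ⊗ₜ pMinus q p)
    (kap q p ⊗ₜ kap q p)
    (comul_aux1 hp hq)
    (by simp only [add_mul, mul_add, Algebra.TensorProduct.tmul_mul_tmul, plus_kap, kapInv_mul hp,
          mul_kapInv hp, TensorProduct.smul_tmul', TensorProduct.tmul_smul, smul_add])
    (by simp only [add_mul, mul_add, Algebra.TensorProduct.tmul_mul_tmul, minus_kap, kapInv_mul hp,
          mul_kapInv hp, TensorProduct.smul_tmul', TensorProduct.tmul_smul, smul_add])
    (by rw [Algebra.TensorProduct.tmul_pow, kap_pow]; rfl)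

/-- The counit: `ε(p±) = 0`, `ε(κ) = 1`. -/
def counit : U q p →ₐ[ℂ] ℂ :=
  lift 0 0 1 (by simp) (by simp) (by simp) (by simp)

end U

/-! ### The reduced quantum Poincaré group `E(1,1|p)` -/

/-- The generators `η₊, η₋, δ`. -/
inductive AGen
  | etaPlus
  | etaMinus
  | del

/-- The defining relations of `A(E(1,1|p))`. -/
inductive ARel (q : ℂ) (p : ℕ) : FreeAlgebra ℂ AGen → FreeAlgebra ℂ AGen → Prop
  | eta : ARel q p (FreeAlgebra.ι ℂ AGen.etaMinus * FreeAlgebra.ι ℂ AGen.etaPlus)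
      (q ^ 2 • (FreeAlgebra.ι ℂ AGen.etaPlus * FreeAlgebra.ι ℂ AGen.etaMinus))
  | plus_del : ARel q p (FreeAlgebra.ι ℂ AGen.etaPlus * FreeAlgebra.ι ℂ AGen.del)
      (q ^ 2 • (FreeAlgebra.ι ℂ AGen.del * FreeAlgebra.ι ℂ AGen.etaPlus))
  | minus_del : ARel q p (FreeAlgebra.ι ℂ AGen.etaMinus * FreeAlgebra.ι ℂ AGen.del)
      (q ^ 2 • (FreeAlgebra.ι ℂ AGen.del * FreeAlgebra.ι ℂ AGen.etaMinus))
  | del_pow : ARel q p (FreeAlgebra.ι ℂ AGen.del ^ p) 1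
  | plus_pow : ARel q p (FreeAlgebra.ι ℂ AGen.etaPlus ^ p) 0
  | minus_pow : ARel q p (FreeAlgebra.ι ℂ AGen.etaMinus ^ p) 0

/-- The algebra `A(E(1,1|p))`. -/
def Ared (q : ℂ) (p : ℕ) : Type := RingQuot (ARel q p)

instance (q : ℂ) (p : ℕ) : Ring (Ared q p) := inferInstanceAs (Ring (RingQuot (ARel q p)))

instance (q : ℂ) (p : ℕ) : Algebra ℂ (Ared q p) :=
  inferInstanceAs (Algebra ℂ (RingQuot (ARel q p)))

namespace Ared

variable (q : ℂ) (p : ℕ)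

/-- The class of a generator. -/
def gen (g : AGen) : Ared q p := RingQuot.mkAlgHom ℂ (ARel q p) (FreeAlgebra.ι ℂ g)

def etaPlus : Ared q p := gen q p AGen.etaPlus
def etaMinus : Ared q p := gen q p AGen.etaMinus
def del : Ared q p := gen q p AGen.del

/-- `δ⁻¹`, which is `δᵖ⁻¹` because `δᵖ = 1`. -/
def delInv : Ared q p := del q p ^ (p - 1)

theorem eta : etaMinus q p * etaPlus q p = q ^ 2 • (etaPlus q p * etaMinus q p) := by
  have h := RingQuot.mkAlgHom_rel ℂ (ARel.eta (q := q) (p := p))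
  rw [map_smul, map_mul, map_mul] at h
  exact h

theorem plus_del : etaPlus q p * del q p = q ^ 2 • (del q p * etaPlus q p) := by
  have h := RingQuot.mkAlgHom_rel ℂ (ARel.plus_del (q := q) (p := p))
  rw [map_smul, map_mul, map_mul] at h
  exact h

theorem minus_del : etaMinus q p * del q p = q ^ 2 • (del q p * etaMinus q p) := by
  have h := RingQuot.mkAlgHom_rel ℂ (ARel.minus_del (q := q) (p := p))
  rw [map_smul, map_mul, map_mul] at h
  exact h

theorem del_pow : del q p ^ p = 1 := by
  have h := RingQuot.mkAlgHom_rel ℂ (ARel.del_pow (q := q) (p := p))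
  rw [map_pow, map_one] at h
  exact h

theorem plus_pow : etaPlus q p ^ p = 0 := by
  have h := RingQuot.mkAlgHom_rel ℂ (ARel.plus_pow (q := q) (p := p))
  rw [map_pow, map_zero] at h
  exact h

theorem minus_pow : etaMinus q p ^ p = 0 := by
  have h := RingQuot.mkAlgHom_rel ℂ (ARel.minus_pow (q := q) (p := p))
  rw [map_pow, map_zero] at h
  exact h

variable {q p}

theorem delInv_mul (hp : 0 < p) : delInv q p * del q p = 1 := by
  rw [delInv, ← pow_succ, Nat.sub_add_cancel hp, del_pow]

theorem mul_delInv (hp : 0 < p) : del q p * delInv q p = 1 := by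
  rw [delInv, ← pow_succ', Nat.sub_add_cancel hp, del_pow]

/-- The universal property of the presentation. -/
def lift {B : Type*} [Ring B] [Algebra ℂ B] (a b d : B) (h1 : b * a = q ^ 2 • (a * b))
    (h2 : a * d = q ^ 2 • (d * a)) (h3 : b * d = q ^ 2 • (d * b)) (h4 : d ^ p = 1)
    (h5 : a ^ p = 0) (h6 : b ^ p = 0) : Ared q p →ₐ[ℂ] B :=
  RingQuot.liftAlgHom ℂ ⟨FreeAlgebra.lift ℂ fun g => AGen.rec a b d g, by
    rintro x y (_ | _ | _ | _ | _ | _) <;> simp [h1, h2, h3, h4, h5, h6]⟩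

theorem lift_gen {B : Type*} [Ring B] [Algebra ℂ B] (a b d : B) (h1 : b * a = q ^ 2 • (a * b))
    (h2 : a * d = q ^ 2 • (d * a)) (h3 : b * d = q ^ 2 • (d * b)) (h4 : d ^ p = 1)
    (h5 : a ^ p = 0) (h6 : b ^ p = 0) (g : AGen) :
    lift (q := q) (p := p) a b d h1 h2 h3 h4 h5 h6 (gen q p g) = AGen.rec a b d g := by
  rw [lift, gen]
  refine (RingQuot.liftAlgHom_mkAlgHom_apply _ _ _ _).trans ?_
  simp

theorem delInv_comm (hp : 0 < p) {x : Ared q p}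
    (h : x * del q p = q ^ 2 • (del q p * x)) :
    delInv q p * x = q ^ 2 • (x * delInv q p) := by
  calc delInv q p * x = delInv q p * (x * del q p) * delInv q p := by
        rw [mul_assoc, mul_assoc, mul_delInv hp, mul_one]
    _ = _ := by
        rw [h, mul_smul_comm, smul_mul_assoc, ← mul_assoc, delInv_mul hp, one_mul]

theorem prim_sq (hodd : Odd p) (hq : IsPrimitiveRoot q p) : IsPrimitiveRoot (q ^ 2) p :=
  hq.pow_of_coprime 2 hodd.coprime_two_left

/-- The coproduct: `Δ(η±) = η± ⊗ 1 + δ^{±1} ⊗ η±`, `Δ(δ) = δ ⊗ δ`. -/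
def comul (hodd : Odd p) (hq : IsPrimitiveRoot q p) :
    Ared q p →ₐ[ℂ] Ared q p ⊗[ℂ] Ared q p :=
  have hp : 0 < p := hodd.pos
  have e1 : delInv q p * etaPlus q p = q ^ 2 • (etaPlus q p * delInv q p) :=
    delInv_comm hp (plus_del q p)
  have e2 : delInv q p * etaMinus q p = q ^ 2 • (etaMinus q p * delInv q p) :=
    delInv_comm hp (minus_del q p)
  lift (etaPlus q p ⊗ₜ 1 + del q p ⊗ₜ etaPlus q p)
    (etaMinus q p ⊗ₜ 1 + delInv q p ⊗ₜ etaMinus q p)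
    (del q p ⊗ₜ del q p)
    (by
      simp only [add_mul, mul_add, Algebra.TensorProduct.tmul_mul_tmul, eta, minus_del, e1,
        delInv_mul hp, mul_delInv hp,
        TensorProduct.smul_tmul', TensorProduct.tmul_smul, smul_add, mul_one, one_mul]
      abel)
    (by
      simp only [add_mul, mul_add, Algebra.TensorProduct.tmul_mul_tmul, plus_del,
        TensorProduct.smul_tmul', TensorProduct.tmul_smul, smul_add, mul_one, one_mul])
    (by
      simp only [add_mul, mul_add, Algebra.TensorProduct.tmul_mul_tmul, minus_del,
        delInv_mul hp, mul_delInv hp,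
        TensorProduct.smul_tmul', TensorProduct.tmul_smul, smul_add, mul_one, one_mul])
    (by rw [Algebra.TensorProduct.tmul_pow, del_pow]; rfl)
    (by
      rw [add_pow_prim hp (prim_sq hodd hq), Algebra.TensorProduct.tmul_pow,
        Algebra.TensorProduct.tmul_pow, plus_pow, zero_tmul, tmul_zero, add_zero]
      simp only [Algebra.TensorProduct.tmul_mul_tmul, plus_del, TensorProduct.smul_tmul',
        mul_one, one_mul])
    (by
      rw [add_comm, add_pow_prim hp (prim_sq hodd hq), Algebra.TensorProduct.tmul_pow,
        Algebra.TensorProduct.tmul_pow, minus_pow, zero_tmul, tmul_zero, add_zero]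
      simp only [Algebra.TensorProduct.tmul_mul_tmul, e2, TensorProduct.smul_tmul',
        mul_one, one_mul])

/-- The counit: `ε(η±) = 0`, `ε(δ) = 1`. -/
def counit (hp : 0 < p) : Ared q p →ₐ[ℂ] ℂ :=
  lift 0 0 1 (by simp) (by simp) (by simp) (by simp) (by simp [hp.ne']) (by simp [hp.ne'])

end Ared

/-! ### Smooth functions -/

/-- The algebra `C^∞(E)` of complex valued infinitely differentiable functions on `E`. -/
def Smooth (E : Type) [NormedAddCommGroup E] [NormedSpace ℝ E] : Subalgebra ℂ (E → ℂ) where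
  carrier := {f | ContDiff ℝ ∞ f}
  mul_mem' {f g} hf hg := by
    have hf' : ContDiff ℝ ∞ f := hf
    have hg' : ContDiff ℝ ∞ g := hg
    exact hf'.mul hg'
  add_mem' {f g} hf hg := by
    have hf' : ContDiff ℝ ∞ f := hf
    have hg' : ContDiff ℝ ∞ g := hg
    exact hf'.add hg'
  algebraMap_mem' c := by
    have h : ContDiff ℝ ∞ (fun _ : E => c) := contDiff_const
    exact h

theorem Smooth.contDiff {E : Type} [NormedAddCommGroup E] [NormedSpace ℝ E] (f : Smooth E) :
    ContDiff ℝ ∞ f.1 := f.2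

/-- A smooth function from its underlying function. -/
def Smooth.mk {E : Type} [NormedAddCommGroup E] [NormedSpace ℝ E] (f : E → ℂ)
    (hf : ContDiff ℝ ∞ f) : Smooth E := ⟨f, hf⟩

/-- The plane `ℝ²` with coordinates `(z₊, z₋)`. -/
abbrev Plane : Type := ℝ × ℝ

/-- The coordinate function `z₊`. -/
def coordPlus : Smooth Plane :=
  Smooth.mk (fun x => (x.1 : ℂ)) (Complex.ofRealCLM.contDiff.comp contDiff_fst)

/-- The coordinate function `z₋`. -/
def coordMinus : Smooth Plane :=
  Smooth.mk (fun x => (x.2 : ℂ)) (Complex.ofRealCLM.contDiff.comp contDiff_snd)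

/-- The directional derivative on smooth functions of the plane. -/
def dirDeriv (v : Plane) : Smooth Plane →ₗ[ℂ] Smooth Plane where
  toFun f := Smooth.mk (fun x => fderiv ℝ f.1 x v)
    (((Smooth.contDiff f).fderiv_right (m := ∞) le_rfl).clm_apply contDiff_const)
  map_add' f g := by
    ext x
    have hf : DifferentiableAt ℝ f.1 x := ((Smooth.contDiff f).differentiable (by simp)) x
    have hg : DifferentiableAt ℝ g.1 x := ((Smooth.contDiff g).differentiable (by simp)) x
    change fderiv ℝ (f.1 + g.1) x v = fderiv ℝ f.1 x v + fderiv ℝ g.1 x v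
    rw [fderiv_add hf hg]
    rfl
  map_smul' c f := by
    ext x
    have hf : DifferentiableAt ℝ f.1 x := ((Smooth.contDiff f).differentiable (by simp)) x
    change fderiv ℝ (c • f.1) x v = c • fderiv ℝ f.1 x v
    rw [fderiv_const_smul hf]
    rfl

/-- `∂/∂z₊`. -/
def dPlus : Smooth Plane →ₗ[ℂ] Smooth Plane := dirDeriv (1, 0)

/-- `∂/∂z₋`. -/
def dMinus : Smooth Plane →ₗ[ℂ] Smooth Plane := dirDeriv (0, 1)

/-- Evaluation of a smooth function at a point. -/
def evalC (x : Plane) : Smooth Plane →ₗ[ℂ] ℂ where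
  toFun f := f.1 x
  map_add' _ _ := rfl
  map_smul' _ _ := rfl

/-- `f ↦ f(Z)`, the function `(x, y) ↦ f (x + y)`. -/
def atZ : Smooth Plane →ₗ[ℂ] Smooth (Plane × Plane) where
  toFun f := Smooth.mk (fun w => f.1 (w.1 + w.2))
    ((Smooth.contDiff f).comp (contDiff_fst.add contDiff_snd))
  map_add' _ _ := rfl
  map_smul' _ _ := rfl

/-- `g ↦ g(x, ·)`. -/
def restrictSnd (x : Plane) : Smooth (Plane × Plane) →ₗ[ℂ] Smooth Plane where
  toFun g := Smooth.mk (fun y => g.1 (x, y))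
    ((Smooth.contDiff g).comp (contDiff_const.prodMk contDiff_id))
  map_add' _ _ := rfl
  map_smul' _ _ := rfl

/-! ### The quantum Poincaré group `E_q(1,1)` -/

/-- The algebra `A(E_q(1,1)) = A(E(1,1|p)) ⊗ C^∞(ℝ²)`. -/
abbrev A (q : ℂ) (p : ℕ) : Type := Ared q p ⊗[ℂ] Smooth Plane

/-- The target of the coproduct of `A(E_q(1,1))`: the completion
`A(E(1,1|p)) ⊗ A(E(1,1|p)) ⊗ C^∞(ℝ² × ℝ²)` of `A(E_q(1,1)) ⊗ A(E_q(1,1))`. -/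
abbrev A₂ (q : ℂ) (p : ℕ) : Type :=
  (Ared q p ⊗[ℂ] Ared q p) ⊗[ℂ] Smooth (Plane × Plane)

namespace A

variable (q : ℂ) (p : ℕ)

/-- `B₊ = (-1)^{(p+1)/2} ∑ q^{n²} / ([p-n]![n]!) η₊^{p-n} δⁿ ⊗ η₊ⁿ`, `1 ≤ n ≤ p - 1`. -/
def BPlus : Ared q p ⊗[ℂ] Ared q p :=
  (-1 : ℂ) ^ ((p + 1) / 2) • ∑ n ∈ Finset.Ico 1 p,
    (q ^ (n ^ 2) / (qFact q (p - n) * qFact q n)) •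
      ((Ared.etaPlus q p ^ (p - n) * Ared.del q p ^ n) ⊗ₜ[ℂ] (Ared.etaPlus q p ^ n))

/-- `B₋ = (-1)^{(p+1)/2} ∑ q^{-n²} / ([p-n]![n]!) η₋^{p-n} δ^{-n} ⊗ η₋ⁿ`, `1 ≤ n ≤ p - 1`. -/
def BMinus : Ared q p ⊗[ℂ] Ared q p :=
  (-1 : ℂ) ^ ((p + 1) / 2) • ∑ n ∈ Finset.Ico 1 p,
    (q⁻¹ ^ (n ^ 2) / (qFact q (p - n) * qFact q n)) •
      ((Ared.etaMinus q p ^ (p - n) * Ared.delInv q p ^ n) ⊗ₜ[ℂ] (Ared.etaMinus q p ^ n))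

/-- The coproduct of a smooth function:
`Δ(f) = f(Z) + (∂₊f)(Z) B₊ + (∂₋f)(Z) B₋ + (∂₊∂₋f)(Z) B₊B₋`. -/
def comulC : Smooth Plane →ₗ[ℂ] A₂ q p :=
  TensorProduct.mk ℂ _ _ 1 ∘ₗ atZ
    + TensorProduct.mk ℂ _ _ (BPlus q p) ∘ₗ atZ ∘ₗ dPlus
    + TensorProduct.mk ℂ _ _ (BMinus q p) ∘ₗ atZ ∘ₗ dMinus
    + TensorProduct.mk ℂ _ _ (BPlus q p * BMinus q p) ∘ₗ atZ ∘ₗ dPlus ∘ₗ dMinus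

variable {q p}

/-- The coproduct of `A(E_q(1,1))`: `Δ(a f) = Δ(a) Δ(f)` for `a ∈ A(E(1,1|p))`,
`f ∈ C^∞(ℝ²)`. -/
def comul (hodd : Odd p) (hq : IsPrimitiveRoot q p) : A q p →ₗ[ℂ] A₂ q p :=
  TensorProduct.lift ((LinearMap.mul ℂ (A₂ q p)).compl₁₂
    ((TensorProduct.mk ℂ _ _).flip 1 ∘ₗ (Ared.comul hodd hq).toLinearMap) (comulC q p))

/-- The counit: `ε(a f) = ε(a) f(0)`. -/
def counit (hp : 0 < p) : A q p →ₗ[ℂ] ℂ :=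
  TensorProduct.lift ((LinearMap.mul ℂ ℂ).compl₁₂ (Ared.counit (q := q) hp).toLinearMap (evalC 0))

/-- An element of `A(E_q(1,1))` is a function on `ℝ²` with values in `A(E(1,1|p))`; this is its
value at `x`. -/
def evalAt (x : Plane) : A q p →ₗ[ℂ] Ared q p :=
  (TensorProduct.rid ℂ (Ared q p)).toLinearMap ∘ₗ (evalC x).lTensor (Ared q p)

/-- The value at `x` of `(id ⊗ L)(G)`, for a linear functional `L` on `A(E_q(1,1))`:
`(a ⊗ b) g ↦ L(b g(x, ·)) a`. -/
def sliceAt (L : A q p →ₗ[ℂ] ℂ) (x : Plane) : A₂ q p →ₗ[ℂ] Ared q p :=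
  (TensorProduct.rid ℂ (Ared q p)).toLinearMap ∘ₗ L.lTensor (Ared q p) ∘ₗ
    (TensorProduct.assoc ℂ (Ared q p) (Ared q p) (Smooth Plane)).toLinearMap ∘ₗ
      (restrictSnd x).lTensor (Ared q p ⊗[ℂ] Ared q p)

variable (q p)

/-- The generators of `A(E_q(1,1))`, and `C^∞(ℝ²)` inside it. -/
def etaPlus : A q p := Ared.etaPlus q p ⊗ₜ 1
def etaMinus : A q p := Ared.etaMinus q p ⊗ₜ 1
def del : A q p := Ared.del q p ⊗ₜ 1
def ofSmooth (f : Smooth Plane) : A q p := 1 ⊗ₜ f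
def zPlus : A q p := ofSmooth q p coordPlus
def zMinus : A q p := ofSmooth q p coordMinus

/-- `ζ(k) = (1/p) ∑ q^{-nk} δⁿ`, `0 ≤ n ≤ p - 1`. -/
def zeta (k : ℕ) : A q p :=
  (p : ℂ)⁻¹ • ∑ n ∈ Finset.range p, q⁻¹ ^ (n * k) • del q p ^ n

/-- The monomial `z₊ᵗ z₋ˢ η₊ⁿ η₋ᵐ ζ(k)`. -/
def monomial (t s n m k : ℕ) : A q p :=
  zPlus q p ^ t * zMinus q p ^ s * etaPlus q p ^ n * etaMinus q p ^ m * zeta q p k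

/-- The subspace of `A(E_q(1,1))` of elements that depend polynomially on `z₊, z₋`. -/
def polyPart : Submodule ℂ (A q p) :=
  Submodule.span ℂ {F | ∃ (a : Ared q p) (t s : ℕ), F = a ⊗ₜ (coordPlus ^ t * coordMinus ^ s)}

end A

namespace U

/-- The monomial `P₊ᵗ P₋ˢ p₊ⁿ p₋ᵐ κᵏ`. -/
def monomial (q : ℂ) (p : ℕ) (t s n m k : ℕ) : U q p :=
  PPlus q p ^ t * PMinus q p ^ s * pPlus q p ^ n * pMinus q p ^ m * kap q p ^ k

end U

/-! ### The duality pairing -/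

/-- `B = ⟨·, ·⟩` is the duality pairing of `U_q(e(1,1))` and `A(E_q(1,1))`: products on either
side are dual to coproducts on the other, units are dual to counits, and on generators it has the
values `⟨κ, δ⟩ = q`, `⟨p±, η±⟩ = i q^{±1/2}`, `⟨p±, δ⟩ = ⟨p±, η∓⟩ = ⟨κ, η±⟩ = 0`,
`⟨κ, f⟩ = f(0)`, `⟨p±, f⟩ = 0` for `f ∈ C^∞(ℝ²)`. Here `r = q^{1/2}`. -/
structure IsDualityPairing {q : ℂ} {p : ℕ} (hodd : Odd p) (hq : IsPrimitiveRoot q p) (r : ℂ)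
    (B : U q p →ₗ[ℂ] A q p →ₗ[ℂ] ℂ) : Prop where
  /-- `⟨XY, F⟩ = ⟨X ⊗ Y, Δ(F)⟩ = ⟨X, (id ⊗ Y)Δ(F)⟩`, where `(id ⊗ Y)Δ(F)` is again an element
  `H` of `A(E_q(1,1))`. -/
  mul_left : ∀ (X Y : U q p) (F : A q p), ∃ H : A q p,
    (∀ x : Plane, A.evalAt x H = A.sliceAt (B Y) x (A.comul hodd hq F)) ∧ B (X * Y) F = B X H
  /-- `⟨X, FG⟩ = ⟨Δ(X), F ⊗ G⟩`. -/
  mul_right : ∀ (X : U q p) (F G : A q p), B X (F * G) =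
    LinearMap.mul' ℂ ℂ (TensorProduct.map (B.flip F) (B.flip G)
      (U.comul hodd.pos (hq.ne_zero hodd.pos.ne') X))
  one_left : ∀ F : A q p, B 1 F = A.counit hodd.pos F
  one_right : ∀ X : U q p, B X 1 = U.counit X
  kap_del : B (U.kap q p) (A.del q p) = q
  kap_etaPlus : B (U.kap q p) (A.etaPlus q p) = 0
  kap_etaMinus : B (U.kap q p) (A.etaMinus q p) = 0
  kap_smooth : ∀ f : Smooth Plane, B (U.kap q p) (A.ofSmooth q p f) = f.1 0
  pPlus_del : B (U.pPlus q p) (A.del q p) = 0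
  pPlus_etaPlus : B (U.pPlus q p) (A.etaPlus q p) = Complex.I * r
  pPlus_etaMinus : B (U.pPlus q p) (A.etaMinus q p) = 0
  pPlus_smooth : ∀ f : Smooth Plane, B (U.pPlus q p) (A.ofSmooth q p f) = 0
  pMinus_del : B (U.pMinus q p) (A.del q p) = 0
  pMinus_etaPlus : B (U.pMinus q p) (A.etaPlus q p) = 0
  pMinus_etaMinus : B (U.pMinus q p) (A.etaMinus q p) = Complex.I * r⁻¹
  pMinus_smooth : ∀ f : Smooth Plane, B (U.pMinus q p) (A.ofSmooth q p f) = 0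

/-! ### The completed tensor product and the universal T-matrix -/

/-- The completion of `U_q(e(1,1)) ⊗ A(E_q(1,1))` along the ideal generated by the central elements
`1 ⊗ z₊` and `1 ⊗ z₋`: formal power series in `z₊` (variable `0`) and `z₋` (variable `1`) with
coefficients in `U_q(e(1,1)) ⊗ A(E(1,1|p))`. -/
abbrev Completed (q : ℂ) (p : ℕ) : Type := MvPowerSeries (Fin 2) (U q p ⊗[ℂ] Ared q p)

/-- The Taylor coefficient `∂₊ᵗ ∂₋ˢ f(0) / (t! s!)`, for `t = d 0`, `s = d 1`. -/
def taylorCoeff (d : Fin 2 →₀ ℕ) : Smooth Plane →ₗ[ℂ] ℂ :=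
  ((Nat.factorial (d 0) : ℂ) * (Nat.factorial (d 1) : ℂ))⁻¹ • (evalC 0 ∘ₗ (dPlus ^ d 0) ∘ₗ (dMinus ^ d 1))

/-- The canonical map from `U_q(e(1,1)) ⊗ A(E_q(1,1))` to its completion:
`X ⊗ a f ↦ (X ⊗ a) · (Taylor series of f)`. -/
def toCompleted {q : ℂ} {p : ℕ} : U q p ⊗[ℂ] A q p →ₗ[ℂ] Completed q p where
  toFun w := fun d => TensorProduct.rid ℂ (U q p ⊗[ℂ] Ared q p)
    ((taylorCoeff d).lTensor (U q p ⊗[ℂ] Ared q p)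
      ((TensorProduct.assoc ℂ (U q p) (Ared q p) (Smooth Plane)).symm w))
  map_add' v w := by
    funext d
    simp only [map_add]
    rfl
  map_smul' c w := by
    funext d
    simp only [map_smul]
    rfl

/-- The family `f` is summable with sum `S` in the completion: for each exponent only finitely many
members have a nonzero coefficient, and these coefficients add up to that of `S`. -/
def HasFormalSum {q : ℂ} {p : ℕ} {ι : Type} (f : ι → Completed q p) (S : Completed q p) : Prop :=
  ∀ d : Fin 2 →₀ ℕ, {i | MvPowerSeries.coeff d (f i) ≠ 0}.Finite ∧
    ∑ᶠ i, MvPowerSeries.coeff d (f i) = MvPowerSeries.coeff d S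

/-- `eˣ = ∑ xⁿ / n!`, for `x` without constant term. -/
def formalExp {q : ℂ} {p : ℕ} (x : Completed q p) : Completed q p :=
  fun d => ∑ᶠ n : ℕ, (Nat.factorial n : ℂ)⁻¹ • MvPowerSeries.coeff d (x ^ n)

/-- The cut off exponential `e₊ˣ = ∑ q^{m(m-1)/2} / [m]! xᵐ`, `0 ≤ m ≤ p - 1`. -/
def cutExpPlus {q : ℂ} {p : ℕ} (x : Completed q p) : Completed q p :=
  ∑ m ∈ Finset.range p, (q ^ (m * (m - 1) / 2) / qFact q m) • x ^ m

/-- The cut off exponential `e₋ˣ = ∑ q^{-m(m-1)/2} / [m]! xᵐ`, `0 ≤ m ≤ p - 1`. -/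
def cutExpMinus {q : ℂ} {p : ℕ} (x : Completed q p) : Completed q p :=
  ∑ m ∈ Finset.range p, (q⁻¹ ^ (m * (m - 1) / 2) / qFact q m) • x ^ m

/-- `ε₊ = -q^{-1/2} p₊ κ⁻¹`, with `r = q^{1/2}`. -/
def epsPlus (q : ℂ) (p : ℕ) (r : ℂ) : U q p := (-r⁻¹) • (U.pPlus q p * U.kapInv q p)

/-- `ε₋ = -q^{1/2} p₋ κ⁻¹`, with `r = q^{1/2}`. -/
def epsMinus (q : ℂ) (p : ℕ) (r : ℂ) : U q p := (-r) • (U.pMinus q p * U.kapInv q p)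

/-- `D(κ, δ) = (1/p) ∑ q^{-mk} κᵐ ⊗ δᵏ`, `0 ≤ m, k ≤ p - 1`. -/
def Dmat (q : ℂ) (p : ℕ) : U q p ⊗[ℂ] A q p :=
  (p : ℂ)⁻¹ • ∑ m ∈ Finset.range p, ∑ k ∈ Finset.range p,
    q⁻¹ ^ (m * k) • ((U.kap q p ^ m) ⊗ₜ[ℂ] (A.del q p ^ k))

/-- `X` and `x` are dual linear bases, with respect to the pairing `B`, of `U_q(e(1,1))` and of the
polynomial part of `A(E_q(1,1))`. -/
def AreDualBases {q : ℂ} {p : ℕ} (B : U q p →ₗ[ℂ] A q p →ₗ[ℂ] ℂ) {ι : Type}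
    (X : Module.Basis ι ℂ (U q p)) (x : Module.Basis ι ℂ (A.polyPart q p)) : Prop :=
  (∀ a, B (X a) (x a) = 1) ∧ ∀ a b, a ≠ b → B (X a) (x b) = 0

/-- `T = ∑ Xᵃ ⊗ xₐ` is the universal T-matrix: dual bases exist, and `T` is this sum for all of
them. -/
def IsUniversalT {q : ℂ} {p : ℕ} (B : U q p →ₗ[ℂ] A q p →ₗ[ℂ] ℂ) (T : Completed q p) : Prop :=
  (∃ (ι : Type) (X : Module.Basis ι ℂ (U q p)) (x : Module.Basis ι ℂ (A.polyPart q p)),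
    AreDualBases B X x) ∧
  ∀ (ι : Type) (X : Module.Basis ι ℂ (U q p)) (x : Module.Basis ι ℂ (A.polyPart q p)),
    AreDualBases B X x →
      HasFormalSum (fun a => toCompleted (X a ⊗ₜ[ℂ] (x a : A q p))) T

/-- The index set of the monomial bases. -/
abbrev MonIdx (p : ℕ) : Type := ℕ × ℕ × Fin p × Fin p × Fin p

end QPoincare

end

/-!
The pairing is `⟨X, F⟩ = ε(X · F)` for an action of `U_q(e(1,1))` on `A(E_q(1,1))` by
`X · F = (id ⊗ X)Δ(F)`. The action is written down on generators. The element `κ` acts by the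
automorphism `δ ↦ qδ`. The element `p_±` acts as a twisted derivation which on `A(E(1,1|p))` is
determined by `p_± η_± = i q^{±1/2} δ^{±1}`, and on a smooth function `f` is `D_± ∂_± f` with `D_±`
a multiple of `η_±^{p-1} δ^{±1}` (`Ared.corner`). That this is `(id ⊗ p_±)Δ(f)` comes from the terms
of `B_±` that are linear in the second factor. Both cases of the sign are treated at once, with a
`Bool` for the sign.

Three facts make `ε(X · F)` a duality pairing: the operators satisfy the relations of `U_q(e(1,1))`
(`rep`), `A(E_q(1,1))` is a module algebra (`rep_mul`), and the operators commute with the coaction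
`F ↦ Δ(F)(x, ·)` (`rep_coact`). The last one is where the precise form of `B_±` matters: it amounts
to `Δ(D_±) = 1 ⊗ D_± + (id ⊗ p_±) B_±` (`Ared.comul_corner`), an instance of the binomial formula
for `(η ⊗ 1 + δ ⊗ η)^{p-1}`, and to `((id ⊗ p_±) B_±) B_± = 0`, which holds because `η_±^p = 0`.
The pairing is unique because the axioms determine `⟨XY, ·⟩` from `⟨X, ·⟩` and `⟨Y, ·⟩`, and the
values on a generator from those on generators (`isDualityPairing_unique`).

For the duality relations, `P_± = p_±^p` is primitive, so it acts as a derivation, and this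
derivation is `i ∂_±` (`rep_pS_pow`): it kills the generators of `A(E(1,1|p))`, while
`p_±^{p-1} D_±` is a scalar, which the choice `(q^{1/2})^p = -1` makes equal to `i`. For `n, m < p`
the operators `p_+ⁿ p_-ᵐ` see the functions only through terms divisible by a power of `η_±`, which
the counit kills (`counit_lTensor_der_pow_der_pow`); what remains is the `q`-differentiation of
`η_+ⁿ η_-ᵐ ζ(k)` (`Ared.counit_der_pow_der_pow`). Together these give `pairing_monomial`, and
linear independence on both sides follows since the matrix is a permuted invertible diagonal one.

Write `Y_{tsnmk}` for the multiple of a monomial of `U_q(e(1,1))` that is dual to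
`z_+ᵗ z_-ˢ η_+ⁿ η_-ᵐ ζ(k)`. The Taylor coefficient of degree `(t, s)` of `X ⊗ F` is
`∑ ⟨Y_{tsnmk}, F⟩ X ⊗ η_+ⁿ η_-ᵐ ζ(k)`, summed over `n, m, k`. Hence `∑ Xᵃ ⊗ xₐ` has the coefficient
`∑ Y_{tsnmk} ⊗ η_+ⁿ η_-ᵐ ζ(k)` for all dual bases (`hasFormalSum_of_areDualBases`), and the product
of exponentials has the same coefficient once the powers of `κ` are moved to the right
(`coeff_universalT`).
-/

noncomputable section

namespace QPoincare

/-! ### Smooth functions of the plane -/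

namespace Smooth

theorem differentiableAt {E : Type} [NormedAddCommGroup E] [NormedSpace ℝ E] (f : Smooth E)
    (x : E) : DifferentiableAt ℝ f.1 x :=
  (Smooth.contDiff f).differentiable (by simp) x

end Smooth

theorem dirDeriv_mul (v : Plane) (f g : Smooth Plane) :
    dirDeriv v (f * g) = f * dirDeriv v g + dirDeriv v f * g := by
  refine Subtype.ext (funext fun x => ?_)
  change fderiv ℝ (f.1 * g.1) x v = f.1 x * fderiv ℝ g.1 x v + fderiv ℝ f.1 x v * g.1 x
  rw [fderiv_mul (Smooth.differentiableAt f x) (Smooth.differentiableAt g x)]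
  simp [mul_comm]

theorem dirDeriv_one (v : Plane) : dirDeriv v 1 = 0 := by
  refine Subtype.ext (funext fun x => ?_)
  change fderiv ℝ (fun _ => (1 : ℂ)) x v = 0
  simp

theorem dirDeriv_comm (v w : Plane) (f : Smooth Plane) :
    dirDeriv v (dirDeriv w f) = dirDeriv w (dirDeriv v f) := by
  refine Subtype.ext (funext fun x => ?_)
  have hd : DifferentiableAt ℝ (fderiv ℝ f.1) x :=
    ((Smooth.contDiff f).fderiv_right (m := 1) (by norm_cast)).differentiable (by simp) x
  have key : ∀ a b : Plane, fderiv ℝ (fun y => fderiv ℝ f.1 y a) x b =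
      fderiv ℝ (fderiv ℝ f.1) x b a := by
    intro a b
    rw [fderiv_clm_apply hd (differentiableAt_const a)]
    simp
  have hs : IsSymmSndFDerivAt ℝ f.1 x :=
    (Smooth.contDiff f).contDiffAt.isSymmSndFDerivAt (by
      rw [minSmoothness_of_isRCLikeNormedField]
      exact WithTop.coe_le_coe.2 (le_top : (2 : ℕ∞) ≤ ⊤))
  change fderiv ℝ (fun y => fderiv ℝ f.1 y w) x v = fderiv ℝ (fun y => fderiv ℝ f.1 y v) x w
  rw [key, key, hs.eq]

/-- Translation `f ↦ f(x + ·)`. -/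
def translate (x : Plane) : Smooth Plane →ₗ[ℂ] Smooth Plane := restrictSnd x ∘ₗ atZ

theorem translate_dirDeriv (x v : Plane) (f : Smooth Plane) :
    dirDeriv v (translate x f) = translate x (dirDeriv v f) := by
  refine Subtype.ext (funext fun y => ?_)
  change fderiv ℝ (fun y => f.1 (x + y)) y v = fderiv ℝ f.1 (x + y) v
  rw [fderiv_comp_add_left]

theorem evalC_translate (x : Plane) (f : Smooth Plane) :
    evalC 0 (translate x f) = evalC x f := by
  change f.1 (x + 0) = f.1 x
  rw [add_zero]

theorem dPlus_coordPlus : dPlus coordPlus = 1 := by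
  refine Subtype.ext (funext fun x => ?_)
  change fderiv ℝ (Complex.ofRealCLM ∘L ContinuousLinearMap.fst ℝ ℝ ℝ) x (1, 0) = 1
  rw [ContinuousLinearMap.fderiv]
  simp

theorem dPlus_coordMinus : dPlus coordMinus = 0 := by
  refine Subtype.ext (funext fun x => ?_)
  change fderiv ℝ (Complex.ofRealCLM ∘L ContinuousLinearMap.snd ℝ ℝ ℝ) x (1, 0) = 0
  rw [ContinuousLinearMap.fderiv]
  simp

theorem dMinus_coordPlus : dMinus coordPlus = 0 := by
  refine Subtype.ext (funext fun x => ?_)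
  change fderiv ℝ (Complex.ofRealCLM ∘L ContinuousLinearMap.fst ℝ ℝ ℝ) x (0, 1) = 0
  rw [ContinuousLinearMap.fderiv]
  simp

theorem dMinus_coordMinus : dMinus coordMinus = 1 := by
  refine Subtype.ext (funext fun x => ?_)
  change fderiv ℝ (Complex.ofRealCLM ∘L ContinuousLinearMap.snd ℝ ℝ ℝ) x (0, 1) = 1
  rw [ContinuousLinearMap.fderiv]
  simp

/-- A derivative in a direction in which `z` has slope one and `g` is constant. -/
theorem dirDeriv_pow_mul {v : Plane} {z g : Smooth Plane} (hz : dirDeriv v z = 1)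
    (hg : dirDeriv v g = 0) (n : ℕ) :
    dirDeriv v (z ^ (n + 1) * g) = ((n + 1 : ℕ) : ℂ) • (z ^ n * g) := by
  have h : ∀ n : ℕ, dirDeriv v (z ^ (n + 1)) = ((n + 1 : ℕ) : ℂ) • z ^ n := by
    intro n
    induction n with
    | zero => simp [hz]
    | succ n ih =>
      rw [pow_succ, dirDeriv_mul, hz, ih, smul_mul_assoc, ← pow_succ, mul_one,
        Nat.cast_succ (n + 1), add_smul, one_smul, add_comm]
  rw [dirDeriv_mul, hg, h, mul_zero, zero_add, smul_mul_assoc]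

theorem dirDeriv_pow_eq_zero {v : Plane} {g : Smooth Plane} (hg : dirDeriv v g = 0) (n : ℕ) :
    dirDeriv v (g ^ n) = 0 := by
  induction n with
  | zero => exact dirDeriv_one v
  | succ n ih => rw [pow_succ, dirDeriv_mul, hg, ih]; simp

/-- Modulo the ideal generated by `z`, `∂ᵗ(zⁿ g)` is `n! g` if `t = n` and zero otherwise. In this
form the induction goes through for all `n` at once, and evaluation at a zero of `z` removes the
remainder. -/
theorem iterate_dirDeriv_pow_mul {v : Plane} {z g : Smooth Plane} (hz : dirDeriv v z = 1)
    (hg : dirDeriv v g = 0) (t n : ℕ) :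
    ∃ f : Smooth Plane, (dirDeriv v ^ t) (z ^ n * g) =
      (if t = n then (n.factorial : ℂ) else 0) • g + z * f := by
  induction t generalizing n with
  | zero =>
    cases n with
    | zero => exact ⟨0, by simp⟩
    | succ n => exact ⟨z ^ n * g, by simp [pow_succ', mul_assoc]⟩
  | succ t ih =>
    cases n with
    | zero => exact ⟨0, by rw [pow_succ, Module.End.mul_apply]; simp [hg]⟩
    | succ n =>
      obtain ⟨f, hf⟩ := ih n
      refine ⟨((n + 1 : ℕ) : ℂ) • f, ?_⟩
      rw [pow_succ, Module.End.mul_apply, dirDeriv_pow_mul hz hg, map_smul, hf, smul_add, smul_smul,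
        mul_smul_comm]
      congr 2
      by_cases h : t = n
      · simp [h, Nat.factorial_succ]
      · simp [h]

theorem evalC_mul (x : Plane) (f g : Smooth Plane) :
    evalC x (f * g) = evalC x f * evalC x g := rfl

theorem evalC_iterate_monomial (t s t' s' : ℕ) :
    evalC 0 ((dPlus ^ t) ((dMinus ^ s) (coordPlus ^ t' * coordMinus ^ s'))) =
      if t = t' ∧ s = s' then (t.factorial : ℂ) * s.factorial else 0 := by
  have h0 : evalC 0 coordPlus = 0 := by change ((0 : ℝ) : ℂ) = 0; simp
  have h1 : evalC 0 coordMinus = 0 := by change ((0 : ℝ) : ℂ) = 0; simp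
  have comm : ∀ f, (dPlus ^ t) ((dMinus ^ s) f) = (dMinus ^ s) ((dPlus ^ t) f) := by
    have : Commute dPlus dMinus := LinearMap.ext fun f => dirDeriv_comm _ _ f
    exact fun f => LinearMap.congr_fun (this.pow_pow t s).eq f
  -- `∂₋` preserves the ideal generated by `z₊`, so that the remainder still vanishes at the origin
  have hP : ∀ (n : ℕ) (f : Smooth Plane), ∃ f', (dMinus ^ n) (coordPlus * f) = coordPlus * f' := by
    intro n
    induction n with
    | zero => exact fun f => ⟨f, rfl⟩
    | succ n ih =>
      intro f
      obtain ⟨f', hf'⟩ := ih (dMinus f)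
      refine ⟨f', ?_⟩
      rw [pow_succ, Module.End.mul_apply, ← hf']
      congr 1
      refine (dirDeriv_mul _ _ _).trans ?_
      change coordPlus * dMinus f + dMinus coordPlus * f = _
      rw [dMinus_coordPlus, zero_mul, add_zero]
  obtain ⟨f, hf⟩ := iterate_dirDeriv_pow_mul (v := (1, 0)) dPlus_coordPlus
    (dirDeriv_pow_eq_zero dPlus_coordMinus s') t t'
  change (dPlus ^ t) _ = _ at hf
  rw [comm, hf, map_add, map_smul, map_add, map_smul]
  obtain ⟨f', hf'⟩ := hP s f
  obtain ⟨g, hg⟩ := iterate_dirDeriv_pow_mul (v := (0, 1)) (g := 1) dMinus_coordMinus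
    (dirDeriv_one _) s s'
  change (dMinus ^ s) _ = _ at hg
  rw [mul_one] at hg
  rw [hf', hg, map_add, map_smul, evalC_mul, evalC_mul, h0, h1]
  have h2 : evalC 0 (1 : Smooth Plane) = 1 := rfl
  rw [h2]
  by_cases ht : t = t' <;> by_cases hs : s = s' <;> simp [ht, hs]

/-! ### Quantum integers -/

theorem qInt_inv (q : ℂ) (n : ℕ) : qInt q⁻¹ n = qInt q n := by
  rw [qInt, qInt, inv_inv, ← neg_sub (q ^ n), ← neg_sub q, neg_div_neg_eq]

theorem qFact_inv (q : ℂ) (n : ℕ) : qFact q⁻¹ n = qFact q n :=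
  Finset.prod_congr rfl fun _ _ => qInt_inv q _

theorem qFact_zero (q : ℂ) : qFact q 0 = 1 := rfl

theorem qFact_succ (q : ℂ) (n : ℕ) : qFact q (n + 1) = qFact q n * qInt q (n + 1) :=
  Finset.prod_range_succ _ _

section PrimitiveRoot

variable {w : ℂ} {p : ℕ}

theorem sub_inv_ne_zero (hodd : Odd p) (hp : 1 < p) (hw : IsPrimitiveRoot w p) {n : ℕ} (h0 : 0 < n)
    (hn : n < p) : w ^ n - w⁻¹ ^ n ≠ 0 := by
  have hw0 : w ≠ 0 := hw.ne_zero (by omega)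
  intro h
  have h1 : (w ^ 2) ^ n = 1 := by
    rw [← pow_mul, mul_comm, pow_mul, sq]
    nth_rewrite 2 [sub_eq_zero.mp h]
    rw [← mul_pow, mul_inv_cancel₀ hw0, one_pow]
  exact (Ared.prim_sq hodd hw).pow_ne_one_of_pos_of_lt (by omega) hn h1

theorem sub_inv_ne_zero' (hodd : Odd p) (hp : 1 < p) (hw : IsPrimitiveRoot w p) :
    w - w⁻¹ ≠ 0 := by
  simpa using sub_inv_ne_zero hodd hp hw one_pos hp

theorem qInt_ne_zero (hodd : Odd p) (hp : 1 < p) (hw : IsPrimitiveRoot w p) {n : ℕ} (h0 : 0 < n)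
    (hn : n < p) : qInt w n ≠ 0 :=
  div_ne_zero (sub_inv_ne_zero hodd hp hw h0 hn) (sub_inv_ne_zero' hodd hp hw)

theorem qFact_ne_zero (hodd : Odd p) (hp : 1 < p) (hw : IsPrimitiveRoot w p) {n : ℕ}
    (hn : n < p) : qFact w n ≠ 0 :=
  Finset.prod_ne_zero_iff.mpr fun i hi =>
    qInt_ne_zero hodd hp hw (by omega) (by rw [Finset.mem_range] at hi; omega)

theorem qInt_one (hodd : Odd p) (hp : 1 < p) (hw : IsPrimitiveRoot w p) : qInt w 1 = 1 := by
  rw [qInt, pow_one, pow_one, div_self (sub_inv_ne_zero' hodd hp hw)]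

/-- `w⁻ⁿ [n + 1] = 1 + w^{-(n+1)} [n]`. -/
theorem qInt_succ (hodd : Odd p) (hp : 1 < p) (hw : IsPrimitiveRoot w p) (n : ℕ) :
    w⁻¹ ^ n * qInt w (n + 1) = 1 + w⁻¹ ^ (n + 1) * qInt w n := by
  have h := sub_inv_ne_zero' hodd hp hw
  have e1 : w * w⁻¹ = 1 := mul_inv_cancel₀ (hw.ne_zero (by omega))
  have e : w ^ n * w⁻¹ ^ n = 1 := by rw [← mul_pow, e1, one_pow]
  rw [qInt, qInt, ← mul_div_assoc, ← mul_div_assoc, div_eq_iff h, add_mul, div_mul_cancel₀ _ h,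
    pow_succ, pow_succ]
  linear_combination (w - w⁻¹) * e

end PrimitiveRoot

/-! ### Induction principles -/

theorem U.induction {q : ℂ} {p : ℕ} {P : U q p → Prop} (halg : ∀ c : ℂ, P (algebraMap ℂ _ c))
    (hadd : ∀ x y, P x → P y → P (x + y)) (hmul : ∀ x y, P x → P y → P (x * y))
    (hgen : ∀ g, P (U.gen q p g)) (x : U q p) : P x := by
  obtain ⟨y, rfl⟩ := RingQuot.mkAlgHom_surjective ℂ (URel q p) x
  induction y using FreeAlgebra.induction with
  | grade0 c => rw [AlgHom.commutes]; exact halg c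
  | grade1 g => exact hgen g
  | mul a b ha hb => rw [map_mul]; exact hmul _ _ ha hb
  | add a b ha hb => rw [map_add]; exact hadd _ _ ha hb

theorem Ared.induction {q : ℂ} {p : ℕ} {P : Ared q p → Prop}
    (halg : ∀ c : ℂ, P (algebraMap ℂ _ c))
    (hadd : ∀ x y, P x → P y → P (x + y)) (hmul : ∀ x y, P x → P y → P (x * y))
    (hgen : ∀ g, P (Ared.gen q p g)) (x : Ared q p) : P x := by
  obtain ⟨y, rfl⟩ := RingQuot.mkAlgHom_surjective ℂ (ARel q p) x
  induction y using FreeAlgebra.induction with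
  | grade0 c => rw [AlgHom.commutes]; exact halg c
  | grade1 g => exact hgen g
  | mul a b ha hb => rw [map_mul]; exact hmul _ _ ha hb
  | add a b ha hb => rw [map_add]; exact hadd _ _ ha hb

/-- A property that is closed under sums and products and holds for the generators of `A(E(1,1|p))`
and for smooth functions holds on `A(E_q(1,1))`; scalars are constant functions. -/
theorem A.induction {q : ℂ} {p : ℕ} {P : A q p → Prop}
    (hadd : ∀ x y, P x → P y → P (x + y)) (hmul : ∀ x y, P x → P y → P (x * y))
    (hgen : ∀ g, P (Ared.gen q p g ⊗ₜ 1)) (hsmooth : ∀ f, P (A.ofSmooth q p f)) (x : A q p) :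
    P x := by
  have h0 : ∀ c : ℂ, P (algebraMap ℂ _ c) := fun c => by
    have h := hsmooth (algebraMap ℂ _ c)
    rwa [A.ofSmooth, Algebra.algebraMap_eq_smul_one, tmul_smul, ← Algebra.TensorProduct.one_def,
      ← Algebra.algebraMap_eq_smul_one] at h
  induction x using TensorProduct.induction_on with
  | zero => simpa using h0 0
  | add x y hx hy => exact hadd _ _ hx hy
  | tmul a f =>
    have h1 : P (a ⊗ₜ 1) := by
      induction a using Ared.induction with
      | halg c =>
        have h := h0 c
        rwa [Algebra.algebraMap_eq_smul_one, Algebra.TensorProduct.one_def, smul_tmul',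
          ← Algebra.algebraMap_eq_smul_one] at h
      | hadd x y hx hy => rw [add_tmul]; exact hadd _ _ hx hy
      | hmul x y hx hy =>
        have h := hmul _ _ hx hy
        rwa [Algebra.TensorProduct.tmul_mul_tmul, mul_one] at h
      | hgen g => exact hgen g
    have h := hmul _ _ h1 (hsmooth f)
    rwa [A.ofSmooth, Algebra.TensorProduct.tmul_mul_tmul, mul_one, one_mul] at h

/-! ### Commutation up to a scalar -/

section QComm

variable {R : Type*} [Ring R] [Algebra ℂ R] {c : ℂ} {x y : R}

theorem qcomm_pow_left (h : x * y = c • (y * x)) (n : ℕ) : x ^ n * y = c ^ n • (y * x ^ n) := by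
  induction n with
  | zero => simp
  | succ n ih =>
    rw [pow_succ, mul_assoc, h, mul_smul_comm, ← mul_assoc, ih, smul_mul_assoc, smul_smul,
      mul_assoc, ← pow_succ']

theorem qcomm_pow_right (h : x * y = c • (y * x)) (n : ℕ) : x * y ^ n = c ^ n • (y ^ n * x) := by
  induction n with
  | zero => simp
  | succ n ih =>
    rw [pow_succ, ← mul_assoc, ih, smul_mul_assoc, mul_assoc, h, mul_smul_comm, smul_smul,
      ← mul_assoc, pow_succ]

theorem qcomm_pow_pow (h : x * y = c • (y * x)) (m n : ℕ) :
    x ^ m * y ^ n = c ^ (m * n) • (y ^ n * x ^ m) := by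
  rw [pow_mul]
  exact qcomm_pow_right (qcomm_pow_left h m) n

theorem qcomm_symm (hc : c ≠ 0) (h : x * y = c • (y * x)) : y * x = c⁻¹ • (x * y) := by
  rw [h, smul_smul, inv_mul_cancel₀ hc, one_smul]

end QComm

/-! ### The two signs -/

/-- The parameter `q^{±1}` that goes with the sign `±`; `true` stands for `+`. -/
def wt (q : ℂ) : Bool → ℂ
  | true => q
  | false => q⁻¹

theorem wt_not (q : ℂ) (s : Bool) : wt q (!s) = (wt q s)⁻¹ := by
  cases s <;> simp [wt]

theorem wt_prim {q : ℂ} {p : ℕ} (hq : IsPrimitiveRoot q p) (s : Bool) :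
    IsPrimitiveRoot (wt q s) p := by
  cases s
  · exact hq.inv
  · exact hq

theorem wt_ne_zero {q : ℂ} {p : ℕ} (hodd : Odd p) (hq : IsPrimitiveRoot q p) (s : Bool) :
    wt q s ≠ 0 :=
  (wt_prim hq s).ne_zero hodd.pos.ne'

theorem qFact_wt (q : ℂ) (s : Bool) (n : ℕ) : qFact (wt q s) n = qFact q n := by
  cases s
  · exact qFact_inv q n
  · rfl

/-- `∂/∂z_±`. -/
def dS : Bool → (Smooth Plane →ₗ[ℂ] Smooth Plane)
  | true => dPlus
  | false => dMinus

theorem dS_mul (s : Bool) (f g : Smooth Plane) : dS s (f * g) = f * dS s g + dS s f * g := by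
  cases s <;> exact dirDeriv_mul _ f g

theorem dS_one (s : Bool) : dS s 1 = 0 := by
  cases s <;> exact dirDeriv_one _

theorem dS_comm (s t : Bool) (f : Smooth Plane) : dS s (dS t f) = dS t (dS s f) := by
  cases s <;> cases t <;> exact dirDeriv_comm _ _ f

theorem dS_translate (s : Bool) (x : Plane) (f : Smooth Plane) :
    dS s (translate x f) = translate x (dS s f) := by
  cases s <;> exact translate_dirDeriv x _ f

namespace Ared

variable (q : ℂ) (p : ℕ)

/-- The generator `η_±`. -/
def etaS : Bool → Ared q p
  | true => etaPlus q p
  | false => etaMinus q p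

/-- `δ^{±1}`. -/
def delS : Bool → Ared q p
  | true => del q p
  | false => delInv q p

theorem etaS_pow (s : Bool) : etaS q p s ^ p = 0 := by
  cases s
  · exact minus_pow q p
  · exact plus_pow q p

theorem delS_pow (s : Bool) : delS q p s ^ p = 1 := by
  cases s
  · rw [delS, delInv, ← pow_mul, mul_comm, pow_mul, del_pow, one_pow]
  · exact del_pow q p

variable {q p}

theorem delS_comm (s t : Bool) : Commute (delS q p s) (delS q p t) := by
  have h : ∀ s, ∃ n, delS q p s = del q p ^ n := by
    rintro (_ | _)
    · exact ⟨_, rfl⟩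
    · exact ⟨1, (pow_one _).symm⟩
  obtain ⟨m, hm⟩ := h s
  obtain ⟨n, hn⟩ := h t
  rw [hm, hn]
  exact Commute.pow_pow_self _ _ _

theorem etaS_mul_delS (hodd : Odd p) (hq : IsPrimitiveRoot q p) (s t : Bool) :
    etaS q p s * delS q p t = (wt q t) ^ 2 • (delS q p t * etaS q p s) := by
  have h0 : q ^ 2 ≠ 0 := pow_ne_zero _ (hq.ne_zero hodd.pos.ne')
  have h : ∀ s, etaS q p s * del q p = q ^ 2 • (del q p * etaS q p s) := by
    rintro (_ | _)
    · exact minus_del q p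
    · exact plus_del q p
  cases t
  · rw [wt, inv_pow, delS]
    exact qcomm_symm h0 (delInv_comm hodd.pos (h s))
  · exact h s

theorem etaS_mul_not (hodd : Odd p) (hq : IsPrimitiveRoot q p) (s : Bool) :
    etaS q p s * etaS q p (!s) = (wt q s)⁻¹ ^ 2 • (etaS q p (!s) * etaS q p s) := by
  have h0 : q ^ 2 ≠ 0 := pow_ne_zero _ (hq.ne_zero hodd.pos.ne')
  cases s
  · rw [wt, inv_inv]
    exact eta q p
  · rw [inv_pow]
    exact qcomm_symm h0 (eta q p)

/-! ### The actions of `κ` and of `p_±` on `A(E(1,1|p))` -/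

/-- The automorphism `η_± ↦ η_±`, `δ ↦ q^{±1} δ`, by which `κ^{±1}` acts. -/
def kapAct (hq : IsPrimitiveRoot q p) (s : Bool) : Ared q p →ₐ[ℂ] Ared q p :=
  lift (etaPlus q p) (etaMinus q p) (wt q s • del q p) (eta q p)
    (by rw [mul_smul_comm, plus_del, smul_mul_assoc, smul_comm])
    (by rw [mul_smul_comm, minus_del, smul_mul_assoc, smul_comm])
    (by rw [smul_pow, del_pow, (wt_prim hq s).pow_eq_one, one_smul])
    (plus_pow q p) (minus_pow q p)

theorem kapAct_etaS (hq : IsPrimitiveRoot q p) (s t : Bool) :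
    kapAct hq s (etaS q p t) = etaS q p t := by
  cases t <;> exact lift_gen _ _ _ _ _ _ _ _ _ _

theorem kapAct_del (hq : IsPrimitiveRoot q p) (s : Bool) :
    kapAct hq s (del q p) = wt q s • del q p :=
  lift_gen _ _ _ _ _ _ _ _ _ _

theorem kapAct_delS (hodd : Odd p) (hq : IsPrimitiveRoot q p) (s t : Bool) :
    kapAct hq s (delS q p t) = wt (wt q s) t • delS q p t := by
  cases t
  · rw [delS, delInv, map_pow, kapAct_del, smul_pow]
    congr 1
    refine eq_inv_of_mul_eq_one_left ?_
    rw [← pow_succ, Nat.sub_add_cancel hodd.pos, (wt_prim hq s).pow_eq_one]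
  · exact kapAct_del hq s

theorem kapAct_not (hodd : Odd p) (hq : IsPrimitiveRoot q p) (s : Bool) (a : Ared q p) :
    kapAct hq s (kapAct hq (!s) a) = a := by
  have h0 := wt_ne_zero hodd hq s
  have h1 : ∀ t, kapAct hq s (kapAct hq (!s) (etaS q p t)) = etaS q p t := fun t => by
    rw [kapAct_etaS, kapAct_etaS]
  induction a using Ared.induction with
  | halg c => simp
  | hadd x y hx hy => rw [map_add, map_add, hx, hy]
  | hmul x y hx hy => rw [map_mul, map_mul, hx, hy]
  | hgen g =>
    cases g
    · exact h1 true
    · exact h1 false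
    · change kapAct hq s (kapAct hq (!s) (del q p)) = del q p
      rw [kapAct_del, map_smul, kapAct_del, smul_smul, wt_not, inv_mul_cancel₀ h0, one_smul]

/-- The upper triangular matrix with diagonal `a, b` and corner `u`. -/
def upper {R : Type*} [Ring R] (a u b : R) : Matrix (Fin 2) (Fin 2) R := !![a, u; 0, b]

section Upper

variable {R : Type*} [Ring R]

theorem upper_mul (a u b a' u' b' : R) :
    upper a u b * upper a' u' b' = upper (a * a') (a * u' + u * b') (b * b') := by
  ext i j
  fin_cases i <;> fin_cases j <;> simp [upper, Matrix.mul_apply, Fin.sum_univ_two]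

theorem upper_add (a u b a' u' b' : R) :
    upper a u b + upper a' u' b' = upper (a + a') (u + u') (b + b') := by
  ext i j
  fin_cases i <;> fin_cases j <;> simp [upper]

theorem smul_upper [Algebra ℂ R] (c : ℂ) (a u b : R) :
    c • upper a u b = upper (c • a) (c • u) (c • b) := by
  ext i j
  fin_cases i <;> fin_cases j <;> simp [upper]

theorem upper_zero : upper (0 : R) 0 0 = 0 := by
  ext i j
  fin_cases i <;> fin_cases j <;> simp [upper]

theorem upper_one : upper (1 : R) 0 1 = 1 := by
  ext i j
  fin_cases i <;> fin_cases j <;> simp [upper]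

theorem upper_diag_pow (a b : R) (n : ℕ) : upper a 0 b ^ n = upper (a ^ n) 0 (b ^ n) := by
  induction n with
  | zero => simp [upper_one]
  | succ n ih => rw [pow_succ, ih, upper_mul]; simp [pow_succ]

/-- The square of the strictly upper triangular part is zero and the parts commute up to `w`, so the
`p`-th power is additive. -/
theorem upper_pow_eq_zero [Algebra ℂ R] {p : ℕ} (hp : 1 < p) {w : ℂ}
    (hw : IsPrimitiveRoot w p) {a u : R} (ha : a ^ p = 0) (h : a * u = w • (u * a)) :
    upper a u a ^ p = 0 := by
  have e : upper a u a = upper a 0 a + upper 0 u 0 := by rw [upper_add]; simp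
  have hz : upper 0 u 0 ^ p = 0 := by
    obtain ⟨n, rfl⟩ : ∃ n, p = n + 2 := ⟨p - 2, by omega⟩
    rw [pow_add, sq, upper_mul]
    simp [upper_zero]
  rw [e, add_pow_prim (by omega) hw, upper_diag_pow, ha, upper_zero, hz, add_zero]
  rw [upper_mul, upper_mul, smul_upper]
  simp [h]

end Upper

/-- The matrix that represents `η_t` in the upper triangular matrices encoding the action of `p_s`:
its corner is `p_s η_t = c δ^{±1}` for `t = s`, and zero otherwise. -/
def etaMat (q : ℂ) (p : ℕ) (s : Bool) (c : ℂ) (t : Bool) : Matrix (Fin 2) (Fin 2) (Ared q p) :=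
  upper (etaS q p t) (if t = s then c • delS q p s else 0) (etaS q p t)

theorem etaMat_pow (hodd : Odd p) (hp : 1 < p) (hq : IsPrimitiveRoot q p) (s : Bool) (c : ℂ)
    (t : Bool) : etaMat q p s c t ^ p = 0 := by
  refine upper_pow_eq_zero hp (prim_sq hodd (wt_prim hq s)) (etaS_pow q p t) ?_
  by_cases h : t = s
  · rw [if_pos h, mul_smul_comm, etaS_mul_delS hodd hq, smul_mul_assoc, smul_comm]
  · rw [if_neg h, mul_zero, zero_mul, smul_zero]

theorem etaMat_mul_del (hodd : Odd p) (hq : IsPrimitiveRoot q p) (s : Bool) (c : ℂ) (t : Bool) :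
    etaMat q p s c t * upper (q⁻¹ • del q p) 0 (q • del q p) =
      q ^ 2 • (upper (q⁻¹ • del q p) 0 (q • del q p) * etaMat q p s c t) := by
  have hq0 : q ≠ 0 := hq.ne_zero hodd.pos.ne'
  have h1 : etaS q p t * del q p = q ^ 2 • (del q p * etaS q p t) :=
    etaS_mul_delS hodd hq t true
  have h2 : delS q p s * del q p = del q p * delS q p s := (delS_comm s true).eq
  rw [etaMat, upper_mul, upper_mul, smul_upper]
  by_cases h : t = s
  · simp only [if_pos h, mul_zero, zero_mul, zero_add, add_zero, mul_smul_comm, smul_mul_assoc,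
      h1, h2, smul_smul]
    congr 2 <;> field_simp
  · simp only [if_neg h, mul_zero, zero_mul, add_zero, mul_smul_comm, smul_mul_assoc,
      h1, smul_zero]
    congr 1 <;> rw [smul_comm]

theorem etaMat_mul_etaMat (hodd : Odd p) (hq : IsPrimitiveRoot q p) (s : Bool) (c : ℂ) :
    etaMat q p s c false * etaMat q p s c true =
    q ^ 2 • (etaMat q p s c true * etaMat q p s c false) := by
  have hq0 : q ≠ 0 := hq.ne_zero hodd.pos.ne'
  have h : etaS q p false * etaS q p true = q ^ 2 • (etaS q p true * etaS q p false) := eta q p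
  rw [etaMat, etaMat, upper_mul, upper_mul, smul_upper, h]
  congr 1
  cases s
  · have h1 := etaS_mul_delS hodd hq true false
    have h2 : q ^ 2 * (c * q⁻¹ ^ 2) = c := by field_simp
    simp only [reduceIte, Bool.true_eq_false, mul_zero, add_zero, zero_add, zero_mul, mul_smul_comm,
      smul_mul_assoc, h1, wt, smul_smul, h2]
  · have h1 := etaS_mul_delS hodd hq false true
    simp only [reduceIte, Bool.false_eq_true, mul_zero, add_zero, zero_add, zero_mul, mul_smul_comm,
      smul_mul_assoc, h1, wt, smul_smul, mul_comm]

theorem delMat_pow (hq : IsPrimitiveRoot q p) :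
    upper (q⁻¹ • del q p) 0 (q • del q p) ^ p = 1 := by
  rw [upper_diag_pow, smul_pow, smul_pow, del_pow, inv_pow, hq.pow_eq_one, inv_one, one_smul,
    upper_one]

variable (hodd : Odd p) (hp : 1 < p) (hq : IsPrimitiveRoot q p)

/-- The algebra homomorphism `a ↦ (κ⁻¹ a, p_± a; 0, κ a)` into upper triangular matrices, for the
action of `p_±` with `p_± η_± = c δ^{±1}`. Multiplicativity is the twisted Leibniz rule. -/
def derMat (s : Bool) (c : ℂ) : Ared q p →ₐ[ℂ] Matrix (Fin 2) (Fin 2) (Ared q p) :=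
  lift (etaMat q p s c true) (etaMat q p s c false) (upper (q⁻¹ • del q p) 0 (q • del q p))
    (etaMat_mul_etaMat hodd hq s c) (etaMat_mul_del hodd hq s c true)
    (etaMat_mul_del hodd hq s c false) (delMat_pow hq) (etaMat_pow hodd hp hq s c true)
    (etaMat_pow hodd hp hq s c false)

theorem derMat_etaS (s t : Bool) (c : ℂ) :
    derMat hodd hp hq s c (etaS q p t) = etaMat q p s c t := by
  cases t <;> exact lift_gen _ _ _ (etaMat_mul_etaMat hodd hq s c)
    (etaMat_mul_del hodd hq s c true) (etaMat_mul_del hodd hq s c false) (delMat_pow hq)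
    (etaMat_pow hodd hp hq s c true) (etaMat_pow hodd hp hq s c false) _

theorem derMat_del (s : Bool) (c : ℂ) : derMat hodd hp hq s c (del q p) =
    upper (q⁻¹ • del q p) 0 (q • del q p) :=
  lift_gen _ _ _ (etaMat_mul_etaMat hodd hq s c)
    (etaMat_mul_del hodd hq s c true) (etaMat_mul_del hodd hq s c false) (delMat_pow hq)
    (etaMat_pow hodd hp hq s c true) (etaMat_pow hodd hp hq s c false) _

/-- The action of `p_±` on `A(E(1,1|p))`, normalised by `p_± η_± = c δ^{±1}`. -/
def der (s : Bool) (c : ℂ) : Ared q p →ₗ[ℂ] Ared q p :=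
  Matrix.entryLinearMap ℂ (Ared q p) 0 1 ∘ₗ (derMat hodd hp hq s c).toLinearMap

theorem derMat_eq (s : Bool) (c : ℂ) (a : Ared q p) : derMat hodd hp hq s c a =
    upper (kapAct hq false a) (der hodd hp hq s c a) (kapAct hq true a) := by
  suffices h : ∃ u, derMat hodd hp hq s c a = upper (kapAct hq false a) u (kapAct hq true a) by
    obtain ⟨u, hu⟩ := h
    have : der hodd hp hq s c a = u := by
      change derMat hodd hp hq s c a 0 1 = u
      rw [hu]
      rfl
    rw [this, hu]
  have h1 : ∀ t, ∃ u, derMat hodd hp hq s c (etaS q p t) =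
      upper (kapAct hq false (etaS q p t)) u (kapAct hq true (etaS q p t)) := fun t => by
    rw [kapAct_etaS, kapAct_etaS, derMat_etaS]
    exact ⟨_, rfl⟩
  induction a using Ared.induction with
  | halg k =>
    refine ⟨0, ?_⟩
    rw [AlgHom.commutes, AlgHom.commutes, AlgHom.commutes, Algebra.algebraMap_eq_smul_one,
      Algebra.algebraMap_eq_smul_one, ← upper_one, smul_upper, smul_zero]
  | hadd x y hx hy =>
    obtain ⟨u, hu⟩ := hx
    obtain ⟨v, hv⟩ := hy
    exact ⟨u + v, by simp only [map_add, hu, hv, upper_add]⟩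
  | hmul x y hx hy =>
    obtain ⟨u, hu⟩ := hx
    obtain ⟨v, hv⟩ := hy
    exact ⟨_, by simp only [map_mul, hu, hv, upper_mul]; rfl⟩
  | hgen g =>
    cases g
    · exact h1 true
    · exact h1 false
    · exact ⟨0, (derMat_del hodd hp hq s c).trans (by
        change _ = upper (kapAct hq false (del q p)) 0 (kapAct hq true (del q p))
        rw [kapAct_del, kapAct_del]; rfl)⟩

/-- The Leibniz rule dual to `Δ(p_±) = p_± ⊗ κ + κ⁻¹ ⊗ p_±`. -/
theorem der_mul (s : Bool) (c : ℂ) (a b : Ared q p) : der hodd hp hq s c (a * b) =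
    kapAct hq false a * der hodd hp hq s c b + der hodd hp hq s c a * kapAct hq true b := by
  have h := derMat_eq hodd hp hq s c (a * b)
  rw [map_mul, derMat_eq, derMat_eq, upper_mul] at h
  exact (congrFun (congrFun h 0) 1).symm

theorem der_etaS (s t : Bool) (c : ℂ) : der hodd hp hq s c (etaS q p t) =
    if t = s then c • delS q p s else 0 := by
  change derMat hodd hp hq s c (etaS q p t) 0 1 = _
  rw [derMat_etaS]
  rfl

theorem der_del (s : Bool) (c : ℂ) : der hodd hp hq s c (del q p) = 0 := by
  change derMat hodd hp hq s c (del q p) 0 1 = _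
  rw [derMat_del]
  rfl

theorem der_one (s : Bool) (c : ℂ) : der hodd hp hq s c 1 = 0 := by
  change derMat hodd hp hq s c 1 0 1 = _
  rw [map_one]
  rfl

theorem der_pow_eq_zero {s : Bool} {c : ℂ} {a : Ared q p} (ha : der hodd hp hq s c a = 0) (n : ℕ) :
    der hodd hp hq s c (a ^ n) = 0 := by
  induction n with
  | zero => rw [pow_zero, der_one]
  | succ n ih => rw [pow_succ, der_mul, ha, ih, mul_zero, zero_mul, add_zero]

theorem der_delS (s t : Bool) (c : ℂ) : der hodd hp hq s c (delS q p t) = 0 := by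
  cases t
  · exact der_pow_eq_zero hodd hp hq (der_del hodd hp hq s c) _
  · exact der_del hodd hp hq s c

theorem der_etaS_pow (s : Bool) (c : ℂ) (n : ℕ) : der hodd hp hq s c (etaS q p s ^ (n + 1)) =
    (c * (wt q s)⁻¹ ^ n * qInt (wt q s) (n + 1)) • (etaS q p s ^ n * delS q p s) := by
  have hw := wt_prim hq s
  have hdn : delS q p s * etaS q p s = ((wt q s)⁻¹ ^ 2) • (etaS q p s * delS q p s) := by
    rw [inv_pow]
    exact qcomm_symm (pow_ne_zero _ (wt_ne_zero hodd hq s)) (etaS_mul_delS hodd hq s s)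
  induction n with
  | zero => simp [der_etaS, qInt_one hodd hp hw]
  | succ n ih =>
    rw [pow_succ, der_mul, ih, der_etaS, if_pos rfl, kapAct_etaS, map_pow, kapAct_etaS,
      smul_mul_assoc, mul_assoc (_ ^ n), hdn, mul_smul_comm, mul_smul_comm, smul_smul, ← mul_assoc,
      ← pow_succ, ← add_smul, mul_assoc c _ (qInt _ (n + 1 + 1)), qInt_succ hodd hp hw]
    congr 1
    ring

end Ared

/-! ### The actions of `κ` and of `p_±` on `A(E_q(1,1))` -/

namespace Ared

variable {q : ℂ} {p : ℕ}

/-- The element `D` with `p_± f = D ∂_± f`, when `p_± η_± = c δ^{±1}`. -/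
def corner (q : ℂ) (p : ℕ) (s : Bool) (c : ℂ) : Ared q p :=
  ((-1) ^ ((p + 1) / 2) * wt q s * c / qFact q (p - 1)) • (etaS q p s ^ (p - 1) * delS q p s)

theorem etaS_pow_eq_zero (s : Bool) {n : ℕ} (hn : p ≤ n) : etaS q p s ^ n = 0 :=
  pow_eq_zero_of_le hn (etaS_pow q p s)

theorem delS_mul_etaS (hodd : Odd p) (hq : IsPrimitiveRoot q p) (s t : Bool) :
    delS q p t * etaS q p s = (wt q t)⁻¹ ^ 2 • (etaS q p s * delS q p t) := by
  rw [inv_pow]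
  exact qcomm_symm (pow_ne_zero _ (wt_ne_zero hodd hq t)) (etaS_mul_delS hodd hq s t)

theorem kapAct_corner (hodd : Odd p) (hq : IsPrimitiveRoot q p) (s t : Bool) (c : ℂ) :
    kapAct hq t (corner q p s c) = wt (wt q t) s • corner q p s c := by
  rw [corner, map_smul, map_mul, map_pow, kapAct_etaS, kapAct_delS hodd, mul_smul_comm, smul_comm]

theorem etaS_mul_corner (hodd : Odd p) (hq : IsPrimitiveRoot q p) (s t : Bool) (c : ℂ) :
    etaS q p t * corner q p s c = corner q p s c * etaS q p t := by
  have hp1 : p - 1 + 1 = p := Nat.sub_add_cancel hodd.pos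
  rw [corner, mul_smul_comm, smul_mul_assoc]
  congr 1
  by_cases h : t = s
  · subst h
    rw [← mul_assoc, ← pow_succ', hp1, etaS_pow, zero_mul, mul_assoc, delS_mul_etaS hodd hq,
      mul_smul_comm, ← mul_assoc, ← pow_succ, hp1, etaS_pow, zero_mul, smul_zero]
  · obtain rfl : t = !s := by cases s <;> cases t <;> simp_all
    have h1 := etaS_mul_not hodd hq (!s)
    rw [Bool.not_not, wt_not, inv_inv] at h1
    rw [← mul_assoc, qcomm_pow_right h1, smul_mul_assoc, mul_assoc, etaS_mul_delS hodd hq,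
      mul_smul_comm, smul_smul, ← pow_succ, hp1, ← mul_assoc, ← pow_mul, mul_comm 2, pow_mul,
      (wt_prim hq s).pow_eq_one, one_pow, one_smul]

/-- The commutation rule for `D` that makes `a f ↦ (p_± a) f + (κ⁻¹ a) D ∂_± f` a twisted
derivation. -/
theorem kapAct_mul_corner (hodd : Odd p) (hq : IsPrimitiveRoot q p) (s : Bool) (c : ℂ)
    (a : Ared q p) :
    kapAct hq false a * corner q p s c = corner q p s c * kapAct hq true a := by
  have hp1 : p - 1 + 1 = p := Nat.sub_add_cancel hodd.pos
  have h1 : ∀ t, kapAct hq false (etaS q p t) * corner q p s c =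
      corner q p s c * kapAct hq true (etaS q p t) := fun t => by
    rw [kapAct_etaS, kapAct_etaS, etaS_mul_corner hodd hq]
  induction a using Ared.induction with
  | halg k => rw [AlgHom.commutes, AlgHom.commutes, Algebra.commutes]
  | hadd x y hx hy => rw [map_add, map_add, add_mul, hx, hy, mul_add]
  | hmul x y hx hy => rw [map_mul, map_mul, mul_assoc, hy, ← mul_assoc, hx, mul_assoc]
  | hgen g =>
    cases g
    · exact h1 true
    · exact h1 false
    · change kapAct hq false (del q p) * _ = _ * kapAct hq true (del q p)
      have h2 : delS q p s * del q p = del q p * delS q p s := (delS_comm s true).eq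
      have h3 : etaS q p s * del q p = q ^ 2 • (del q p * etaS q p s) :=
        etaS_mul_delS hodd hq s true
      have h4 : q * (q ^ 2) ^ (p - 1) = q⁻¹ := by
        refine eq_inv_of_mul_eq_one_left ?_
        calc q * (q ^ 2) ^ (p - 1) * q = (q ^ 2) ^ (p - 1 + 1) := by ring
          _ = 1 := by rw [hp1, ← pow_mul, mul_comm, pow_mul, hq.pow_eq_one, one_pow]
      rw [kapAct_del, kapAct_del, corner, mul_smul_comm, smul_mul_assoc, smul_mul_assoc,
        mul_smul_comm, mul_assoc _ (delS q p s), h2, ← mul_assoc _ (del q p), qcomm_pow_left h3,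
        smul_mul_assoc, wt, wt, smul_smul q, h4, mul_assoc (del q p),
        smul_smul]

end Ared

namespace A

variable {q : ℂ} {p : ℕ}

/-- The action of `κ^{±1}` on `A(E_q(1,1))`. -/
def kapAct (hq : IsPrimitiveRoot q p) (s : Bool) : A q p →ₐ[ℂ] A q p :=
  Algebra.TensorProduct.map (Ared.kapAct hq s) (AlgHom.id ℂ _)

theorem kapAct_tmul (hq : IsPrimitiveRoot q p) (s : Bool) (a : Ared q p) (f : Smooth Plane) :
    kapAct hq s (a ⊗ₜ f) = Ared.kapAct hq s a ⊗ₜ f := rfl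

theorem kapAct_not (hodd : Odd p) (hq : IsPrimitiveRoot q p) (s : Bool) (F : A q p) :
    kapAct hq s (kapAct hq (!s) F) = F := by
  induction F using TensorProduct.induction_on with
  | zero => simp
  | add x y hx hy => rw [map_add, map_add, hx, hy]
  | tmul a f => rw [kapAct_tmul, kapAct_tmul, Ared.kapAct_not hodd]

variable (hodd : Odd p) (hp : 1 < p) (hq : IsPrimitiveRoot q p)

/-- The action `a f ↦ (p_± a) f + (κ⁻¹ a) D ∂_± f` of `p_±` on `A(E_q(1,1))`, normalised by
`p_± η_± = c δ^{±1}`. -/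
def der (s : Bool) (c : ℂ) : A q p →ₗ[ℂ] A q p :=
  (Ared.der hodd hp hq s c).rTensor (Smooth Plane) +
    TensorProduct.map
      (LinearMap.mulRight ℂ (Ared.corner q p s c) ∘ₗ (Ared.kapAct hq false).toLinearMap) (dS s)

theorem der_tmul (s : Bool) (c : ℂ) (a : Ared q p) (f : Smooth Plane) :
    der hodd hp hq s c (a ⊗ₜ f) = Ared.der hodd hp hq s c a ⊗ₜ f +
      (Ared.kapAct hq false a * Ared.corner q p s c) ⊗ₜ dS s f := rfl

theorem der_mul (s : Bool) (c : ℂ) (F G : A q p) : der hodd hp hq s c (F * G) =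
    kapAct hq false F * der hodd hp hq s c G + der hodd hp hq s c F * kapAct hq true G := by
  induction F using TensorProduct.induction_on with
  | zero => simp
  | add x y hx hy => simp only [add_mul, map_add, hx, hy]; abel
  | tmul a f =>
    induction G using TensorProduct.induction_on with
    | zero => simp
    | add x y hx hy => simp only [mul_add, map_add, hx, hy]; abel
    | tmul b g =>
      simp only [Algebra.TensorProduct.tmul_mul_tmul, der_tmul, kapAct_tmul, mul_add, add_mul,
        Ared.der_mul, dS_mul, map_mul, add_tmul, tmul_add, mul_assoc,
        Ared.kapAct_mul_corner hodd hq s c b]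
      abel

theorem der_smooth (s : Bool) (c : ℂ) (f : Smooth Plane) :
    der hodd hp hq s c (ofSmooth q p f) = Ared.corner q p s c ⊗ₜ dS s f := by
  rw [ofSmooth, der_tmul, Ared.der_one, zero_tmul, zero_add, map_one, one_mul]

theorem der_red (s : Bool) (c : ℂ) (a : Ared q p) :
    der hodd hp hq s c (a ⊗ₜ 1) = Ared.der hodd hp hq s c a ⊗ₜ 1 := by
  rw [der_tmul, dS_one, tmul_zero, add_zero]

/-- The relation `p_± κ = q^{∓1} κ p_±` as one between operators, and its analogue for `κ⁻¹`. -/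
theorem der_kapAct (s t : Bool) (c : ℂ) (F : A q p) : der hodd hp hq s c (kapAct hq t F) =
    (wt (wt q t) s)⁻¹ • kapAct hq t (der hodd hp hq s c F) := by
  have hw := wt_ne_zero hodd (wt_prim hq t) s
  have h1 : ∀ u, der hodd hp hq s c (kapAct hq t (Ared.etaS q p u ⊗ₜ 1)) =
      (wt (wt q t) s)⁻¹ • kapAct hq t (der hodd hp hq s c (Ared.etaS q p u ⊗ₜ 1)) := fun u => by
    rw [kapAct_tmul, der_red, Ared.kapAct_etaS, der_red, kapAct_tmul, smul_tmul', ← map_smul,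
      Ared.der_etaS]
    congr 1
    by_cases h : u = s
    · rw [if_pos h, map_smul, map_smul, Ared.kapAct_delS hodd, smul_smul, smul_smul,
        mul_right_comm, inv_mul_cancel₀ hw, one_mul]
    · rw [if_neg h]; simp
  induction F using A.induction with
  | hadd x y hx hy => simp only [map_add, hx, hy, smul_add]
  | hmul x y hx hy =>
    have hc : ∀ z : A q p, kapAct hq true (kapAct hq t z) = kapAct hq t (kapAct hq true z) := by
      cases t
      · exact fun z => (kapAct_not hodd hq true z).trans (kapAct_not hodd hq false z).symm
      · exact fun _ => rfl
    have hc' : ∀ z : A q p, kapAct hq false (kapAct hq t z) = kapAct hq t (kapAct hq false z) := by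
      cases t
      · exact fun _ => rfl
      · exact fun z => (kapAct_not hodd hq false z).trans (kapAct_not hodd hq true z).symm
    rw [map_mul, der_mul, hx, hy, der_mul, map_add, map_mul, map_mul, hc, hc', mul_smul_comm,
      smul_mul_assoc, smul_add]
  | hgen g =>
    cases g
    · exact h1 true
    · exact h1 false
    · change der hodd hp hq s c (kapAct hq t (Ared.del q p ⊗ₜ 1)) =
        (wt (wt q t) s)⁻¹ • kapAct hq t (der hodd hp hq s c (Ared.del q p ⊗ₜ 1))
      rw [kapAct_tmul, der_red, der_red, Ared.kapAct_del, map_smul, Ared.der_del]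
      simp
  | hsmooth f =>
    have h2 : kapAct hq t (ofSmooth q p f) = ofSmooth q p f := by
      rw [ofSmooth, kapAct_tmul, map_one]
    rw [h2, der_smooth, kapAct_tmul, Ared.kapAct_corner hodd, ← smul_tmul', smul_smul,
      inv_mul_cancel₀ hw, one_smul]

/-- The relation `p_+ p_- = p_- p_+` as one between operators. -/
theorem der_der_not (s : Bool) (c c' : ℂ) (F : A q p) :
    der hodd hp hq s c (der hodd hp hq (!s) c' F) =
      der hodd hp hq (!s) c' (der hodd hp hq s c F) := by
  have h1 : ∀ u s c c', Ared.der hodd hp hq s c (Ared.der hodd hp hq (!s) c' (Ared.etaS q p u)) =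
      0 := fun u s c c' => by
    rw [Ared.der_etaS]
    split_ifs
    · rw [map_smul, Ared.der_delS, smul_zero]
    · rw [map_zero]
  have h2 : ∀ u, der hodd hp hq s c (der hodd hp hq (!s) c' (Ared.etaS q p u ⊗ₜ 1)) =
      der hodd hp hq (!s) c' (der hodd hp hq s c (Ared.etaS q p u ⊗ₜ 1)) := fun u => by
    have h3 := h1 u (!s) c' c
    rw [Bool.not_not] at h3
    rw [der_red, der_red, der_red, der_red, h1, h3]
  have h4 : ∀ s c c', Ared.der hodd hp hq s c (Ared.corner q p (!s) c') = 0 := fun s c c' => by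
    rw [Ared.corner, map_smul, Ared.der_mul, Ared.der_delS, Ared.der_pow_eq_zero]
    · simp
    · rw [Ared.der_etaS, if_neg (by cases s <;> simp)]
  induction F using A.induction with
  | hadd x y hx hy => simp only [map_add, hx, hy]
  | hmul x y hx hy =>
    simp only [der_mul, map_add, hx, hy, der_kapAct, smul_mul_assoc, mul_smul_comm]
    have e : ∀ t, (wt (wt q false) t)⁻¹ = wt q t := by
      intro t; cases t <;> simp [wt]
    have e' : ∀ t, (wt (wt q true) (!t))⁻¹ = wt q t := by
      intro t; cases t <;> simp [wt]
    have e'' : (wt (wt q true) s)⁻¹ = wt q (!s) := by cases s <;> simp [wt]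
    rw [e, e, e', e'']
    abel
  | hgen g =>
    cases g
    · exact h2 true
    · exact h2 false
    · change der hodd hp hq s c (der hodd hp hq (!s) c' (Ared.del q p ⊗ₜ 1)) =
        der hodd hp hq (!s) c' (der hodd hp hq s c (Ared.del q p ⊗ₜ 1))
      simp only [der_red, Ared.der_del, map_zero, zero_tmul]
  | hsmooth f =>
    have h5 := h4 (!s) c' c
    rw [Bool.not_not] at h5
    -- both sides are multiples of `D_s D_{-s}`, which commute up to the scalar that `κ` produces
    have h6 := Ared.kapAct_mul_corner hodd hq s c (Ared.corner q p (!s) c')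
    rw [Ared.kapAct_corner hodd, Ared.kapAct_corner hodd] at h6
    rw [der_smooth, der_smooth, der_tmul, der_tmul, h4, h5, zero_tmul, zero_tmul, zero_add,
      zero_add, Ared.kapAct_corner hodd, Ared.kapAct_corner hodd, h6, dS_comm]
    congr 1
    rw [mul_smul_comm, smul_mul_assoc]
    congr 1
    cases s <;> simp [wt]

end A

/-! ### Gaussian binomial coefficients and quantum factorials -/

section GaussBinom

variable {w : ℂ} {p : ℕ}

/-- The `q`-Pochhammer symbol in the base `w²` and the symmetric quantum factorial in the base `w`
differ by an explicit nonzero factor. -/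
theorem qPoch_sq (hw0 : w ≠ 0) (hw : w - w⁻¹ ≠ 0) (n : ℕ) : qPoch (w ^ 2) n =
    (-(w - w⁻¹)) ^ n * (∏ i ∈ Finset.range n, w ^ (i + 1)) * qFact w n := by
  rw [qPoch, qFact, ← Finset.card_range n, ← Finset.prod_const, Finset.card_range,
    ← Finset.prod_mul_distrib, ← Finset.prod_mul_distrib]
  refine Finset.prod_congr rfl fun i _ => ?_
  have h1 : w ^ (i + 1) * w⁻¹ ^ (i + 1) = 1 := by rw [← mul_pow, mul_inv_cancel₀ hw0, one_pow]
  have h2 : (w - w⁻¹) * qInt w (i + 1) = w ^ (i + 1) - w⁻¹ ^ (i + 1) := by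
    rw [qInt, mul_div_cancel₀ _ hw]
  linear_combination w ^ (i + 1) * h2 - h1

theorem prod_pow_add (w : ℂ) (a b : ℕ) : ∏ i ∈ Finset.range (a + b), w ^ (i + 1) =
    (∏ i ∈ Finset.range a, w ^ (i + 1)) * (∏ i ∈ Finset.range b, w ^ (i + 1)) * w ^ (a * b) := by
  induction b with
  | zero => simp
  | succ b ih =>
    rw [← add_assoc, Finset.prod_range_succ, ih, Finset.prod_range_succ _ b]
    ring

/-- The Gaussian binomial coefficient in terms of symmetric quantum factorials. -/
theorem gaussBinom_sq_mul (hodd : Odd p) (hp : 1 < p) (hw : IsPrimitiveRoot w p) (a b : ℕ) :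
    gaussBinom (w ^ 2) (a + b) a * (qFact w a * qFact w b) = w ^ (a * b) * qFact w (a + b) := by
  have hw0 : w ≠ 0 := hw.ne_zero (by omega)
  have h1 := sub_inv_ne_zero' hodd hp hw
  have h := gaussBinom_mul (w ^ 2) a b
  rw [qPoch_sq hw0 h1, qPoch_sq hw0 h1, qPoch_sq hw0 h1, prod_pow_add, pow_add] at h
  have hA : (∏ i ∈ Finset.range a, w ^ (i + 1)) ≠ 0 :=
    Finset.prod_ne_zero_iff.mpr fun i _ => pow_ne_zero _ hw0
  have hB : (∏ i ∈ Finset.range b, w ^ (i + 1)) ≠ 0 :=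
    Finset.prod_ne_zero_iff.mpr fun i _ => pow_ne_zero _ hw0
  have hC : (-(w - w⁻¹)) ^ a * (-(w - w⁻¹)) ^ b ≠ 0 :=
    mul_ne_zero (pow_ne_zero _ (neg_ne_zero.mpr h1)) (pow_ne_zero _ (neg_ne_zero.mpr h1))
  refine mul_left_cancel₀ (mul_ne_zero (mul_ne_zero hC hA) hB) ?_
  linear_combination h

end GaussBinom

/-! ### The action on the second factor of `A(E(1,1|p)) ⊗ A(E(1,1|p))` -/

namespace Ared

variable {q : ℂ} {p : ℕ}

/-- `id ⊗ κ^{±1}`. -/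
def kapAct₂ (hq : IsPrimitiveRoot q p) (s : Bool) :
    Ared q p ⊗[ℂ] Ared q p →ₐ[ℂ] Ared q p ⊗[ℂ] Ared q p :=
  Algebra.TensorProduct.map (AlgHom.id ℂ _) (kapAct hq s)

theorem kapAct₂_tmul (hq : IsPrimitiveRoot q p) (s : Bool) (a b : Ared q p) :
    kapAct₂ hq s (a ⊗ₜ b) = a ⊗ₜ kapAct hq s b := rfl

/-- The element `B_±` in the coproduct of a smooth function, for either sign. -/
def BS (q : ℂ) (p : ℕ) (s : Bool) : Ared q p ⊗[ℂ] Ared q p :=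
  (-1 : ℂ) ^ ((p + 1) / 2) • ∑ n ∈ Finset.Ico 1 p,
    (wt q s ^ (n ^ 2) / (qFact q (p - n) * qFact q n)) •
      ((etaS q p s ^ (p - n) * delS q p s ^ n) ⊗ₜ[ℂ] (etaS q p s ^ n))

theorem kapAct₂_BS (hq : IsPrimitiveRoot q p) (s t : Bool) :
    kapAct₂ hq t (BS q p s) = BS q p s := by
  simp only [BS, map_smul, map_sum, kapAct₂_tmul, map_pow, kapAct_etaS]

/-- Reordering two terms, with indices `n` and `m`, produces the factor
`q^{∓2(nm + n(p-m) + (p-n)(p-m) + (p-n)m)} = q^{∓2p²} = 1`. -/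
theorem BS_commute (hodd : Odd p) (hq : IsPrimitiveRoot q p) (s : Bool) :
    BS q p s * BS q p (!s) = BS q p (!s) * BS q p s := by
  refine Commute.eq ?_
  refine Commute.smul_left (Commute.smul_right ?_ _) _
  refine Commute.sum_left _ _ _ fun n hn => Commute.sum_right _ _ _ fun m hm => ?_
  refine Commute.smul_left (Commute.smul_right ?_ _) _
  rw [Finset.mem_Ico] at hn hm
  set u : ℂ := (wt q s)⁻¹ ^ 2 with hu
  have h1 := qcomm_pow_pow (etaS_mul_not hodd hq s)
  have h2 : ∀ a m, etaS q p s ^ a * delS q p (!s) ^ m =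
      u ^ (a * m) • (delS q p (!s) ^ m * etaS q p s ^ a) := by
    have h := etaS_mul_delS hodd hq s (!s)
    rw [wt_not] at h
    exact qcomm_pow_pow h
  have h3 := qcomm_pow_pow (delS_mul_etaS hodd hq (!s) s)
  have h4 : ∀ m, delS q p s ^ n * delS q p (!s) ^ m = delS q p (!s) ^ m * delS q p s ^ n :=
    fun m => ((delS_comm s (!s)).pow_pow n m).eq
  rw [Commute, SemiconjBy, Algebra.TensorProduct.tmul_mul_tmul,
    Algebra.TensorProduct.tmul_mul_tmul]
  have h5 : etaS q p s ^ (p - n) * delS q p s ^ n *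
      (etaS q p (!s) ^ (p - m) * delS q p (!s) ^ m) =
      u ^ (n * (p - m) + (p - n) * (p - m) + (p - n) * m) •
        (etaS q p (!s) ^ (p - m) * delS q p (!s) ^ m *
          (etaS q p s ^ (p - n) * delS q p s ^ n)) := by
    calc _ = etaS q p s ^ (p - n) * (delS q p s ^ n * etaS q p (!s) ^ (p - m)) *
          delS q p (!s) ^ m := by simp only [mul_assoc]
      _ = u ^ (n * (p - m)) • ((etaS q p s ^ (p - n) * etaS q p (!s) ^ (p - m)) *
          (delS q p s ^ n * delS q p (!s) ^ m)) := by
        rw [h3]; simp only [mul_assoc, mul_smul_comm, smul_mul_assoc]; rfl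
      _ = (u ^ (n * (p - m)) * u ^ ((p - n) * (p - m))) • (etaS q p (!s) ^ (p - m) *
          (etaS q p s ^ (p - n) * delS q p (!s) ^ m) * delS q p s ^ n) := by
        rw [h1, h4]; simp only [mul_assoc, smul_mul_assoc, smul_smul]; rfl
      _ = _ := by
        rw [h2, pow_add, pow_add]
        simp only [mul_assoc, mul_smul_comm, smul_mul_assoc, smul_smul]
  rw [h5, h1, tmul_smul, smul_tmul', smul_smul, ← hu, ← pow_add]
  have h6 : n * m + (n * (p - m) + (p - n) * (p - m) + (p - n) * m) = p * p := by
    have e : p * p = (n + (p - n)) * (m + (p - m)) := by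
      rw [Nat.add_sub_cancel' hn.2.le, Nat.add_sub_cancel' hm.2.le]
    rw [e]
    ring
  have h7 : u ^ p = 1 := by
    rw [hu, ← pow_mul, mul_comm, pow_mul, inv_pow, (wt_prim hq s).pow_eq_one, inv_one, one_pow]
  rw [h6, pow_mul, h7, one_pow, one_smul]

theorem comul_etaS (hodd : Odd p) (hq : IsPrimitiveRoot q p) (s : Bool) :
    comul hodd hq (etaS q p s) = etaS q p s ⊗ₜ 1 + delS q p s ⊗ₜ etaS q p s := by
  cases s
  · change comul hodd hq (gen q p AGen.etaMinus) = _
    simp only [comul]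
    rw [lift_gen]
    rfl
  · change comul hodd hq (gen q p AGen.etaPlus) = _
    simp only [comul]
    rw [lift_gen]
    rfl

theorem comul_del (hodd : Odd p) (hq : IsPrimitiveRoot q p) :
    comul hodd hq (del q p) = del q p ⊗ₜ del q p := by
  change comul hodd hq (gen q p AGen.del) = _
  simp only [comul]
  rw [lift_gen]

theorem comul_delS (hodd : Odd p) (hq : IsPrimitiveRoot q p) (s : Bool) :
    comul hodd hq (delS q p s) = delS q p s ⊗ₜ delS q p s := by
  cases s
  · rw [delS, delInv, map_pow, comul_del, Algebra.TensorProduct.tmul_pow]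
  · exact comul_del hodd hq

theorem kapAct₂_comul (hodd : Odd p) (hq : IsPrimitiveRoot q p) (s : Bool) (a : Ared q p) :
    kapAct₂ hq s (comul hodd hq a) = comul hodd hq (kapAct hq s a) := by
  have h1 : ∀ t, kapAct₂ hq s (comul hodd hq (etaS q p t)) =
      comul hodd hq (kapAct hq s (etaS q p t)) := fun t => by
    rw [kapAct_etaS, comul_etaS, map_add, kapAct₂_tmul, kapAct₂_tmul, map_one, kapAct_etaS]
  induction a using Ared.induction with
  | halg k => simp only [AlgHom.commutes]
  | hadd x y hx hy => simp only [map_add, hx, hy]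
  | hmul x y hx hy => simp only [map_mul, hx, hy]
  | hgen g =>
    cases g
    · exact h1 true
    · exact h1 false
    · change kapAct₂ hq s (comul hodd hq (del q p)) = comul hodd hq (kapAct hq s (del q p))
      rw [kapAct_del, map_smul, comul_del, kapAct₂_tmul, kapAct_del, tmul_smul]

variable (hodd : Odd p) (hp : 1 < p) (hq : IsPrimitiveRoot q p)

/-- `id ⊗ p_±`. -/
def der₂ (s : Bool) (c : ℂ) : Ared q p ⊗[ℂ] Ared q p →ₗ[ℂ] Ared q p ⊗[ℂ] Ared q p :=
  (der hodd hp hq s c).lTensor (Ared q p)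

theorem der₂_tmul (s : Bool) (c : ℂ) (a b : Ared q p) :
    der₂ hodd hp hq s c (a ⊗ₜ b) = a ⊗ₜ der hodd hp hq s c b := rfl

theorem der₂_mul (s : Bool) (c : ℂ) (v w : Ared q p ⊗[ℂ] Ared q p) :
    der₂ hodd hp hq s c (v * w) =
      kapAct₂ hq false v * der₂ hodd hp hq s c w + der₂ hodd hp hq s c v * kapAct₂ hq true w := by
  induction v using TensorProduct.induction_on with
  | zero => simp
  | add x y hx hy => simp only [add_mul, map_add, hx, hy]; abel
  | tmul a b =>
    induction w using TensorProduct.induction_on with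
    | zero => simp
    | add x y hx hy => simp only [mul_add, map_add, hx, hy]; abel
    | tmul a' b' =>
      simp only [Algebra.TensorProduct.tmul_mul_tmul, der₂_tmul, kapAct₂_tmul, der_mul, tmul_add]

/-- The action of `p_±` on `A(E(1,1|p))` commutes with the coproduct. -/
theorem der₂_comul (s : Bool) (c : ℂ) (a : Ared q p) :
    der₂ hodd hp hq s c (comul hodd hq a) = comul hodd hq (der hodd hp hq s c a) := by
  have h1 : ∀ t, der₂ hodd hp hq s c (comul hodd hq (etaS q p t)) =
      comul hodd hq (der hodd hp hq s c (etaS q p t)) := fun t => by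
    rw [comul_etaS, map_add, der₂_tmul, der₂_tmul, der_one, der_etaS, tmul_zero, zero_add]
    split_ifs with h
    · rw [map_smul, comul_delS, tmul_smul, h]
    · rw [map_zero, tmul_zero]
  induction a using Ared.induction with
  | halg k =>
    rw [AlgHom.commutes, Algebra.algebraMap_eq_smul_one, Algebra.algebraMap_eq_smul_one, map_smul,
      map_smul, map_smul, der_one, Algebra.TensorProduct.one_def, der₂_tmul, der_one]
    simp
  | hadd x y hx hy => simp only [map_add, hx, hy]
  | hmul x y hx hy => simp only [map_mul, map_add, der_mul, der₂_mul, kapAct₂_comul, hx, hy]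
  | hgen g =>
    cases g
    · exact h1 true
    · exact h1 false
    · change der₂ hodd hp hq s c (comul hodd hq (del q p)) =
        comul hodd hq (der hodd hp hq s c (del q p))
      rw [comul_del, der₂_tmul, der_del, map_zero, tmul_zero]

theorem der₂_BS_not (s : Bool) (c : ℂ) : der₂ hodd hp hq s c (BS q p (!s)) = 0 := by
  have h : der hodd hp hq s c (etaS q p (!s)) = 0 := by
    rw [der_etaS, if_neg (by cases s <;> simp)]
  simp only [BS, map_smul, map_sum, der₂_tmul, der_pow_eq_zero hodd hp hq h, tmul_zero, smul_zero,
    Finset.sum_const_zero]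

theorem der₂_BS (s : Bool) (c : ℂ) : der₂ hodd hp hq s c (BS q p s) =
    (-1 : ℂ) ^ ((p + 1) / 2) • ∑ k ∈ Finset.range (p - 1),
      (c * (wt q s ^ (k ^ 2 + k + 1)) / (qFact q (p - 1 - k) * qFact q k)) •
      ((etaS q p s ^ (p - 1 - k) * delS q p s ^ (k + 1)) ⊗ₜ[ℂ]
        (etaS q p s ^ k * delS q p s)) := by
  have hw0 := wt_ne_zero hodd hq s
  rw [BS, map_smul, map_sum, Finset.sum_Ico_eq_sum_range]
  congr 1
  refine Finset.sum_congr rfl fun k hk => ?_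
  rw [Finset.mem_range] at hk
  have h1 : qInt (wt q s) (k + 1) ≠ 0 :=
    qInt_ne_zero hodd hp (wt_prim hq s) (by omega) (by omega)
  have h2 : qFact q (k + 1) = qFact q k * qInt (wt q s) (k + 1) := by
    rw [← qFact_wt q s, qFact_succ, qFact_wt]
  have h3 : wt q s ^ ((k + 1) ^ 2) * (wt q s)⁻¹ ^ k = wt q s ^ (k ^ 2 + k + 1) := by
    rw [show (k + 1) ^ 2 = k ^ 2 + k + 1 + k by ring, pow_add, mul_assoc, ← mul_pow,
      mul_inv_cancel₀ hw0, one_pow, mul_one]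
  rw [add_comm 1 k, map_smul, der₂_tmul, der_etaS_pow, tmul_smul, smul_smul, ← h3, h2,
    Nat.sub_sub, add_comm 1 k]
  congr 1
  field_simp

/-- In each product of a monomial of `(id ⊗ p_±) B_±` with one of `B_±` the power of `η_±` is at
least `p` in one of the two factors. -/
theorem der₂_BS_mul_BS (s : Bool) (c : ℂ) :
    der₂ hodd hp hq s c (BS q p s) * BS q p s = 0 := by
  have h1 : ∀ a x b y, p ≤ a + b →
      etaS q p s ^ a * delS q p s ^ x * (etaS q p s ^ b * delS q p s ^ y) = 0 := by
    intro a x b y h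
    rw [mul_assoc, ← mul_assoc (delS q p s ^ x), qcomm_pow_pow (delS_mul_etaS hodd hq s s),
      smul_mul_assoc, mul_smul_comm, mul_assoc, ← mul_assoc (etaS q p s ^ a), ← pow_add,
      etaS_pow_eq_zero s h, zero_mul, smul_zero]
  rw [der₂_BS, BS, smul_mul_smul_comm, Finset.sum_mul_sum]
  refine smul_eq_zero_of_right _ (Finset.sum_eq_zero fun k hk => Finset.sum_eq_zero fun n hn => ?_)
  rw [Finset.mem_range] at hk
  rw [Finset.mem_Ico] at hn
  rw [smul_mul_smul_comm, Algebra.TensorProduct.tmul_mul_tmul]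
  refine smul_eq_zero_of_right _ ?_
  rcases Nat.lt_or_ge (k + n) p with h | h
  · rw [h1 _ _ _ _ (by omega), zero_tmul]
  · have h2 := h1 k 1 n 0 h
    rw [pow_one, pow_zero, mul_one] at h2
    rw [h2, tmul_zero]

/-- The binomial expansion of `(η_± ⊗ 1 + δ^{±1} ⊗ η_±)^{p-1}`: the last term is `1 ⊗ D_±`, and the
others are the derivatives of the terms of `B_±`. -/
theorem comul_corner (s : Bool) (c : ℂ) : comul hodd hq (corner q p s c) =
    1 ⊗ₜ corner q p s c + der₂ hodd hp hq s c (BS q p s) := by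
  have hw := wt_prim hq s
  have hw0 := wt_ne_zero hodd hq s
  have hp1 : p - 1 + 1 = p := Nat.sub_add_cancel hodd.pos
  have hx : (etaS q p s ⊗ₜ[ℂ] (1 : Ared q p)) * (delS q p s ⊗ₜ[ℂ] etaS q p s) =
      (wt q s ^ 2) • ((delS q p s ⊗ₜ[ℂ] etaS q p s) * (etaS q p s ⊗ₜ[ℂ] (1 : Ared q p))) := by
    rw [Algebra.TensorProduct.tmul_mul_tmul, Algebra.TensorProduct.tmul_mul_tmul,
      etaS_mul_delS hodd hq, one_mul, mul_one, smul_tmul']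
  -- split off the last term of the expansion; `δ^{±p} = 1` turns it into `1 ⊗ D`
  rw [der₂_BS, corner, map_smul, map_mul, map_pow, comul_etaS, comul_delS, add_pow_qcomm hx, hp1,
    tmul_smul, ← hp1, Finset.sum_range_succ, hp1, add_mul, smul_add, add_comm]
  congr 1
  · have h1 := gaussBinom_sq_mul hodd hp hw (p - 1) 0
    rw [mul_zero, pow_zero, one_mul, add_zero, qFact_zero, mul_one] at h1
    rw [mul_eq_right₀ (qFact_ne_zero hodd hp hw (by omega))] at h1
    rw [h1, one_smul, Nat.sub_self, pow_zero, mul_one, Algebra.TensorProduct.tmul_pow,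
      Algebra.TensorProduct.tmul_mul_tmul, ← pow_succ, hp1, delS_pow]
  · rw [Finset.sum_mul, Finset.smul_sum, Finset.smul_sum]
    refine Finset.sum_congr rfl fun k hk => ?_
    rw [Finset.mem_range] at hk
    obtain ⟨j, hj⟩ : ∃ j, p - 1 = k + j := ⟨p - 1 - k, by omega⟩
    have hjk : p - 1 - k = j := by omega
    have h1 := gaussBinom_sq_mul hodd hp hw k j
    rw [qFact_wt, qFact_wt, qFact_wt] at h1
    have hf : ∀ n, n < p → qFact q n ≠ 0 := fun n hn => qFact_ne_zero hodd hp hq hn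
    have hk0 := hf k (by omega)
    have hj0 := hf j (by omega)
    have hkj0 := hf (k + j) (by omega)
    have h2 : wt q s ^ (k * j) * wt q s ^ (k ^ 2 + k) = 1 := by
      rw [← pow_add, show k * j + (k ^ 2 + k) = (k + j + 1) * k by ring, ← hj, hp1, pow_mul,
        hw.pow_eq_one, one_pow]
    have h3 : (wt q s)⁻¹ ^ (2 * (k * j)) * wt q s ^ (k * j) = wt q s ^ (k ^ 2 + k) := by
      rw [inv_pow, two_mul, pow_add, mul_inv, mul_assoc, inv_mul_cancel₀ (pow_ne_zero _ hw0),
        mul_one]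
      exact inv_eq_of_mul_eq_one_right h2
    rw [hjk, hj, Algebra.TensorProduct.tmul_pow, Algebra.TensorProduct.tmul_pow, smul_mul_assoc,
      Algebra.TensorProduct.tmul_mul_tmul, Algebra.TensorProduct.tmul_mul_tmul, one_pow, mul_one,
      qcomm_pow_pow (delS_mul_etaS hodd hq s s), smul_mul_assoc, ← smul_tmul', smul_smul, smul_smul,
      smul_smul, mul_assoc (etaS q p s ^ j), ← pow_succ, ← pow_mul]
    congr 1
    have h4 : gaussBinom (wt q s ^ 2) (k + j) k =
        wt q s ^ (k * j) * qFact q (k + j) / (qFact q k * qFact q j) := by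
      rw [eq_div_iff (mul_ne_zero hk0 hj0), h1]
    rw [h4, pow_succ (wt q s) (k ^ 2 + k), ← h3]
    field_simp

end Ared

variable {q : ℂ} {p : ℕ}

/-! ### Counits and coproducts of the generators -/

namespace U

/-- The generator `p_±`. -/
def pS (q : ℂ) (p : ℕ) : Bool → U q p
  | true => pPlus q p
  | false => pMinus q p

theorem counit_pS (s : Bool) : counit (pS q p s) = 0 := by
  cases s
  · change counit (gen q p UGen.pMinus) = _
    simp only [counit]
    rw [lift_gen]
  · change counit (gen q p UGen.pPlus) = _
    simp only [counit]
    rw [lift_gen]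

theorem counit_kap : counit (kap q p) = 1 := by
  change counit (gen q p UGen.kap) = _
  simp only [counit]
  rw [lift_gen]

theorem comul_pS (hp : 0 < p) (hq : q ≠ 0) (s : Bool) :
    comul hp hq (pS q p s) = pS q p s ⊗ₜ kap q p + kapInv q p ⊗ₜ pS q p s := by
  cases s
  · change comul hp hq (gen q p UGen.pMinus) = _
    simp only [comul]
    rw [lift_gen]
    rfl
  · change comul hp hq (gen q p UGen.pPlus) = _
    simp only [comul]
    rw [lift_gen]
    rfl

theorem comul_kap (hp : 0 < p) (hq : q ≠ 0) :
    comul hp hq (kap q p) = kap q p ⊗ₜ kap q p := by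
  change comul hp hq (gen q p UGen.kap) = _
  simp only [comul]
  rw [lift_gen]

end U

namespace Ared

theorem counit_etaS (hp : 0 < p) (s : Bool) : counit (q := q) hp (etaS q p s) = 0 := by
  cases s
  · change counit hp (gen q p AGen.etaMinus) = _
    simp only [counit]
    rw [lift_gen]
  · change counit hp (gen q p AGen.etaPlus) = _
    simp only [counit]
    rw [lift_gen]

theorem counit_del (hp : 0 < p) : counit (q := q) hp (del q p) = 1 := by
  change counit hp (gen q p AGen.del) = _
  simp only [counit]
  rw [lift_gen]

theorem counit_delS (hp : 0 < p) (s : Bool) : counit (q := q) hp (delS q p s) = 1 := by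
  cases s
  · rw [delS, delInv, map_pow, counit_del, one_pow]
  · exact counit_del hp

/-- `id ⊗ ε`. -/
def counit₂ (q : ℂ) {p : ℕ} (hp : 0 < p) : Ared q p ⊗[ℂ] Ared q p →ₐ[ℂ] Ared q p :=
  (Algebra.TensorProduct.rid ℂ ℂ (Ared q p)).toAlgHom.comp
    (Algebra.TensorProduct.map (AlgHom.id ℂ _) (counit hp))

theorem counit₂_tmul (hp : 0 < p) (a b : Ared q p) :
    counit₂ q hp (a ⊗ₜ b) = counit hp b • a := rfl

theorem counit₂_comul (hodd : Odd p) (hq : IsPrimitiveRoot q p) (a : Ared q p) :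
    counit₂ q hodd.pos (comul hodd hq a) = a := by
  have h1 : ∀ t, counit₂ q hodd.pos (comul hodd hq (etaS q p t)) = etaS q p t := fun t => by
    rw [comul_etaS, map_add, counit₂_tmul, counit₂_tmul, map_one, counit_etaS, one_smul, zero_smul,
      add_zero]
  induction a using Ared.induction with
  | halg k => simp only [AlgHom.commutes]
  | hadd x y hx hy => simp only [map_add, hx, hy]
  | hmul x y hx hy => simp only [map_mul, hx, hy]
  | hgen g =>
    cases g
    · exact h1 true
    · exact h1 false
    · change counit₂ q hodd.pos (comul hodd hq (del q p)) = del q p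
      rw [comul_del, counit₂_tmul, counit_del, one_smul]

theorem counit₂_BS (hp : 0 < p) (s : Bool) : counit₂ q hp (BS q p s) = 0 := by
  rw [BS, map_smul, map_sum]
  refine smul_eq_zero_of_right _ (Finset.sum_eq_zero fun n hn => ?_)
  rw [Finset.mem_Ico] at hn
  rw [map_smul, counit₂_tmul, map_pow, counit_etaS, zero_pow (by omega), zero_smul, smul_zero]

end Ared

namespace A

theorem counit_tmul (hp : 0 < p) (a : Ared q p) (f : Smooth Plane) :
    counit hp (a ⊗ₜ f) = Ared.counit hp a * evalC 0 f := rfl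

theorem counit_mul (hp : 0 < p) (F G : A q p) :
    counit hp (F * G) = counit hp F * counit hp G := by
  induction F using TensorProduct.induction_on with
  | zero => simp
  | add x y hx hy => rw [add_mul, map_add, hx, hy, map_add, add_mul]
  | tmul a f =>
    induction G using TensorProduct.induction_on with
    | zero => simp
    | add x y hx hy => rw [mul_add, map_add, hx, hy, map_add, mul_add]
    | tmul b g =>
      rw [Algebra.TensorProduct.tmul_mul_tmul, counit_tmul, counit_tmul, counit_tmul, map_mul,
        evalC_mul]
      ring

/-! ### The coproduct as a coaction -/

/-- `F ↦ Δ(F)(x, ·)`, with values in `A(E(1,1|p)) ⊗ A(E_q(1,1))`. -/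
def coact (hodd : Odd p) (hq : IsPrimitiveRoot q p) (x : Plane) : A q p →ₗ[ℂ] Ared q p ⊗[ℂ] A q p :=
  (TensorProduct.assoc ℂ (Ared q p) (Ared q p) (Smooth Plane)).toLinearMap ∘ₗ
    (restrictSnd x).lTensor (Ared q p ⊗[ℂ] Ared q p) ∘ₗ comul hodd hq

/-- The element `w g` of `A(E(1,1|p)) ⊗ A(E_q(1,1))`, for `w ∈ A(E(1,1|p)) ⊗ A(E(1,1|p))` and a
smooth function `g`. -/
def join (w : Ared q p ⊗[ℂ] Ared q p) (g : Smooth Plane) : Ared q p ⊗[ℂ] A q p :=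
  TensorProduct.assoc ℂ (Ared q p) (Ared q p) (Smooth Plane) (w ⊗ₜ g)

theorem join_add (v w : Ared q p ⊗[ℂ] Ared q p) (g : Smooth Plane) :
    join (v + w) g = join v g + join w g := by
  rw [join, add_tmul]
  exact LinearEquiv.map_add _ _ _

theorem join_zero (g : Smooth Plane) : join (0 : Ared q p ⊗[ℂ] Ared q p) g = 0 := by
  rw [join, zero_tmul]
  exact LinearEquiv.map_zero _

/-- The coaction on `a f`, with the four terms ordered with respect to a chosen sign `s`; both
orders agree because `B_+` and `B_-` commute. -/
theorem coact_tmul (hodd : Odd p) (hq : IsPrimitiveRoot q p) (x : Plane) (s : Bool) (a : Ared q p)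
    (f : Smooth Plane) : coact hodd hq x (a ⊗ₜ f) =
      join (Ared.comul hodd hq a) (translate x f)
      + join (Ared.comul hodd hq a * Ared.BS q p s) (translate x (dS s f))
      + join (Ared.comul hodd hq a * Ared.BS q p (!s)) (translate x (dS (!s) f))
      + join (Ared.comul hodd hq a * (Ared.BS q p s * Ared.BS q p (!s)))
        (translate x (dS s (dS (!s) f))) := by
  have h : comul hodd hq (a ⊗ₜ f) = (Ared.comul hodd hq a ⊗ₜ 1) *
      (1 ⊗ₜ atZ f + Ared.BS q p true ⊗ₜ atZ (dS true f) + Ared.BS q p false ⊗ₜ atZ (dS false f)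
        + (Ared.BS q p true * Ared.BS q p false) ⊗ₜ atZ (dS true (dS false f))) := rfl
  have hj : ∀ (w : Ared q p ⊗[ℂ] Ared q p) (g : Smooth Plane),
      TensorProduct.assoc ℂ (Ared q p) (Ared q p) (Smooth Plane)
        ((restrictSnd x).lTensor (Ared q p ⊗[ℂ] Ared q p) (w ⊗ₜ atZ g)) =
      join w (translate x g) := fun _ _ => rfl
  change TensorProduct.assoc ℂ (Ared q p) (Ared q p) (Smooth Plane)
        ((restrictSnd x).lTensor (Ared q p ⊗[ℂ] Ared q p) (comul hodd hq (a ⊗ₜ f))) = _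
  rw [h]
  simp only [mul_add, Algebra.TensorProduct.tmul_mul_tmul, one_mul, mul_one, map_add, hj]
  cases s
  · simp only [Bool.not_false]
    have hB : Ared.BS q p false * Ared.BS q p true = _ := Ared.BS_commute hodd hq false
    rw [hB, Bool.not_false, dS_comm false]
    abel
  · rfl

variable (hodd : Odd p) (hp : 1 < p) (hq : IsPrimitiveRoot q p)

theorem lTensor_der_join (s : Bool) (c : ℂ) (w : Ared q p ⊗[ℂ] Ared q p) (g : Smooth Plane) :
    (der hodd hp hq s c).lTensor (Ared q p) (join w g) = join (Ared.der₂ hodd hp hq s c w) g +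
      join (Ared.kapAct₂ hq false w * 1 ⊗ₜ Ared.corner q p s c) (dS s g) := by
  induction w using TensorProduct.induction_on with
  | zero => simp only [join_zero, map_zero, zero_mul, add_zero]
  | add x y hx hy => simp only [join_add, map_add, hx, hy, add_mul]; abel
  | tmul a b =>
    change a ⊗ₜ der hodd hp hq s c (b ⊗ₜ g) = a ⊗ₜ (Ared.der hodd hp hq s c b ⊗ₜ g) + _
    rw [der_tmul, tmul_add, Ared.kapAct₂_tmul, Algebra.TensorProduct.tmul_mul_tmul, mul_one]
    rfl

theorem lTensor_kapAct_join (s : Bool) (w : Ared q p ⊗[ℂ] Ared q p) (g : Smooth Plane) :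
    (kapAct hq s).toLinearMap.lTensor (Ared q p) (join w g) = join (Ared.kapAct₂ hq s w) g := by
  induction w using TensorProduct.induction_on with
  | zero => simp only [join_zero, map_zero]
  | add x y hx hy => simp only [join_add, map_add, hx, hy]
  | tmul a b => rfl

theorem kapAct_coact (s : Bool) (x : Plane) (F : A q p) :
    (kapAct hq s).toLinearMap.lTensor (Ared q p) (coact hodd hq x F) =
      coact hodd hq x (kapAct hq s F) := by
  induction F using TensorProduct.induction_on with
  | zero => simp
  | add x y hx hy => simp only [map_add, hx, hy]
  | tmul a f =>
    rw [kapAct_tmul, coact_tmul hodd hq x true, coact_tmul hodd hq x true]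
    simp only [map_add, lTensor_kapAct_join, map_mul, Ared.kapAct₂_comul, Ared.kapAct₂_BS]

/-- The action of `p_±` commutes with the coaction. With `D`, `B` belonging to the same sign and
`E = (id ⊗ p_±) B`, comparing the coefficients of the derivatives of `f` reduces this to
`Δ(D) = D + E`, `B D = D B` and `E B = 0`. -/
theorem der_coact (s : Bool) (c : ℂ) (x : Plane) (F : A q p) :
    (der hodd hp hq s c).lTensor (Ared q p) (coact hodd hq x F) =
      coact hodd hq x (der hodd hp hq s c F) := by
  induction F using TensorProduct.induction_on with
  | zero => simp
  | add x y hx hy => simp only [map_add, hx, hy]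
  | tmul a f =>
    set D : Ared q p ⊗[ℂ] Ared q p := 1 ⊗ₜ Ared.corner q p s c with hD
    set E := Ared.der₂ hodd hp hq s c (Ared.BS q p s) with hE
    have hc : Ared.comul hodd hq (Ared.corner q p s c) = D + E := Ared.comul_corner hodd hp hq s c
    have h0 : E * Ared.BS q p s = 0 := Ared.der₂_BS_mul_BS hodd hp hq s c
    have hBD : ∀ t, Ared.BS q p t * D = D * Ared.BS q p t := by
      have h : ∀ w, Ared.kapAct₂ hq false w * D = D * Ared.kapAct₂ hq true w := by
        intro w
        induction w using TensorProduct.induction_on with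
        | zero => simp
        | add x y hx hy => simp only [map_add, add_mul, mul_add, hx, hy]
        | tmul a b =>
          rw [hD, Ared.kapAct₂_tmul, Ared.kapAct₂_tmul, Algebra.TensorProduct.tmul_mul_tmul,
            Algebra.TensorProduct.tmul_mul_tmul, Ared.kapAct_mul_corner hodd, mul_one, one_mul]
      intro t
      simpa only [Ared.kapAct₂_BS] using h (Ared.BS q p t)
    have h1 : D * Ared.BS q p s = (D + E) * Ared.BS q p s := by rw [add_mul, h0, add_zero]
    rw [der_tmul, map_add, coact_tmul hodd hq x s, coact_tmul hodd hq x s, coact_tmul hodd hq x s]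
    simp only [map_add, lTensor_der_join, Ared.der₂_mul, map_mul, Ared.kapAct₂_comul,
      Ared.kapAct₂_BS, Ared.der₂_comul, Ared.der₂_BS_not, ← hE, ← hD, hc, mul_zero, zero_add,
      dS_translate]
    have e1 : Ared.BS q p s * D = (D + E) * Ared.BS q p s := by rw [hBD, h1]
    have e2 : Ared.BS q p s * Ared.BS q p (!s) * D =
        (D + E) * (Ared.BS q p s * Ared.BS q p (!s)) := by
      rw [mul_assoc, hBD, ← mul_assoc, e1, mul_assoc]
    simp only [mul_assoc, e1, e2, hBD (!s), mul_add, add_mul, join_add, dS_comm (!s) s]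
    abel

/-- The counit axiom `(id ⊗ ε) Δ = id`. -/
theorem counit_coact (x : Plane) (F : A q p) :
    TensorProduct.rid ℂ (Ared q p) ((counit hodd.pos).lTensor (Ared q p) (coact hodd hq x F)) =
      evalAt x F := by
  have hj : ∀ (w : Ared q p ⊗[ℂ] Ared q p) (g : Smooth Plane),
      TensorProduct.rid ℂ (Ared q p) ((counit hodd.pos).lTensor (Ared q p) (join w g)) =
        evalC 0 g • Ared.counit₂ q hodd.pos w := by
    intro w g
    induction w using TensorProduct.induction_on with
    | zero => simp only [join_zero, map_zero, smul_zero]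
    | add x y hx hy => simp only [join_add, map_add, hx, hy, smul_add]
    | tmul a b =>
      change (Ared.counit hodd.pos b * evalC 0 g) • a = _
      rw [Ared.counit₂_tmul, smul_smul, mul_comm]
  induction F using TensorProduct.induction_on with
  | zero => simp
  | add x y hx hy => simp only [map_add, hx, hy]
  | tmul a f =>
    rw [coact_tmul hodd hq x true]
    simp only [map_add, hj, map_mul, Ared.counit₂_comul, Ared.counit₂_BS, mul_zero, smul_zero,
      add_zero, evalC_translate]
    rfl

end A

/-! ### The representation of `U_q(e(1,1))` on `A(E_q(1,1))` -/

section Representation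

variable (hodd : Odd p) (hp : 1 < p) (hq : IsPrimitiveRoot q p) (r : ℂ)

/-- The action of `p_±` with `p_± η_± = i q^{±1/2} δ^{±1}`. -/
def pAct (s : Bool) : A q p →ₗ[ℂ] A q p := A.der hodd hp hq s (Complex.I * wt r s)

theorem kapAct_pow_apply (n : ℕ) (F : A q p) (hF : A.kapAct hq true F = F) :
    ((A.kapAct hq true).toLinearMap ^ n : Module.End ℂ (A q p)) F = F := by
  induction n with
  | zero => rfl
  | succ n ih => rw [pow_succ, Module.End.mul_apply, AlgHom.toLinearMap_apply, hF, ih]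

theorem kapAct_pow :
    ((A.kapAct hq true).toLinearMap ^ p : Module.End ℂ (A q p)) = 1 := by
  have hmul : ∀ (n : ℕ) (F G : A q p),
      ((A.kapAct hq true).toLinearMap ^ n : Module.End ℂ (A q p)) (F * G) =
      ((A.kapAct hq true).toLinearMap ^ n : Module.End ℂ (A q p)) F *
      ((A.kapAct hq true).toLinearMap ^ n : Module.End ℂ (A q p)) G := by
    intro n
    induction n with
    | zero => exact fun _ _ => rfl
    | succ n ih =>
      intro F G
      simp only [pow_succ, Module.End.mul_apply, AlgHom.toLinearMap_apply, map_mul, ih]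
  have hdel : ∀ n : ℕ, ((A.kapAct hq true).toLinearMap ^ n : Module.End ℂ (A q p))
      (Ared.del q p ⊗ₜ 1) = q ^ n • (Ared.del q p ⊗ₜ 1) := by
    intro n
    induction n with
    | zero => simp
    | succ n ih =>
      rw [pow_succ, Module.End.mul_apply, AlgHom.toLinearMap_apply, A.kapAct_tmul, Ared.kapAct_del,
        ← smul_tmul', map_smul, ih, smul_smul, pow_succ', wt]
  refine LinearMap.ext fun F => ?_
  induction F using A.induction with
  | hadd x y hx hy => rw [map_add, map_add, hx, hy]
  | hmul x y hx hy => rw [hmul, hx, hy]; rfl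
  | hgen g =>
    cases g
    · exact kapAct_pow_apply hq p _
        (congrArg (· ⊗ₜ[ℂ] (1 : Smooth Plane)) (Ared.kapAct_etaS hq true true))
    · exact kapAct_pow_apply hq p _
        (congrArg (· ⊗ₜ[ℂ] (1 : Smooth Plane)) (Ared.kapAct_etaS hq true false))
    · refine (hdel p).trans ?_
      rw [hq.pow_eq_one, one_smul]
      rfl
  | hsmooth f =>
    refine kapAct_pow_apply hq p _ ?_
    rw [A.ofSmooth, A.kapAct_tmul, map_one]

/-- The action `X ↦ (F ↦ (id ⊗ X) Δ(F))` of `U_q(e(1,1))` on `A(E_q(1,1))`. -/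
def rep : U q p →ₐ[ℂ] Module.End ℂ (A q p) :=
  U.lift (pAct hodd hp hq r true) (pAct hodd hp hq r false) (A.kapAct hq true).toLinearMap
    (LinearMap.ext fun F => A.der_der_not hodd hp hq true _ _ F)
    (LinearMap.ext fun F => A.der_kapAct hodd hp hq true true _ F)
    (LinearMap.ext fun F => (A.der_kapAct hodd hp hq false true _ F).trans
      (congrArg (· • _) (inv_inv q)))
    (kapAct_pow hq)

theorem rep_pS (s : Bool) : rep hodd hp hq r (U.pS q p s) = pAct hodd hp hq r s := by
  cases s
  · change rep hodd hp hq r (U.gen q p UGen.pMinus) = _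
    simp only [rep]
    rw [U.lift_gen]
  · change rep hodd hp hq r (U.gen q p UGen.pPlus) = _
    simp only [rep]
    rw [U.lift_gen]

theorem rep_kap : rep hodd hp hq r (U.kap q p) = (A.kapAct hq true).toLinearMap := by
  change rep hodd hp hq r (U.gen q p UGen.kap) = _
  simp only [rep]
  rw [U.lift_gen]

theorem rep_kapInv : rep hodd hp hq r (U.kapInv q p) = (A.kapAct hq false).toLinearMap := by
  have h1 : rep hodd hp hq r (U.kap q p) * (A.kapAct hq false).toLinearMap = 1 := by
    rw [rep_kap]
    exact LinearMap.ext fun F => A.kapAct_not hodd hq true F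
  have h2 : rep hodd hp hq r (U.kapInv q p) * rep hodd hp hq r (U.kap q p) = 1 := by
    rw [← map_mul, U.kapInv_mul hodd.pos, map_one]
  exact left_inv_eq_right_inv h2 h1

/-- The action commutes with the coaction: it acts on the second factor of `Δ(F)`. -/
theorem rep_coact (x : Plane) (Y : U q p) (F : A q p) :
    (rep hodd hp hq r Y).lTensor (Ared q p) (A.coact hodd hq x F) =
      A.coact hodd hq x (rep hodd hp hq r Y F) := by
  have h1 : ∀ s F, (rep hodd hp hq r (U.pS q p s)).lTensor (Ared q p) (A.coact hodd hq x F) =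
      A.coact hodd hq x (rep hodd hp hq r (U.pS q p s) F) := by
    intro s F
    rw [rep_pS]
    exact A.der_coact hodd hp hq s _ x F
  induction Y using U.induction generalizing F with
  | halg k =>
    rw [AlgHom.commutes, Algebra.algebraMap_eq_smul_one, LinearMap.lTensor_smul,
      LinearMap.smul_apply, LinearMap.smul_apply, map_smul, Module.End.one_eq_id,
      LinearMap.lTensor_id]
    rfl
  | hadd x y hx hy =>
    rw [map_add, LinearMap.lTensor_add, LinearMap.add_apply, hx, hy, LinearMap.add_apply, map_add]
  | hmul x y hx hy =>
    rw [map_mul, LinearMap.lTensor_mul, Module.End.mul_apply, hy, hx, Module.End.mul_apply]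
  | hgen g =>
    cases g
    · exact h1 true F
    · exact h1 false F
    · change (rep hodd hp hq r (U.kap q p)).lTensor (Ared q p) (A.coact hodd hq x F) =
        A.coact hodd hq x (rep hodd hp hq r (U.kap q p) F)
      rw [rep_kap]
      exact A.kapAct_coact hodd hq true x F

/-- The action of `U_q(e(1,1)) ⊗ U_q(e(1,1))` on `A(E_q(1,1)) ⊗ A(E_q(1,1))`. -/
def rep₂ : U q p ⊗[ℂ] U q p →ₐ[ℂ] Module.End ℂ (A q p ⊗[ℂ] A q p) :=
  (Module.endTensorEndAlgHom (R := ℂ) (S := ℂ) (A := ℂ) (M := A q p) (N := A q p)).comp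
    (Algebra.TensorProduct.map (rep hodd hp hq r) (rep hodd hp hq r))

theorem rep₂_tmul (X Y : U q p) (F G : A q p) : rep₂ hodd hp hq r (X ⊗ₜ Y) (F ⊗ₜ G) =
    rep hodd hp hq r X F ⊗ₜ rep hodd hp hq r Y G := rfl

/-- `A(E_q(1,1))` is a module algebra: `X` acts on a product through `Δ(X)`. -/
theorem rep_mul (X : U q p) (F G : A q p) : rep hodd hp hq r X (F * G) =
    LinearMap.mul' ℂ (A q p) (rep₂ hodd hp hq r
      (U.comul hodd.pos (hq.ne_zero hodd.pos.ne') X) (F ⊗ₜ G)) := by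
  set Δ := U.comul hodd.pos (hq.ne_zero hodd.pos.ne') with hΔ
  suffices h : ∀ W : A q p ⊗[ℂ] A q p, rep hodd hp hq r X (LinearMap.mul' ℂ (A q p) W) =
      LinearMap.mul' ℂ (A q p) (rep₂ hodd hp hq r (Δ X) W) from h (F ⊗ₜ G)
  have h1 : ∀ s (W : A q p ⊗[ℂ] A q p),
      rep hodd hp hq r (U.pS q p s) (LinearMap.mul' ℂ (A q p) W) =
      LinearMap.mul' ℂ (A q p) (rep₂ hodd hp hq r (Δ (U.pS q p s)) W) := by
    intro s W
    induction W using TensorProduct.induction_on with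
    | zero => simp
    | add x y hx hy => simp only [map_add, hx, hy]
    | tmul F G =>
      rw [hΔ, U.comul_pS, map_add, LinearMap.add_apply, rep₂_tmul, rep₂_tmul, map_add, rep_kap,
        rep_kapInv, rep_pS, LinearMap.mul'_apply, LinearMap.mul'_apply, LinearMap.mul'_apply,
        add_comm]
      exact A.der_mul hodd hp hq s _ F G
  induction X using U.induction with
  | halg k =>
    intro W
    rw [AlgHom.commutes, AlgHom.commutes, AlgHom.commutes, Algebra.algebraMap_eq_smul_one,
      Algebra.algebraMap_eq_smul_one, LinearMap.smul_apply, LinearMap.smul_apply, map_smul]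
    rfl
  | hadd x y hx hy =>
    intro W
    rw [map_add, LinearMap.add_apply, hx, hy, map_add, map_add, LinearMap.add_apply, map_add]
  | hmul x y hx hy =>
    intro W
    rw [map_mul, Module.End.mul_apply, hy, hx, map_mul, map_mul, Module.End.mul_apply]
  | hgen g =>
    cases g
    · exact h1 true
    · exact h1 false
    · intro W
      change rep hodd hp hq r (U.kap q p) (LinearMap.mul' ℂ (A q p) W) =
        LinearMap.mul' ℂ (A q p) (rep₂ hodd hp hq r (Δ (U.kap q p)) W)
      induction W using TensorProduct.induction_on with
      | zero => simp
      | add x y hx hy => simp only [map_add, hx, hy]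
      | tmul F G =>
        rw [hΔ, U.comul_kap, rep₂_tmul, rep_kap]
        exact map_mul (A.kapAct hq true) F G

/-- The pairing `⟨X, F⟩ = ε(X F)`. -/
def pairing : U q p →ₗ[ℂ] A q p →ₗ[ℂ] ℂ :=
  LinearMap.compr₂ (rep hodd hp hq r).toLinearMap (A.counit hodd.pos)

theorem pairing_apply (X : U q p) (F : A q p) :
    pairing hodd hp hq r X F = A.counit hodd.pos (rep hodd hp hq r X F) := rfl

/-- The unit is invariant. -/
theorem rep_one (X : U q p) : rep hodd hp hq r X 1 = U.counit X • (1 : A q p) := by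
  have h1 : ∀ s, rep hodd hp hq r (U.pS q p s) 1 = U.counit (U.pS q p s) • (1 : A q p) := by
    intro s
    rw [rep_pS, U.counit_pS, zero_smul]
    refine (A.der_red hodd hp hq s _ 1).trans ?_
    rw [Ared.der_one, zero_tmul]
  induction X using U.induction with
  | halg k =>
    rw [AlgHom.commutes, AlgHom.commutes, Algebra.algebraMap_eq_smul_one]
    rfl
  | hadd x y hx hy => rw [map_add, LinearMap.add_apply, hx, hy, map_add, add_smul]
  | hmul x y hx hy =>
    rw [map_mul, Module.End.mul_apply, hy, map_smul, hx, smul_smul, map_mul, mul_comm]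
  | hgen g =>
    cases g
    · exact h1 true
    · exact h1 false
    · change rep hodd hp hq r (U.kap q p) 1 = U.counit (U.kap q p) • (1 : A q p)
      rw [rep_kap, U.counit_kap, one_smul]
      exact map_one (A.kapAct hq true)

theorem pAct_red (s : Bool) (a : Ared q p) : pAct hodd hp hq r s (a ⊗ₜ 1) =
    Ared.der hodd hp hq s (Complex.I * wt r s) a ⊗ₜ 1 :=
  A.der_red hodd hp hq s _ a

theorem evalC_one (x : Plane) : evalC x 1 = 1 := rfl

theorem pairing_pS_etaS (s t : Bool) :
    pairing hodd hp hq r (U.pS q p s) (Ared.etaS q p t ⊗ₜ 1) =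
      if t = s then Complex.I * wt r s else 0 := by
  rw [pairing_apply, rep_pS, pAct_red, Ared.der_etaS, A.counit_tmul, evalC_one, mul_one]
  split_ifs
  · rw [map_smul, Ared.counit_delS, smul_eq_mul, mul_one]
  · rw [map_zero]

theorem pairing_pS_del (s : Bool) :
    pairing hodd hp hq r (U.pS q p s) (Ared.del q p ⊗ₜ 1) = 0 := by
  rw [pairing_apply, rep_pS, pAct_red, Ared.der_del, zero_tmul, map_zero]

theorem pairing_pS_smooth (s : Bool) (f : Smooth Plane) :
    pairing hodd hp hq r (U.pS q p s) (A.ofSmooth q p f) = 0 := by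
  rw [pairing_apply, rep_pS, pAct, A.der_smooth, A.counit_tmul, Ared.corner, map_smul, map_mul,
    map_pow, Ared.counit_etaS, zero_pow (by omega)]
  simp

theorem pairing_kap_tmul (a : Ared q p) (f : Smooth Plane) :
    pairing hodd hp hq r (U.kap q p) (a ⊗ₜ f) =
      Ared.counit hodd.pos (Ared.kapAct hq true a) * f.1 0 := by
  rw [pairing_apply, rep_kap]
  rfl

theorem isDualityPairing : IsDualityPairing hodd hq r (pairing hodd hp hq r) where
  mul_left X Y F := by
    refine ⟨rep hodd hp hq r Y F, fun x => ?_, ?_⟩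
    · rw [← A.counit_coact hodd hq, ← rep_coact, ← LinearMap.lTensor_comp_apply]
      rfl
    · rw [pairing_apply, map_mul]
      rfl
  mul_right X F G := by
    rw [pairing_apply, rep_mul]
    generalize U.comul hodd.pos (hq.ne_zero hodd.pos.ne') X = W
    induction W using TensorProduct.induction_on with
    | zero => simp
    | add x y hx hy => simp only [map_add, LinearMap.add_apply, hx, hy]
    | tmul X Y =>
      rw [rep₂_tmul, LinearMap.mul'_apply, A.counit_mul]
      rfl
  one_left F := by
    rw [pairing_apply, map_one]
    rfl
  one_right X := by
    rw [pairing_apply, rep_one, map_smul]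
    have h : A.counit hodd.pos (1 : A q p) = 1 := by
      refine (A.counit_tmul hodd.pos 1 1).trans ?_
      rw [map_one, evalC_one, mul_one]
    rw [h, smul_eq_mul, mul_one]
  kap_del := by
    rw [A.del, pairing_kap_tmul, Ared.kapAct_del, map_smul, Ared.counit_del]
    simp [wt]
  kap_etaPlus := by
    rw [A.etaPlus, pairing_kap_tmul]
    change Ared.counit hodd.pos (Ared.kapAct hq true (Ared.etaS q p true)) * _ = 0
    rw [Ared.kapAct_etaS, Ared.counit_etaS, zero_mul]
  kap_etaMinus := by
    rw [A.etaMinus, pairing_kap_tmul]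
    change Ared.counit hodd.pos (Ared.kapAct hq true (Ared.etaS q p false)) * _ = 0
    rw [Ared.kapAct_etaS, Ared.counit_etaS, zero_mul]
  kap_smooth f := by rw [A.ofSmooth, pairing_kap_tmul, map_one, map_one, one_mul]
  pPlus_del := pairing_pS_del hodd hp hq r true
  pPlus_etaPlus := pairing_pS_etaS hodd hp hq r true true
  pPlus_etaMinus := pairing_pS_etaS hodd hp hq r true false
  pPlus_smooth := pairing_pS_smooth hodd hp hq r true
  pMinus_del := pairing_pS_del hodd hp hq r false
  pMinus_etaPlus := pairing_pS_etaS hodd hp hq r false true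
  pMinus_etaMinus := pairing_pS_etaS hodd hp hq r false false
  pMinus_smooth := pairing_pS_smooth hodd hp hq r false

end Representation

/-! ### Uniqueness of the pairing -/

/-- An element of `A(E_q(1,1))` is determined by its values. -/
theorem A.ext_evalAt {F G : A q p} (h : ∀ x, A.evalAt x F = A.evalAt x G) : F = G := by
  classical
  rw [← sub_eq_zero]
  have h' : ∀ x, A.evalAt x (F - G) = 0 := fun x => by rw [map_sub, h, sub_self]
  generalize F - G = H at h'
  let b := Module.Basis.ofVectorSpace ℂ (Ared q p)
  let e := TensorProduct.equivFinsuppOfBasisLeft (N := Smooth Plane) b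
  have key : ∀ (H : A q p) x i, evalC x (e H i) = b.repr (A.evalAt x H) i := by
    intro H x i
    induction H using TensorProduct.induction_on with
    | zero => simp
    | add y z hy hz => simp only [map_add, Finsupp.add_apply, hy, hz]
    | tmul a f =>
      rw [TensorProduct.equivFinsuppOfBasisLeft_apply_tmul_apply, map_smul]
      change b.repr a i * evalC x f = b.repr (evalC x f • a) i
      rw [map_smul, Finsupp.smul_apply, smul_eq_mul, mul_comm]
  refine e.injective ?_
  rw [map_zero]
  refine Finsupp.ext fun i => Subtype.ext (funext fun x => ?_)
  have h2 := key H x i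
  rw [h', map_zero] at h2
  exact h2

/-- The set of `X` for which `⟨X, ·⟩` is determined is closed under products, because an element of
`A(E_q(1,1))` is determined by its values; it contains `κ`, and then `p_±`, because their coproducts
reduce `⟨X, FG⟩` to the factors. -/
theorem isDualityPairing_unique {hodd : Odd p} {hq : IsPrimitiveRoot q p} {r : ℂ}
    {B B' : U q p →ₗ[ℂ] A q p →ₗ[ℂ] ℂ} (h : IsDualityPairing hodd hq r B)
    (h' : IsDualityPairing hodd hq r B') : B' = B := by
  have hone : B' 1 = B 1 := LinearMap.ext fun F => by rw [h.one_left, h'.one_left]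
  have hmul : ∀ X Y, B' X = B X → B' Y = B Y → B' (X * Y) = B (X * Y) := by
    intro X Y hX hY
    refine LinearMap.ext fun F => ?_
    obtain ⟨H, hH, e⟩ := h.mul_left X Y F
    obtain ⟨H', hH', e'⟩ := h'.mul_left X Y F
    have : H' = H := A.ext_evalAt fun x => by rw [hH, hH', hY]
    rw [e, e', hX, this]
  have hkap : B' (U.kap q p) = B (U.kap q p) := by
    refine LinearMap.ext fun F => ?_
    induction F using A.induction with
    | hadd x y hx hy => rw [map_add, map_add, hx, hy]
    | hmul x y hx hy =>
      rw [h.mul_right, h'.mul_right, U.comul_kap]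
      change B' _ x * B' _ y = B _ x * B _ y
      rw [hx, hy]
    | hgen g =>
      cases g
      · exact h'.kap_etaPlus.trans h.kap_etaPlus.symm
      · exact h'.kap_etaMinus.trans h.kap_etaMinus.symm
      · exact h'.kap_del.trans h.kap_del.symm
    | hsmooth f => rw [h.kap_smooth, h'.kap_smooth]
  have hkapInv : B' (U.kapInv q p) = B (U.kapInv q p) := by
    have : ∀ n, B' (U.kap q p ^ n) = B (U.kap q p ^ n) := by
      intro n
      induction n with
      | zero => rw [pow_zero, hone]
      | succ n ih => rw [pow_succ]; exact hmul _ _ ih hkap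
    exact this _
  have hp : ∀ s, B' (U.pS q p s) = B (U.pS q p s) := by
    intro s
    refine LinearMap.ext fun F => ?_
    induction F using A.induction with
    | hadd x y hx hy => rw [map_add, map_add, hx, hy]
    | hmul x y hx hy =>
      rw [h.mul_right, h'.mul_right, U.comul_pS, map_add, map_add, map_add, map_add]
      change B' _ x * B' _ y + B' _ x * B' _ y = B _ x * B _ y + B _ x * B _ y
      rw [hx, hy, hkap, hkapInv]
    | hgen g =>
      cases s <;> cases g
      · exact h'.pMinus_etaPlus.trans h.pMinus_etaPlus.symm
      · exact h'.pMinus_etaMinus.trans h.pMinus_etaMinus.symm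
      · exact h'.pMinus_del.trans h.pMinus_del.symm
      · exact h'.pPlus_etaPlus.trans h.pPlus_etaPlus.symm
      · exact h'.pPlus_etaMinus.trans h.pPlus_etaMinus.symm
      · exact h'.pPlus_del.trans h.pPlus_del.symm
    | hsmooth f =>
      cases s
      · exact (h'.pMinus_smooth f).trans (h.pMinus_smooth f).symm
      · exact (h'.pPlus_smooth f).trans (h.pPlus_smooth f).symm
  refine LinearMap.ext fun X => ?_
  induction X using U.induction with
  | halg k => rw [Algebra.algebraMap_eq_smul_one, map_smul, map_smul, hone]
  | hadd x y hx hy => rw [map_add, map_add, hx, hy]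
  | hmul x y hx hy => exact hmul x y hx hy
  | hgen g =>
    cases g
    · exact hp true
    · exact hp false
    · exact hkap

/-! ### The idempotents `ζ(k)` -/

theorem sum_root_pow (hq : IsPrimitiveRoot q p) (k : ℕ) :
    ∑ n ∈ Finset.range p, q⁻¹ ^ (n * k) = if p ∣ k then (p : ℂ) else 0 := by
  have hc : ∀ n ∈ Finset.range p, q⁻¹ ^ (n * k) = (q⁻¹ ^ k) ^ n := fun n _ => by
    rw [← pow_mul, mul_comm]
  rw [Finset.sum_congr rfl hc]
  split_ifs with h
  · rw [(hq.inv.pow_eq_one_iff_dvd k).mpr h]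
    simp
  · have h1 : q⁻¹ ^ k ≠ 1 := fun h1 => h ((hq.inv.pow_eq_one_iff_dvd k).mp h1)
    have h2 := geom_sum_mul (q⁻¹ ^ k) p
    rw [← pow_mul, mul_comm k p, pow_mul, hq.inv.pow_eq_one, one_pow, sub_self] at h2
    exact (mul_eq_zero.mp h2).resolve_right (sub_ne_zero.mpr h1)

/-- Adding `(p - 1) j` stands for subtracting `j` modulo `p`, without truncation. -/
theorem modEq_add_pred_mul (hp : 0 < p) (k j : ℕ) : k + (p - 1) * j + j ≡ k [MOD p] := by
  have hp1 : p - 1 + 1 = p := Nat.sub_add_cancel hp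
  have h : k + (p - 1) * j + j = k + p * j := by
    calc k + (p - 1) * j + j = k + (p - 1 + 1) * j := by ring
      _ = k + p * j := by rw [hp1]
  rw [h]
  exact Nat.add_mul_mod_self_left k p j

namespace Ared

/-- `ζ(k)` in `A(E(1,1|p))`. -/
def zeta (q : ℂ) (p : ℕ) (k : ℕ) : Ared q p :=
  (p : ℂ)⁻¹ • ∑ n ∈ Finset.range p, q⁻¹ ^ (n * k) • del q p ^ n

theorem zeta_congr (hq : IsPrimitiveRoot q p) {k k' : ℕ} (h : k ≡ k' [MOD p]) :
    zeta q p k = zeta q p k' := by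
  rw [zeta, zeta]
  congr 1
  refine Finset.sum_congr rfl fun n _ => ?_
  congr 1
  exact pow_eq_pow_of_modEq (Nat.ModEq.mul_left n h) hq.inv.pow_eq_one

theorem counit_zeta (hodd : Odd p) (hq : IsPrimitiveRoot q p) (k : ℕ) :
    counit hodd.pos (zeta q p k) = if p ∣ k then 1 else 0 := by
  have hp0 : (p : ℂ) ≠ 0 := Nat.cast_ne_zero.mpr hodd.pos.ne'
  have h : ∀ n ∈ Finset.range p, counit hodd.pos (q⁻¹ ^ (n * k) • del q p ^ n) = q⁻¹ ^ (n * k) :=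
    fun n _ => by rw [map_smul, map_pow, counit_del, one_pow, smul_eq_mul, mul_one]
  rw [zeta, map_smul, map_sum, Finset.sum_congr rfl h, sum_root_pow hq]
  split_ifs
  · exact inv_mul_cancel₀ hp0
  · exact smul_zero _

theorem sum_zeta (hodd : Odd p) (hq : IsPrimitiveRoot q p) :
    ∑ k ∈ Finset.range p, zeta q p k = 1 := by
  have hp0 : (p : ℂ) ≠ 0 := Nat.cast_ne_zero.mpr hodd.pos.ne'
  have h : ∀ n ∈ Finset.range p, ∑ k ∈ Finset.range p, q⁻¹ ^ (n * k) • del q p ^ n =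
      if n = 0 then (p : ℂ) • (1 : Ared q p) else 0 := fun n hn => by
    rw [← Finset.sum_smul]
    simp_rw [mul_comm n]
    rw [sum_root_pow hq]
    rw [Finset.mem_range] at hn
    by_cases h0 : n = 0
    · simp [h0]
    · rw [if_neg h0, if_neg (fun hd => h0 (Nat.eq_zero_of_dvd_of_lt hd hn)), zero_smul]
  simp only [zeta]
  rw [← Finset.smul_sum, Finset.sum_comm, Finset.sum_congr rfl h, Finset.sum_ite_eq',
    if_pos (Finset.mem_range.mpr hodd.pos), smul_smul, inv_mul_cancel₀ hp0, one_smul]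

theorem del_mul_zeta (hodd : Odd p) (hq : IsPrimitiveRoot q p) (k : ℕ) :
    del q p * zeta q p k = q ^ k • zeta q p k := by
  have hq0 : q ≠ 0 := hq.ne_zero hodd.pos.ne'
  rw [zeta, mul_smul_comm, smul_comm (q ^ k), Finset.mul_sum]
  congr 1
  have h : ∀ n ∈ Finset.range p, del q p * q⁻¹ ^ (n * k) • del q p ^ n =
      q ^ k • (q⁻¹ ^ ((n + 1) * k) • del q p ^ (n + 1)) := fun n _ => by
    rw [mul_smul_comm, ← pow_succ', smul_smul, add_mul, one_mul, pow_add q⁻¹,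
      mul_comm _ (q⁻¹ ^ k), ← mul_assoc, ← mul_pow, mul_inv_cancel₀ hq0, one_pow, one_mul]
  rw [Finset.sum_congr rfl h, ← Finset.smul_sum]
  congr 1
  have h1 := Finset.sum_range_succ (fun n => q⁻¹ ^ (n * k) • del q p ^ n) p
  rw [Finset.sum_range_succ', pow_mul q⁻¹ p, hq.inv.pow_eq_one, del_pow, one_pow, zero_mul,
    pow_zero, pow_zero] at h1
  exact add_right_cancel h1

theorem delS_mul_zeta (hodd : Odd p) (hq : IsPrimitiveRoot q p) (s : Bool) (k : ℕ) :
    delS q p s * zeta q p k = wt q s ^ k • zeta q p k := by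
  cases s
  · have hq0 : q ≠ 0 := hq.ne_zero hodd.pos.ne'
    have h : delInv q p * (del q p * zeta q p k) = zeta q p k := by
      rw [← mul_assoc, delInv_mul hodd.pos, one_mul]
    rw [del_mul_zeta hodd hq, mul_smul_comm] at h
    nth_rewrite 2 [← h]
    rw [smul_smul, wt, ← mul_pow, inv_mul_cancel₀ hq0, one_pow, one_smul, delS]
  · exact del_mul_zeta hodd hq k

theorem kapAct_zeta (hodd : Odd p) (hq : IsPrimitiveRoot q p) (k : ℕ) :
    kapAct hq true (zeta q p (k + 1)) = zeta q p k := by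
  have hq0 : q ≠ 0 := hq.ne_zero hodd.pos.ne'
  rw [zeta, map_smul, map_sum, zeta]
  congr 1
  refine Finset.sum_congr rfl fun n _ => ?_
  rw [map_smul, map_pow, kapAct_del, smul_pow, smul_smul, wt, mul_add, mul_one, pow_add, mul_assoc,
    ← mul_pow, inv_mul_cancel₀ hq0, one_pow, mul_one]

variable (hodd : Odd p) (hp : 1 < p) (hq : IsPrimitiveRoot q p)

theorem der_zeta (s : Bool) (c : ℂ) (k : ℕ) : der hodd hp hq s c (zeta q p k) = 0 := by
  rw [zeta, map_smul, map_sum, Finset.sum_eq_zero, smul_zero]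
  intro n _
  rw [map_smul, der_pow_eq_zero hodd hp hq (der_del hodd hp hq s c), smul_zero]

/-! ### Iterated action of `p_±` on monomials -/

theorem der_pow_mul_of_invariant {s : Bool} {c : ℂ} {a : Ared q p} (h : der hodd hp hq s c a = 0)
    (hK : kapAct hq false a = a) (n : ℕ) (b : Ared q p) :
    (der hodd hp hq s c ^ n) (a * b) = a * (der hodd hp hq s c ^ n) b := by
  induction n generalizing b with
  | zero => rfl
  | succ n ih =>
    rw [pow_succ, Module.End.mul_apply, der_mul, h, hK, zero_mul, add_zero, ih]
    rfl

theorem der_pow_etaS_not_mul (s : Bool) (c : ℂ) (n m : ℕ) (b : Ared q p) :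
    (der hodd hp hq s c ^ n) (etaS q p (!s) ^ m * b) =
      etaS q p (!s) ^ m * (der hodd hp hq s c ^ n) b := by
  refine der_pow_mul_of_invariant hodd hp hq (der_pow_eq_zero hodd hp hq ?_ m) ?_ n b
  · rw [der_etaS, if_neg (by cases s <;> simp)]
  · rw [map_pow, kapAct_etaS]

theorem der_etaS_pow_mul_zeta (s : Bool) (c : ℂ) (l k : ℕ) :
    der hodd hp hq s c (etaS q p s ^ (l + 1) * zeta q p (k + l + 1)) =
      (c * wt q s ^ k * qInt (wt q s) (l + 1)) • (etaS q p s ^ l * zeta q p (k + l)) := by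
  have hw0 := wt_ne_zero hodd hq s
  rw [der_mul, der_zeta, mul_zero, zero_add, der_etaS_pow, kapAct_zeta hodd, smul_mul_assoc,
    mul_assoc (etaS q p s ^ l), delS_mul_zeta hodd hq, mul_smul_comm, smul_smul]
  congr 1
  have h : (wt q s)⁻¹ ^ l * wt q s ^ (k + l) = wt q s ^ k := by
    rw [pow_add, mul_left_comm, ← mul_pow, inv_mul_cancel₀ hw0, one_pow, mul_one]
  rw [← h]
  ring

theorem der_pow_etaS_pow_mul_zeta (s : Bool) (c : ℂ) (n k : ℕ) :
    (der hodd hp hq s c ^ n) (etaS q p s ^ n * zeta q p (k + n)) =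
      ((c * wt q s ^ k) ^ n * qFact q n) • zeta q p k := by
  induction n with
  | zero => simp [qFact_zero]
  | succ n ih =>
    rw [pow_succ, Module.End.mul_apply, ← add_assoc, der_etaS_pow_mul_zeta, map_smul, ih, smul_smul,
      ← qFact_wt q s (n + 1), qFact_succ, qFact_wt]
    congr 1
    ring

theorem der_pow_etaS_pow_mul_zeta_of_lt (s : Bool) (c : ℂ) {n a : ℕ} (h : a < n) (k : ℕ) :
    (der hodd hp hq s c ^ n) (etaS q p s ^ a * zeta q p k) = 0 := by
  obtain ⟨j, rfl⟩ := Nat.exists_eq_add_of_lt h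
  have hk : zeta q p k = zeta q p (k + (p - 1) * a + a) := by
    exact zeta_congr hq (modEq_add_pred_mul hodd.pos k a).symm
  rw [show a + j + 1 = j + (1 + a) by ring, pow_add, pow_add, Module.End.mul_apply,
    Module.End.mul_apply, hk, der_pow_etaS_pow_mul_zeta, map_smul, pow_one, der_zeta, smul_zero,
    map_zero]

/-- Each application of `p_±` removes at most one power of `η_±`. -/
theorem exists_der_pow_etaS_pow_mul (s : Bool) (c : ℂ) (n k : ℕ) (x : Ared q p) :
    ∃ y, (der hodd hp hq s c ^ n) (etaS q p s ^ (k + n) * x) = etaS q p s ^ k * y := by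
  induction n generalizing x with
  | zero => exact ⟨x, rfl⟩
  | succ n ih =>
    have h : ∃ y, der hodd hp hq s c (etaS q p s ^ (k + (n + 1)) * x) =
        etaS q p s ^ (k + n) * y := by
      rw [← add_assoc, der_mul, der_etaS_pow, map_pow, kapAct_etaS]
      exact ⟨etaS q p s * der hodd hp hq s c x +
        (c * (wt q s)⁻¹ ^ (k + n) * qInt (wt q s) (k + n + 1)) •
          (delS q p s * kapAct hq true x), by
        rw [mul_add, ← mul_assoc, ← pow_succ, smul_mul_assoc, mul_assoc (_ ^ _) (delS q p s),
          mul_smul_comm]⟩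
    obtain ⟨y, hy⟩ := h
    obtain ⟨z, hz⟩ := ih y
    exact ⟨z, by rw [pow_succ, Module.End.mul_apply, hy, hz]⟩

theorem counit_etaS_pow_mul (s : Bool) {k : ℕ} (hk : k ≠ 0) (x : Ared q p) :
    counit hodd.pos (etaS q p s ^ k * x) = 0 := by
  rw [map_mul, map_pow, counit_etaS, zero_pow hk, zero_mul]

/-- The pairing of `p₊ⁿ p₋ᵐ` with `η₊ᵃ η₋ᵇ ζ(k)`. -/
theorem counit_der_pow_der_pow (c c' : ℂ) (n m a b k : ℕ) :
    counit hodd.pos ((der hodd hp hq true c ^ n) ((der hodd hp hq false c' ^ m)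
      (etaS q p true ^ a * etaS q p false ^ b * zeta q p k))) =
    if n = a ∧ m = b ∧ n + m ≡ k [MOD p] then
      c ^ n * c' ^ m * q⁻¹ ^ (n * m) * qFact q n * qFact q m else 0 := by
  rw [mul_assoc, show etaS q p true = etaS q p (!false) from rfl, der_pow_etaS_not_mul,
    Bool.not_false]
  rcases lt_trichotomy m b with h | rfl | h
  · obtain ⟨j, rfl⟩ := Nat.exists_eq_add_of_lt h
    rw [if_neg (by omega), show m + j + 1 = j + 1 + m by ring]
    obtain ⟨y, hy⟩ := exists_der_pow_etaS_pow_mul hodd hp hq false c' m (j + 1) (zeta q p k)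
    have h1 := qcomm_pow_pow (etaS_mul_not hodd hq true) a (j + 1)
    rw [Bool.not_true] at h1
    rw [hy, ← mul_assoc, h1, smul_mul_assoc, map_smul, map_smul, mul_assoc,
      show etaS q p false = etaS q p (!true) from rfl, der_pow_etaS_not_mul,
      counit_etaS_pow_mul hodd _ (by omega), smul_zero]
  · -- shift `k` by a multiple of `p`, so that it becomes `j + n + m`
    set j := k + (p - 1) * (n + m) with hj
    have hmod : j + n + m ≡ k [MOD p] := by
      rw [add_assoc]
      exact modEq_add_pred_mul hodd.pos k (n + m)
    have hdvd : n + m ≡ k [MOD p] ↔ p ∣ j := by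
      rw [← Nat.modEq_zero_iff_dvd]
      constructor
      · intro h
        have h2 : j + (n + m) ≡ 0 + (n + m) [MOD p] := by
          rw [zero_add, ← add_assoc]; exact hmod.trans h.symm
        exact Nat.ModEq.add_right_cancel' _ h2
      · intro h
        have h2 : j + (n + m) ≡ 0 + (n + m) [MOD p] := h.add_right _
        rw [zero_add, ← add_assoc] at h2
        exact h2.symm.trans hmod
    rw [← zeta_congr hq hmod, der_pow_etaS_pow_mul_zeta, mul_smul_comm, map_smul, map_smul]
    rcases lt_trichotomy n a with h | rfl | h
    · obtain ⟨i, rfl⟩ := Nat.exists_eq_add_of_lt h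
      obtain ⟨y, hy⟩ := exists_der_pow_etaS_pow_mul hodd hp hq true c n (i + 1) (zeta q p (j + n))
      rw [if_neg (by omega), show n + i + 1 = i + 1 + n by ring, hy,
        counit_etaS_pow_mul hodd _ (by omega), smul_zero]
    · rw [der_pow_etaS_pow_mul_zeta, map_smul, counit_zeta hodd hq]
      by_cases h : p ∣ j
      · have hw1 : wt q true ^ j = 1 := ((wt_prim hq true).pow_eq_one_iff_dvd j).mpr h
        have hw2 : wt q false ^ j = 1 := ((wt_prim hq false).pow_eq_one_iff_dvd j).mpr h
        rw [if_pos h, if_pos ⟨rfl, rfl, hdvd.mpr h⟩, hw1, pow_add, hw2, wt]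
        simp only [smul_eq_mul, mul_one, one_mul, mul_pow, ← pow_mul]
        ring
      · rw [if_neg h, if_neg (fun h' => h (hdvd.mp h'.2.2)), smul_zero, smul_zero]
    · rw [if_neg (by omega), der_pow_etaS_pow_mul_zeta_of_lt hodd hp hq true c h, map_zero,
        smul_zero]
  · rw [if_neg (by omega), der_pow_etaS_pow_mul_zeta_of_lt hodd hp hq false c' h, mul_zero,
      map_zero, map_zero]

end Ared

/-! ### The action of `P_±` -/

namespace U

theorem pS_mul_kap (s : Bool) : pS q p s * kap q p = (wt q s)⁻¹ • (kap q p * pS q p s) := by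
  cases s
  · rw [wt, inv_inv]
    exact minus_kap q p
  · exact plus_kap q p

theorem kap_mul_pS (hq0 : q ≠ 0) (s : Bool) :
    kap q p * pS q p s = wt q s • (pS q p s * kap q p) := by
  have h0 : wt q s ≠ 0 := by cases s <;> simp [wt, hq0]
  rw [pS_mul_kap, smul_smul, mul_inv_cancel₀ h0, one_smul]

theorem kapInv_mul_pS (hp : 0 < p) (s : Bool) :
    kapInv q p * pS q p s = (wt q s)⁻¹ • (pS q p s * kapInv q p) := by
  calc kapInv q p * pS q p s = kapInv q p * (pS q p s * kap q p) * kapInv q p := by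
        rw [mul_assoc, mul_assoc, mul_kapInv hp, mul_one]
    _ = _ := by
        rw [pS_mul_kap, mul_smul_comm, smul_mul_assoc, ← mul_assoc, kapInv_mul hp, one_mul]

theorem kapInv_pow (q : ℂ) (p : ℕ) : kapInv q p ^ p = 1 := by
  rw [kapInv, ← pow_mul, mul_comm, pow_mul, kap_pow, one_pow]

/-- `P_±` is primitive. -/
theorem comul_pS_pow (hodd : Odd p) (hq : IsPrimitiveRoot q p) (s : Bool) :
    comul hodd.pos (hq.ne_zero hodd.pos.ne') (pS q p s ^ p) =
      (pS q p s ^ p) ⊗ₜ 1 + 1 ⊗ₜ (pS q p s ^ p) := by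
  have hq0 := hq.ne_zero hodd.pos.ne'
  have h0 := wt_ne_zero hodd hq s
  have h : (pS q p s ⊗ₜ[ℂ] kap q p) * (kapInv q p ⊗ₜ[ℂ] pS q p s) =
      (wt q s ^ 2) • ((kapInv q p ⊗ₜ[ℂ] pS q p s) * (pS q p s ⊗ₜ[ℂ] kap q p)) := by
    rw [Algebra.TensorProduct.tmul_mul_tmul, Algebra.TensorProduct.tmul_mul_tmul,
      kap_mul_pS hq0, kapInv_mul_pS hodd.pos, tmul_smul, ← smul_tmul', smul_smul, sq,
      mul_inv_cancel_right₀ h0]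
  rw [map_pow, comul_pS, add_pow_prim hodd.pos (Ared.prim_sq hodd (wt_prim hq s)) h,
    Algebra.TensorProduct.tmul_pow, Algebra.TensorProduct.tmul_pow, kap_pow, kapInv_pow]

end U

section Action

variable (hodd : Odd p) (hp : 1 < p) (hq : IsPrimitiveRoot q p) (r : ℂ)

/-- In `p_±ⁿ (η_±ⁿ δ^{±j} g)` with `n + j = p` no derivative of `g` survives. -/
theorem pAct_pow_etaS (s : Bool) (c : ℂ) (n j : ℕ) (h : n + j = p) (hj : j ≠ 0) (g : Smooth Plane) :
    (A.der hodd hp hq s c ^ n) ((Ared.etaS q p s ^ n * Ared.delS q p s ^ j) ⊗ₜ g) =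
      (c ^ n * qFact q n * (wt q s)⁻¹ ^ (n ^ 2)) • (1 ⊗ₜ g) := by
  have hw0 := wt_ne_zero hodd hq s
  induction n generalizing j with
  | zero =>
    obtain rfl : j = p := by omega
    simp [Ared.delS_pow, qFact_zero]
  | succ n ih =>
    have h1 : wt q s ^ j = (wt q s)⁻¹ ^ (n + 1) := by
      rw [inv_pow]
      refine eq_inv_of_mul_eq_one_left ?_
      rw [← pow_add, add_comm, h, (wt_prim hq s).pow_eq_one]
    have h2 : Ared.kapAct hq true (Ared.delS q p s) = wt q s • Ared.delS q p s :=
      Ared.kapAct_delS hodd hq true s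
    -- the derivative of `g` comes with the power `n + p` of `η`, which vanishes
    have h3 : Ared.kapAct hq false (Ared.etaS q p s ^ (n + 1) * Ared.delS q p s ^ j) *
        Ared.corner q p s c = 0 := by
      rw [Ared.kapAct_mul_corner hodd, Ared.corner, map_mul, map_pow, map_pow, Ared.kapAct_etaS,
        smul_mul_assoc, ← mul_assoc, mul_assoc _ (Ared.delS q p s),
        ← pow_one (Ared.delS q p s), qcomm_pow_pow (Ared.delS_mul_etaS hodd hq s s), mul_smul_comm,
        ← mul_assoc, ← pow_add, Ared.etaS_pow_eq_zero s (by omega), zero_mul, smul_zero, zero_mul,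
        smul_zero]
    rw [pow_succ, Module.End.mul_apply, A.der_tmul, h3, zero_tmul, add_zero, Ared.der_mul,
      Ared.der_pow_eq_zero hodd hp hq (Ared.der_delS hodd hp hq s s c), mul_zero, zero_add,
      Ared.der_etaS_pow, map_pow, h2, smul_pow, smul_mul_assoc, mul_smul_comm,
      mul_assoc (_ ^ n), ← pow_succ', ← smul_tmul', ← smul_tmul', map_smul, map_smul,
      ih (j + 1) (by omega) (by omega), smul_smul, smul_smul, h1, ← qFact_wt q s (n + 1),
      qFact_succ, qFact_wt]
    congr 1
    ring

theorem wt_pow_eq (hr : r ^ p = -1) (s : Bool) : wt r s ^ p = -1 := by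
  cases s
  · rw [wt, inv_pow, hr, inv_neg, inv_one]
  · exact hr

/-- `P_±` acts as `i ∂_±`. -/
theorem rep_pS_pow (hr : r ^ p = -1) (s : Bool) :
    rep hodd hp hq r (U.pS q p s ^ p) = Complex.I • (dS s).lTensor (Ared q p) := by
  have hp1 : p - 1 + 1 = p := Nat.sub_add_cancel hodd.pos
  have hw0 := wt_ne_zero hodd hq s
  have hmul : ∀ F G, rep hodd hp hq r (U.pS q p s ^ p) (F * G) =
      rep hodd hp hq r (U.pS q p s ^ p) F * G + F * rep hodd hp hq r (U.pS q p s ^ p) G := by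
    intro F G
    rw [rep_mul, U.comul_pS_pow hodd hq, map_add, LinearMap.add_apply, map_add, rep₂_tmul,
      rep₂_tmul, map_one]
    rfl
  have hmul' : ∀ F G : A q p, (Complex.I • (dS s).lTensor (Ared q p)) (F * G) =
      (Complex.I • (dS s).lTensor (Ared q p)) F * G +
        F * (Complex.I • (dS s).lTensor (Ared q p)) G := by
    intro F G
    simp only [LinearMap.smul_apply, smul_mul_assoc, mul_smul_comm, ← smul_add]
    congr 1
    induction F using TensorProduct.induction_on with
    | zero => simp
    | add x y hx hy => simp only [add_mul, map_add, hx, hy]; abel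
    | tmul a f =>
      induction G using TensorProduct.induction_on with
      | zero => simp
      | add x y hx hy => simp only [mul_add, map_add, hx, hy]; abel
      | tmul b g =>
        simp only [Algebra.TensorProduct.tmul_mul_tmul, LinearMap.lTensor_tmul, dS_mul, tmul_add]
        abel
  have hred : ∀ a : Ared q p, Ared.der hodd hp hq s (Complex.I * wt r s)
      (Ared.der hodd hp hq s (Complex.I * wt r s) a) = 0 →
      rep hodd hp hq r (U.pS q p s ^ p) (a ⊗ₜ 1) =
        (Complex.I • (dS s).lTensor (Ared q p)) (a ⊗ₜ 1) := by
    intro a ha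
    rw [LinearMap.smul_apply, LinearMap.lTensor_tmul, dS_one, tmul_zero, smul_zero, map_pow,
      rep_pS, ← pow_sub_mul_pow _ hp, pow_succ _ 1, pow_one, Module.End.mul_apply,
      Module.End.mul_apply, pAct_red, pAct_red, ha, zero_tmul, map_zero]
  have heta : ∀ t, Ared.der hodd hp hq s (Complex.I * wt r s)
      (Ared.der hodd hp hq s (Complex.I * wt r s) (Ared.etaS q p t)) = 0 := by
    intro t
    rw [Ared.der_etaS]
    split_ifs
    · rw [map_smul, Ared.der_delS, smul_zero]
    · rw [map_zero]
  refine LinearMap.ext fun F => ?_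
  induction F using A.induction with
  | hadd x y hx hy => rw [map_add, map_add, hx, hy]
  | hmul x y hx hy => rw [hmul, hmul', hx, hy]
  | hgen g =>
    cases g
    · exact hred _ (heta true)
    · exact hred _ (heta false)
    · refine hred _ ?_
      change Ared.der hodd hp hq s _ (Ared.der hodd hp hq s _ (Ared.del q p)) = 0
      rw [Ared.der_del, map_zero]
  | hsmooth f =>
    have h1 : (pAct hodd hp hq r s ^ p) (A.ofSmooth q p f) =
        (pAct hodd hp hq r s ^ (p - 1)) (Ared.corner q p s (Complex.I * wt r s) ⊗ₜ dS s f) := by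
      rw [← pow_sub_one_mul hodd.pos.ne', Module.End.mul_apply, pAct, A.der_smooth]
    have h2 := pAct_pow_etaS hodd hp hq s (Complex.I * wt r s) (p - 1) 1 hp1 one_ne_zero (dS s f)
    rw [pow_one] at h2
    rw [map_pow, rep_pS, h1, Ared.corner, ← smul_tmul', map_smul, pAct, h2, smul_smul]
    change _ = Complex.I • ((1 : Ared q p) ⊗ₜ dS s f)
    congr 1
    have h3 : qFact q (p - 1) ≠ 0 := qFact_ne_zero hodd hp hq (by omega)
    have h4 : wt q s * (wt q s)⁻¹ ^ ((p - 1) ^ 2) = 1 := by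
      have e : (p - 1) ^ 2 = p * (p - 2) + 1 := by
        obtain ⟨n, rfl⟩ : ∃ n, p = n + 2 := ⟨p - 2, by omega⟩
        rw [show n + 2 - 1 = n + 1 by omega, Nat.add_sub_cancel]
        ring
      rw [e, pow_succ, pow_mul, inv_pow, (wt_prim hq s).pow_eq_one, inv_one, one_pow, one_mul,
        mul_inv_cancel₀ hw0]
    have h5 : (Complex.I * wt r s) * (Complex.I * wt r s) ^ (p - 1) = -(Complex.I ^ p) := by
      rw [← pow_succ', hp1, mul_pow, wt_pow_eq r hr, mul_neg_one]
    have h6 : (-1 : ℂ) ^ ((p + 1) / 2) * -(Complex.I ^ p) = Complex.I := by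
      obtain ⟨m, rfl⟩ := hodd
      rw [show (2 * m + 1 + 1) / 2 = m + 1 by omega, pow_succ, pow_succ, pow_mul, Complex.I_sq]
      have : (-1 : ℂ) ^ m * (-1) ^ m = 1 := by rw [← mul_pow]; simp
      linear_combination Complex.I * this
    calc _ = ((-1) ^ ((p + 1) / 2) * ((Complex.I * wt r s) * (Complex.I * wt r s) ^ (p - 1))) *
          (wt q s * (wt q s)⁻¹ ^ ((p - 1) ^ 2)) := by field_simp
      _ = Complex.I := by rw [h4, h5, h6, mul_one]

/-! ### The duality relations -/

/-- Each application of `p_±` that differentiates `f` produces `η_±^{p-1}`, and each later one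
removes a single power of `η_±`; so after `n` steps these terms are divisible by `η_±^{p-n}`. -/
theorem exists_der_pow_tmul (s : Bool) (c : ℂ) (n k : ℕ) (h : n + k = p) (a : Ared q p)
    (f : Smooth Plane) : ∃ G, (A.der hodd hp hq s c ^ n) (a ⊗ₜ f) =
      (Ared.der hodd hp hq s c ^ n) a ⊗ₜ f + ((Ared.etaS q p s ^ k) ⊗ₜ 1) * G := by
  induction n generalizing k with
  | zero => exact ⟨0, by rw [mul_zero, add_zero]; rfl⟩
  | succ n ih =>
    obtain ⟨G, hG⟩ := ih (k + 1) (by omega)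
    set b := (Ared.der hodd hp hq s c ^ n) a with hb
    rw [pow_succ', Module.End.mul_apply, hG, map_add, A.der_tmul, A.der_mul, A.kapAct_tmul,
      map_pow, Ared.kapAct_etaS, A.der_red, Ared.der_etaS_pow, Ared.kapAct_mul_corner hodd,
      pow_succ' (Ared.der hodd hp hq s c), Module.End.mul_apply, ← hb, Ared.corner]
    refine ⟨(((-1) ^ ((p + 1) / 2) * wt q s * c / qFact q (p - 1)) •
        (Ared.etaS q p s ^ n * Ared.delS q p s * Ared.kapAct hq true b)) ⊗ₜ dS s f +
      ((Ared.etaS q p s ⊗ₜ 1) * A.der hodd hp hq s c G +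
        (((c * (wt q s)⁻¹ ^ k * qInt (wt q s) (k + 1)) • Ared.delS q p s) ⊗ₜ 1) *
          A.kapAct hq true G), ?_⟩
    have e : p - 1 = k + n := by omega
    rw [mul_add, mul_add, Algebra.TensorProduct.tmul_mul_tmul, ← mul_assoc, ← mul_assoc,
      Algebra.TensorProduct.tmul_mul_tmul, Algebra.TensorProduct.tmul_mul_tmul, one_mul, one_mul,
      mul_smul_comm, mul_smul_comm, ← pow_succ, smul_mul_assoc, ← mul_assoc, ← mul_assoc,
      ← pow_add, ← e, add_assoc]

theorem der_pow_etaS_not_tmul_mul (s : Bool) (c : ℂ) (n k : ℕ) (G : A q p) :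
    (A.der hodd hp hq s c ^ n) (((Ared.etaS q p (!s) ^ k) ⊗ₜ 1) * G) =
      ((Ared.etaS q p (!s) ^ k) ⊗ₜ 1) * (A.der hodd hp hq s c ^ n) G := by
  induction n generalizing G with
  | zero => rfl
  | succ n ih =>
    have h : Ared.der hodd hp hq s c (Ared.etaS q p (!s)) = 0 := by
      rw [Ared.der_etaS, if_neg (by cases s <;> simp)]
    rw [pow_succ, Module.End.mul_apply, A.der_mul, A.der_red,
      Ared.der_pow_eq_zero hodd hp hq h, zero_tmul, zero_mul, add_zero, A.kapAct_tmul, map_pow,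
      Ared.kapAct_etaS, ih]
    rfl

theorem counit_lTensor_etaS_mul (L : Smooth Plane →ₗ[ℂ] Smooth Plane) (s : Bool) {k : ℕ}
    (hk : k ≠ 0) (G : A q p) :
    A.counit hodd.pos (L.lTensor (Ared q p) (((Ared.etaS q p s ^ k) ⊗ₜ 1) * G)) = 0 := by
  induction G using TensorProduct.induction_on with
  | zero => simp
  | add x y hx hy => rw [mul_add, map_add, map_add, hx, hy, add_zero]
  | tmul a f =>
    rw [Algebra.TensorProduct.tmul_mul_tmul, LinearMap.lTensor_tmul, A.counit_tmul,
      Ared.counit_etaS_pow_mul hodd s hk, zero_mul]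

/-- For `n, m < p`, the functional `L p₊ⁿ p₋ᵐ` does not mix `A(E(1,1|p))` and the functions. -/
theorem counit_lTensor_der_pow_der_pow (L : Smooth Plane →ₗ[ℂ] Smooth Plane) (c c' : ℂ) {n m : ℕ}
    (hn : n < p) (hm : m < p) (a : Ared q p) (f : Smooth Plane) :
    A.counit hodd.pos (L.lTensor (Ared q p)
      ((A.der hodd hp hq true c ^ n) ((A.der hodd hp hq false c' ^ m) (a ⊗ₜ f)))) =
    Ared.counit hodd.pos ((Ared.der hodd hp hq true c ^ n) ((Ared.der hodd hp hq false c' ^ m) a)) *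
      evalC 0 (L f) := by
  obtain ⟨G, hG⟩ := exists_der_pow_tmul hodd hp hq false c' m (p - m) (by omega) a f
  obtain ⟨G', hG'⟩ := exists_der_pow_tmul hodd hp hq true c n (p - n) (by omega)
    ((Ared.der hodd hp hq false c' ^ m) a) f
  rw [hG, map_add, hG', show Ared.etaS q p false = Ared.etaS q p (!true) from rfl,
    der_pow_etaS_not_tmul_mul, map_add, map_add, map_add, map_add,
    counit_lTensor_etaS_mul hodd L _ (by omega), counit_lTensor_etaS_mul hodd L _ (by omega),
    LinearMap.lTensor_tmul, A.counit_tmul, add_zero, add_zero]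

theorem kapAct_pow_zeta (hodd : Odd p) (hq : IsPrimitiveRoot q p) (n a b k : ℕ) (f : Smooth Plane) :
    ((A.kapAct hq true).toLinearMap ^ n : Module.End ℂ (A q p))
      ((Ared.etaS q p true ^ a * Ared.etaS q p false ^ b * Ared.zeta q p (k + n)) ⊗ₜ f) =
      (Ared.etaS q p true ^ a * Ared.etaS q p false ^ b * Ared.zeta q p k) ⊗ₜ f := by
  induction n with
  | zero => rfl
  | succ n ih =>
    rw [pow_succ, Module.End.mul_apply, AlgHom.toLinearMap_apply, A.kapAct_tmul, map_mul, map_mul,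
      map_pow, map_pow, Ared.kapAct_etaS, Ared.kapAct_etaS, ← add_assoc, Ared.kapAct_zeta hodd, ih]

theorem A.zeta_eq (k : ℕ) : A.zeta q p k = Ared.zeta q p k ⊗ₜ 1 := by
  rw [A.zeta, Ared.zeta, ← smul_tmul', sum_tmul]
  congr 1
  refine Finset.sum_congr rfl fun n _ => ?_
  rw [A.del, Algebra.TensorProduct.tmul_pow, one_pow, smul_tmul']

theorem A.monomial_eq (t s n m k : ℕ) : A.monomial q p t s n m k =
    (Ared.etaS q p true ^ n * Ared.etaS q p false ^ m * Ared.zeta q p k) ⊗ₜ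
      (coordPlus ^ t * coordMinus ^ s) := by
  rw [A.monomial, A.zeta_eq, A.zPlus, A.zMinus, A.ofSmooth, A.ofSmooth, A.etaPlus, A.etaMinus]
  simp only [Algebra.TensorProduct.tmul_pow, Algebra.TensorProduct.tmul_mul_tmul, one_pow, one_mul,
    mul_one]
  rfl

theorem lTensor_dS_pow (s : Bool) (t : ℕ) :
    (Complex.I • (dS s).lTensor (Ared q p) : Module.End ℂ (A q p)) ^ t =
      Complex.I ^ t • ((dS s ^ t : Module.End ℂ (Smooth Plane)).lTensor (Ared q p)) := by
  rw [smul_pow, LinearMap.lTensor_pow]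

/-- The duality relations. The exponent of `κ` shifts `ζ(k')`, so that only the case without `κ`
has to be computed. -/
theorem pairing_monomial (hr : r ^ p = -1) (t s t' s' n m k n' m' k' : ℕ) (hn : n < p)
    (hm : m < p) :
    pairing hodd hp hq r (U.monomial q p t s n m k) (A.monomial q p t' s' n' m' k') =
      if n = n' ∧ m = m' ∧ t = t' ∧ s = s' ∧ k + n + m ≡ k' [MOD p] then
        Complex.I ^ (n + m + t + s) * r ^ n * r⁻¹ ^ m * q⁻¹ ^ (n * m) *
          (Nat.factorial t : ℂ) * (Nat.factorial s : ℂ) * qFact q n * qFact q m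
      else 0 := by
  set j := k' + (p - 1) * k with hj
  have hmod : j + k ≡ k' [MOD p] := modEq_add_pred_mul hodd.pos k' k
  have hiff : k + n + m ≡ k' [MOD p] ↔ n + m ≡ j [MOD p] := by
    constructor
    · intro h
      have h2 : n + m + k ≡ j + k [MOD p] := by
        rw [show n + m + k = k + n + m by ring]; exact h.trans hmod.symm
      exact Nat.ModEq.add_right_cancel' _ h2
    · intro h
      have h2 : n + m + k ≡ j + k [MOD p] := h.add_right _
      rw [show n + m + k = k + n + m by ring] at h2
      exact h2.trans hmod
  rw [A.monomial_eq, ← Ared.zeta_congr hq hmod, pairing_apply, U.monomial]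
  rw [show U.PPlus q p = U.pS q p true ^ p from rfl,
    show U.PMinus q p = U.pS q p false ^ p from rfl,
    show U.pPlus q p = U.pS q p true from rfl, show U.pMinus q p = U.pS q p false from rfl]
  rw [map_mul, map_mul, map_mul, map_mul, map_pow _ (U.pS q p true ^ p), rep_pS_pow hodd hp hq r hr,
    map_pow _ (U.pS q p false ^ p), rep_pS_pow hodd hp hq r hr, map_pow, map_pow, map_pow, rep_pS,
    rep_pS, rep_kap, lTensor_dS_pow, lTensor_dS_pow, smul_mul_smul_comm, ← LinearMap.lTensor_mul]
  simp only [Module.End.mul_apply, smul_mul_assoc, LinearMap.smul_apply]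
  rw [kapAct_pow_zeta hodd hq, map_smul, pAct, pAct,
    counit_lTensor_der_pow_der_pow hodd hp hq _ _ _ hn hm,
    Ared.counit_der_pow_der_pow]
  have hev : evalC 0 ((dS true ^ t * dS false ^ s : Module.End ℂ (Smooth Plane))
      (coordPlus ^ t' * coordMinus ^ s')) = _ := evalC_iterate_monomial t s t' s'
  rw [hev]
  by_cases h1 : n = n' ∧ m = m' ∧ n + m ≡ j [MOD p]
  · by_cases h2 : t = t' ∧ s = s'
    · rw [if_pos h1, if_pos h2, if_pos ⟨h1.1, h1.2.1, h2.1, h2.2, hiff.mpr h1.2.2⟩, smul_eq_mul,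
        mul_pow, mul_pow, wt, wt]
      ring
    · rw [if_neg h2, mul_zero, smul_zero, if_neg (fun h => h2 ⟨h.2.2.1, h.2.2.2.1⟩)]
  · rw [if_neg h1, zero_mul, smul_zero,
      if_neg (fun h => h1 ⟨h.1, h.2.1, hiff.mp h.2.2.2.2⟩)]

end Action

/-! ### The monomial bases -/

/-- A family with a biorthogonal family on the other side of a bilinear form is independent. -/
theorem linearIndependent_of_biorthogonal {ι M N : Type*} [AddCommGroup M] [Module ℂ M]
    [AddCommGroup N] [Module ℂ N] [DecidableEq ι] (B : M →ₗ[ℂ] N →ₗ[ℂ] ℂ) (X : ι → M) (x : ι → N)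
    (h : ∀ a b, B (X a) (x b) = if a = b then 1 else 0) : LinearIndependent ℂ X := by
  rw [linearIndependent_iff']
  intro s g hg i hi
  have h1 := congrArg (fun m => B m (x i)) hg
  simp only [map_sum, map_smul, LinearMap.sum_apply, LinearMap.smul_apply, h, smul_eq_mul, mul_ite,
    mul_one, mul_zero, map_zero, LinearMap.zero_apply] at h1
  rwa [Finset.sum_ite_eq', if_pos hi] at h1

/-- The value of the pairing on a monomial and its dual partner. -/
def pairCoeff (q r : ℂ) (t s n m : ℕ) : ℂ :=
  Complex.I ^ (n + m + t + s) * r ^ n * r⁻¹ ^ m * q⁻¹ ^ (n * m) *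
    (Nat.factorial t : ℂ) * (Nat.factorial s : ℂ) * qFact q n * qFact q m

theorem pairCoeff_ne_zero (hodd : Odd p) (hp : 1 < p) (hq : IsPrimitiveRoot q p) {r : ℂ}
    (hr : r ^ p = -1) (t s : ℕ) {n m : ℕ} (hn : n < p) (hm : m < p) :
    pairCoeff q r t s n m ≠ 0 := by
  have hq0 : q ≠ 0 := hq.ne_zero hodd.pos.ne'
  have hr0 : r ≠ 0 := by
    rintro rfl
    rw [zero_pow hodd.pos.ne'] at hr
    norm_num at hr
  have h1 := qFact_ne_zero hodd hp hq hn
  have h2 := qFact_ne_zero hodd hp hq hm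
  have h3 : (Nat.factorial t : ℂ) ≠ 0 := Nat.cast_ne_zero.mpr (Nat.factorial_ne_zero t)
  have h4 : (Nat.factorial s : ℂ) ≠ 0 := Nat.cast_ne_zero.mpr (Nat.factorial_ne_zero s)
  have h5 := Complex.I_ne_zero
  unfold pairCoeff
  positivity

/-- The element of `U_q(e(1,1))` dual to the monomial `z₊ᵗ z₋ˢ η₊ⁿ η₋ᵐ ζ(k)`. -/
def U.dualMonomial (q : ℂ) (p : ℕ) (r : ℂ) (t s n m k : ℕ) : U q p :=
  (pairCoeff q r t s n m)⁻¹ • U.monomial q p t s n m (k + (p - 1) * (n + m))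

section Duality

variable (hodd : Odd p) (hp : 1 < p) (hq : IsPrimitiveRoot q p) (r : ℂ)

theorem pairing_dualMonomial (hr : r ^ p = -1) (t s t' s' : ℕ) (n m k n' m' k' : Fin p) :
    pairing hodd hp hq r (U.dualMonomial q p r t s n m k) (A.monomial q p t' s' n' m' k') =
      if (t, s, n, m, k) = (t', s', n', m', k') then 1 else 0 := by
  rw [U.dualMonomial, map_smul, LinearMap.smul_apply,
    pairing_monomial hodd hp hq r hr t s t' s' n m _ n' m' k' n.2 m.2]
  have h1 : ((k : ℕ) + (p - 1) * (n + m) + n + m ≡ k' [MOD p]) ↔ k = k' := by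
    have h2 := modEq_add_pred_mul hodd.pos k (n + m)
    rw [add_assoc ((k : ℕ) + _)]
    constructor
    · intro h
      exact Fin.ext ((h2.symm.trans h).eq_of_lt_of_lt k.2 k'.2)
    · rintro rfl
      exact h2
  simp only [Prod.mk.injEq, h1, ← Fin.ext_iff]
  by_cases h : n = n' ∧ m = m' ∧ t = t' ∧ s = s' ∧ k = k'
  · rw [if_pos h, if_pos (by tauto), smul_eq_mul]
    exact inv_mul_cancel₀ (pairCoeff_ne_zero hodd hp hq hr t s n.2 m.2)
  · rw [if_neg h, if_neg (by tauto), smul_zero]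

/-- The monomial dual to `P₊ᵗ P₋ˢ p₊ⁿ p₋ᵐ κᵏ`. -/
def A.dualMonomial (q : ℂ) (p : ℕ) (r : ℂ) (t s n m k : ℕ) : A q p :=
  (pairCoeff q r t s n m)⁻¹ • A.monomial q p t s n m (k + n + m)

theorem pairing_monomial_dual (hr : r ^ p = -1) (t s t' s' : ℕ) (n m k n' m' k' : Fin p) :
    pairing hodd hp hq r (U.monomial q p t s n m k) (A.dualMonomial q p r t' s' n' m' k') =
      if (t, s, n, m, k) = (t', s', n', m', k') then 1 else 0 := by
  rw [A.dualMonomial, map_smul,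
    pairing_monomial hodd hp hq r hr t s t' s' n m k n' m' _ n.2 m.2]
  simp only [Prod.mk.injEq]
  by_cases h : n = n' ∧ m = m' ∧ t = t' ∧ s = s' ∧ k = k'
  · obtain ⟨rfl, rfl, rfl, rfl, rfl⟩ := h
    rw [if_pos ⟨rfl, rfl, rfl, rfl, Nat.ModEq.refl _⟩, if_pos (by tauto), smul_eq_mul]
    exact inv_mul_cancel₀ (pairCoeff_ne_zero hodd hp hq hr t s n.2 m.2)
  · rw [if_neg, if_neg (by tauto), smul_zero]
    rintro ⟨h1, h2, h3, h4, h5⟩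
    obtain rfl := Fin.ext h1
    obtain rfl := Fin.ext h2
    refine h ⟨rfl, rfl, h3, h4, Fin.ext ?_⟩
    exact Nat.ModEq.eq_of_lt_of_lt
      (Nat.ModEq.add_right_cancel' _ (Nat.ModEq.add_right_cancel' _ h5)) k.2 k'.2

end Duality

theorem U.linearIndependent_monomial (hodd : Odd p) (hp : 1 < p)
    (hq : IsPrimitiveRoot q p) (r : ℂ) (hr : r ^ p = -1) :
    LinearIndependent ℂ (fun a : MonIdx p =>
      U.monomial q p a.1 a.2.1 a.2.2.1 a.2.2.2.1 a.2.2.2.2) :=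
  linearIndependent_of_biorthogonal (pairing hodd hp hq r) _
    (fun a : MonIdx p => A.dualMonomial q p r a.1 a.2.1 a.2.2.1 a.2.2.2.1 a.2.2.2.2)
    fun _ _ => pairing_monomial_dual hodd hp hq r hr _ _ _ _ _ _ _ _ _ _

theorem A.linearIndependent_dualMonomial (hodd : Odd p) (hp : 1 < p)
    (hq : IsPrimitiveRoot q p) (r : ℂ) (hr : r ^ p = -1) :
    LinearIndependent ℂ (fun a : MonIdx p =>
      A.dualMonomial q p r a.1 a.2.1 a.2.2.1 a.2.2.2.1 a.2.2.2.2) :=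
  linearIndependent_of_biorthogonal (pairing hodd hp hq r).flip _
    (fun a : MonIdx p => U.monomial q p a.1 a.2.1 a.2.2.1 a.2.2.2.1 a.2.2.2.2)
    fun _ _ => (pairing_monomial_dual hodd hp hq r hr _ _ _ _ _ _ _ _ _ _).trans
      (if_congr eq_comm rfl rfl)

theorem A.linearIndependent_monomial (hodd : Odd p) (hp : 1 < p)
    (hq : IsPrimitiveRoot q p) (r : ℂ) (hr : r ^ p = -1) :
    LinearIndependent ℂ (fun a : MonIdx p =>
      A.monomial q p a.1 a.2.1 a.2.2.1 a.2.2.2.1 a.2.2.2.2) :=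
  linearIndependent_of_biorthogonal (pairing hodd hp hq r).flip _
    (fun a : MonIdx p => U.dualMonomial q p r a.1 a.2.1 a.2.2.1 a.2.2.2.1 a.2.2.2.2)
    fun _ _ => (pairing_dualMonomial hodd hp hq r hr _ _ _ _ _ _ _ _ _ _).trans
      (if_congr eq_comm rfl rfl)

theorem U.pPlus_pow_mul_eq_monomial (N M K : ℕ) :
    pPlus q p ^ N * pMinus q p ^ M * kap q p ^ K =
      monomial q p (N / p) (M / p) (N % p) (M % p) (K % p) := by
  have hc : Commute (pMinus q p ^ p) (pPlus q p) :=
    (show Commute _ _ from (comm q p).symm).pow_left p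
  have hk : kap q p ^ K = kap q p ^ (K % p) := by
    nth_rewrite 1 [← Nat.div_add_mod K p]
    rw [pow_add, pow_mul, kap_pow, one_pow, one_mul]
  rw [monomial, PPlus, PMinus, hk]
  congr 1
  nth_rewrite 1 [← Nat.div_add_mod N p, ← Nat.div_add_mod M p]
  rw [pow_add, pow_add, pow_mul, pow_mul, mul_assoc, ← mul_assoc (pPlus q p ^ (N % p)),
    ← (hc.pow_pow (M / p) (N % p)).eq]
  simp only [mul_assoc]

theorem U.span_monomial (hodd : Odd p) (hq0 : q ≠ 0) :
    Submodule.span ℂ (Set.range fun a : MonIdx p =>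
      U.monomial q p a.1 a.2.1 a.2.2.1 a.2.2.2.1 a.2.2.2.2) = ⊤ := by
  set S := Submodule.span ℂ (Set.range fun a : MonIdx p =>
      U.monomial q p a.1 a.2.1 a.2.2.1 a.2.2.2.1 a.2.2.2.2) with hS
  have hmem : ∀ N M K, pPlus q p ^ N * pMinus q p ^ M * kap q p ^ K ∈ S := fun N M K => by
    rw [U.pPlus_pow_mul_eq_monomial]
    exact Submodule.subset_span ⟨(N / p, M / p, ⟨N % p, Nat.mod_lt _ hodd.pos⟩,
      ⟨M % p, Nat.mod_lt _ hodd.pos⟩, ⟨K % p, Nat.mod_lt _ hodd.pos⟩), rfl⟩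
  have hspan : S ≤ Submodule.span ℂ
      (Set.range fun a : ℕ × ℕ × ℕ => pPlus q p ^ a.1 * pMinus q p ^ a.2.1 * kap q p ^ a.2.2) := by
    refine Submodule.span_le.mpr ?_
    rintro _ ⟨⟨t, s, n, m, k⟩, rfl⟩
    have h := U.pPlus_pow_mul_eq_monomial (q := q) (p := p) (n + p * t) (m + p * s) k
    rw [Nat.add_mul_div_left _ _ hodd.pos, Nat.add_mul_div_left _ _ hodd.pos,
      Nat.add_mul_mod_self_left, Nat.add_mul_mod_self_left, Nat.div_eq_of_lt n.2,
      Nat.div_eq_of_lt m.2, Nat.mod_eq_of_lt n.2, Nat.mod_eq_of_lt m.2, Nat.mod_eq_of_lt k.2,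
      zero_add, zero_add] at h
    exact Submodule.subset_span ⟨(n + p * t, m + p * s, k), h⟩
  have hgen : ∀ g, ∀ x ∈ S, U.gen q p g * x ∈ S := by
    intro g x hx
    refine Submodule.span_induction (p := fun x _ => U.gen q p g * x ∈ S) ?_ ?_ ?_ ?_ (hspan hx)
    · rintro _ ⟨⟨N, M, K⟩, rfl⟩
      have hM : ∀ s N, kap q p * pS q p s ^ N = wt q s ^ N • (pS q p s ^ N * kap q p) :=
        fun s N => qcomm_pow_right (kap_mul_pS hq0 s) N
      cases g
      · have h := hmem (N + 1) M K
        rwa [pow_succ', mul_assoc, mul_assoc, ← mul_assoc (_ ^ N)] at h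
      · have h := hmem N (M + 1) K
        have hc : pMinus q p * pPlus q p ^ N = pPlus q p ^ N * pMinus q p :=
          ((show Commute _ _ from (comm q p).symm).pow_right N).eq
        change pMinus q p * (pPlus q p ^ N * pMinus q p ^ M * kap q p ^ K) ∈ S
        rwa [← mul_assoc, ← mul_assoc, hc, mul_assoc (_ ^ N), ← pow_succ']
      · change kap q p * (pS q p true ^ N * pS q p false ^ M * kap q p ^ K) ∈ S
        have h : kap q p * (pS q p true ^ N * pS q p false ^ M * kap q p ^ K) =
            (wt q true ^ N * wt q false ^ M) •
              (pS q p true ^ N * pS q p false ^ M * kap q p ^ (K + 1)) := by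
          rw [← mul_assoc, ← mul_assoc, hM, smul_mul_assoc, smul_mul_assoc, mul_assoc (_ ^ N), hM,
            mul_smul_comm, smul_mul_assoc, smul_smul, ← mul_assoc, mul_assoc _ (kap q p),
            ← pow_succ']
        rw [h]
        exact S.smul_mem _ (hmem N M (K + 1))
    · rw [mul_zero]; exact S.zero_mem
    · intro x y _ _ hx hy
      rw [mul_add]
      exact S.add_mem hx hy
    · intro c x _ hx
      rw [mul_smul_comm]
      exact S.smul_mem c hx
  have hmul : ∀ X : U q p, ∀ x ∈ S, X * x ∈ S := by
    intro X
    induction X using U.induction with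
    | halg c =>
      intro x hx
      rw [← Algebra.smul_def]
      exact S.smul_mem c hx
    | hadd X Y hX hY =>
      intro x hx
      rw [add_mul]
      exact S.add_mem (hX x hx) (hY x hx)
    | hmul X Y hX hY =>
      intro x hx
      rw [mul_assoc]
      exact hX _ (hY x hx)
    | hgen g => exact hgen g
  refine eq_top_iff.mpr fun X _ => ?_
  have h := hmul X _ (hmem 0 0 0)
  rwa [pow_zero, pow_zero, pow_zero, mul_one, mul_one, mul_one] at h

/-- The monomial `η₊ⁿ η₋ᵐ ζ(k)` of `A(E(1,1|p))`. -/
def Ared.monomial (q : ℂ) (p : ℕ) (n m k : ℕ) : Ared q p :=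
  etaS q p true ^ n * etaS q p false ^ m * zeta q p k

theorem Ared.span_monomial (hodd : Odd p) (hq : IsPrimitiveRoot q p) :
    Submodule.span ℂ (Set.range fun a : Fin p × Fin p × Fin p =>
      Ared.monomial q p a.1 a.2.1 a.2.2) = ⊤ := by
  set S := Submodule.span ℂ (Set.range fun a : Fin p × Fin p × Fin p =>
      Ared.monomial q p a.1 a.2.1 a.2.2) with hS
  have hmem : ∀ n m k, Ared.monomial q p n m k ∈ S := fun n m k => by
    rcases Nat.lt_or_ge n p with hn | hn
    · rcases Nat.lt_or_ge m p with hm | hm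
      · refine Submodule.subset_span ⟨(⟨n, hn⟩, ⟨m, hm⟩, ⟨k % p, Nat.mod_lt _ hodd.pos⟩), ?_⟩
        change Ared.monomial q p n m (k % p) = _
        rw [Ared.monomial, Ared.monomial, Ared.zeta_congr hq (Nat.mod_modEq k p)]
      · rw [Ared.monomial, etaS_pow_eq_zero false hm, mul_zero, zero_mul]
        exact S.zero_mem
    · rw [Ared.monomial, etaS_pow_eq_zero true hn, zero_mul, zero_mul]
      exact S.zero_mem
  have hgen : ∀ g, ∀ x ∈ S, Ared.gen q p g * x ∈ S := by
    intro g x hx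
    refine Submodule.span_induction (p := fun x _ => Ared.gen q p g * x ∈ S) ?_ ?_ ?_ ?_ hx
    · rintro _ ⟨⟨⟨n, hn⟩, ⟨m, hm⟩, ⟨k, hk⟩⟩, rfl⟩
      change Ared.gen q p g * (etaS q p true ^ n * etaS q p false ^ m * zeta q p k) ∈ S
      cases g
      · have h := hmem (n + 1) m k
        rwa [Ared.monomial, pow_succ', mul_assoc, mul_assoc, ← mul_assoc (_ ^ n)] at h
      · change etaS q p false * _ ∈ S
        have h1 := qcomm_pow_right (etaS_mul_not hodd hq false) n
        rw [Bool.not_false] at h1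
        rw [← mul_assoc, ← mul_assoc, h1, smul_mul_assoc, smul_mul_assoc, mul_assoc (_ ^ n),
          ← pow_succ']
        exact S.smul_mem _ (hmem n (m + 1) k)
      · change delS q p true * _ ∈ S
        have h1 := fun s => qcomm_pow_right (delS_mul_etaS hodd hq s true)
        rw [← mul_assoc, ← mul_assoc, h1, smul_mul_assoc, smul_mul_assoc, mul_assoc (_ ^ n), h1,
          mul_smul_comm, smul_mul_assoc, ← mul_assoc, mul_assoc _ (delS q p true),
          delS_mul_zeta hodd hq, mul_smul_comm]
        exact S.smul_mem _ (S.smul_mem _ (S.smul_mem _ (hmem n m k)))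
    · rw [mul_zero]; exact S.zero_mem
    · intro x y _ _ hx hy
      rw [mul_add]
      exact S.add_mem hx hy
    · intro c x _ hx
      rw [mul_smul_comm]
      exact S.smul_mem c hx
  have hmul : ∀ X : Ared q p, ∀ x ∈ S, X * x ∈ S := by
    intro X
    induction X using Ared.induction with
    | halg c =>
      intro x hx
      rw [← Algebra.smul_def]
      exact S.smul_mem c hx
    | hadd X Y hX hY =>
      intro x hx
      rw [add_mul]
      exact S.add_mem (hX x hx) (hY x hx)
    | hmul X Y hX hY =>
      intro x hx
      rw [mul_assoc]
      exact hX _ (hY x hx)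
    | hgen g => exact hgen g
  have hone : (1 : Ared q p) ∈ S := by
    rw [← Ared.sum_zeta hodd hq]
    refine S.sum_mem fun k _ => ?_
    have h := hmem 0 0 k
    rwa [Ared.monomial, pow_zero, pow_zero, one_mul, one_mul] at h
  refine eq_top_iff.mpr fun X _ => ?_
  have h := hmul X 1 hone
  rwa [mul_one] at h

theorem A.monomial_eq_tmul (t s n m k : ℕ) : A.monomial q p t s n m k =
    Ared.monomial q p n m k ⊗ₜ (coordPlus ^ t * coordMinus ^ s) :=
  A.monomial_eq t s n m k

theorem A.monomial_congr (hq : IsPrimitiveRoot q p) (t s n m : ℕ) {k k' : ℕ}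
    (h : k ≡ k' [MOD p]) : A.monomial q p t s n m k = A.monomial q p t s n m k' := by
  rw [A.monomial_eq, A.monomial_eq, Ared.zeta_congr hq h]

theorem A.span_monomial (hodd : Odd p) (hq : IsPrimitiveRoot q p) :
    Submodule.span ℂ (Set.range fun a : MonIdx p =>
      A.monomial q p a.1 a.2.1 a.2.2.1 a.2.2.2.1 a.2.2.2.2) = A.polyPart q p := by
  apply le_antisymm
  · refine Submodule.span_le.mpr ?_
    rintro _ ⟨⟨t, s, n, m, k⟩, rfl⟩
    exact Submodule.subset_span ⟨_, t, s, A.monomial_eq_tmul t s n m k⟩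
  · refine Submodule.span_le.mpr ?_
    rintro _ ⟨a, t, s, rfl⟩
    have ha : a ∈ Submodule.span ℂ (Set.range fun a : Fin p × Fin p × Fin p =>
      Ared.monomial q p a.1 a.2.1 a.2.2) := by rw [Ared.span_monomial hodd hq]; trivial
    change a ⊗ₜ (coordPlus ^ t * coordMinus ^ s) ∈ _
    induction ha using Submodule.span_induction with
    | mem x hx =>
      obtain ⟨⟨n, m, k⟩, rfl⟩ := hx
      exact Submodule.subset_span ⟨(t, s, n, m, k), A.monomial_eq_tmul t s n m k⟩
    | zero => rw [zero_tmul]; exact Submodule.zero_mem _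
    | add x y _ _ hx hy => rw [add_tmul]; exact Submodule.add_mem _ hx hy
    | smul c x _ hx => rw [← smul_tmul']; exact Submodule.smul_mem _ c hx

theorem A.span_dualMonomial (hodd : Odd p) (hp : 1 < p) (hq : IsPrimitiveRoot q p) {r : ℂ}
    (hr : r ^ p = -1) : Submodule.span ℂ (Set.range fun a : MonIdx p =>
      A.dualMonomial q p r a.1 a.2.1 a.2.2.1 a.2.2.2.1 a.2.2.2.2) = A.polyPart q p := by
  rw [← A.span_monomial hodd hq]
  apply le_antisymm
  · refine Submodule.span_le.mpr ?_
    rintro _ ⟨⟨t, s, n, m, k⟩, rfl⟩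
    refine Submodule.smul_mem _ _ (Submodule.subset_span
      ⟨(t, s, n, m, ⟨(k + n + m) % p, Nat.mod_lt _ hodd.pos⟩), ?_⟩)
    exact A.monomial_congr hq t s n m (Nat.mod_modEq _ p)
  · refine Submodule.span_le.mpr ?_
    rintro _ ⟨⟨t, s, n, m, k⟩, rfl⟩
    have h : A.monomial q p t s n m k = pairCoeff q r t s n m •
        A.dualMonomial q p r t s n m ((k + (p - 1) * (n + m)) % p : ℕ) := by
      rw [A.dualMonomial, smul_smul, mul_inv_cancel₀ (pairCoeff_ne_zero hodd hp hq hr t s n.2 m.2),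
        one_smul]
      refine A.monomial_congr hq t s n m ?_
      refine Nat.ModEq.symm (Nat.ModEq.trans ?_ (modEq_add_pred_mul hodd.pos k (n + m)))
      rw [← add_assoc]
      exact ((Nat.mod_modEq _ p).add_right _).add_right _
    change A.monomial q p t s n m k ∈ _
    rw [h]
    exact Submodule.smul_mem _ _ (Submodule.subset_span
      ⟨(t, s, n, m, ⟨(k + (p - 1) * (n + m)) % p, Nat.mod_lt _ hodd.pos⟩), rfl⟩)

/-! ### The canonical element of the pairing -/

theorem coeff_toCompleted_tmul (d : Fin 2 →₀ ℕ) (X : U q p) (a : Ared q p) (f : Smooth Plane) :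
    MvPowerSeries.coeff d (toCompleted (X ⊗ₜ[ℂ] (a ⊗ₜ[ℂ] f))) = taylorCoeff d f • (X ⊗ₜ[ℂ] a) :=
  rfl

theorem taylorCoeff_monomial (d : Fin 2 →₀ ℕ) (t s : ℕ) :
    taylorCoeff d (coordPlus ^ t * coordMinus ^ s) = if d 0 = t ∧ d 1 = s then 1 else 0 := by
  rw [taylorCoeff]
  change ((Nat.factorial (d 0) : ℂ) * (Nat.factorial (d 1) : ℂ))⁻¹ *
    evalC 0 ((dPlus ^ d 0) ((dMinus ^ d 1) (coordPlus ^ t * coordMinus ^ s))) = _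
  rw [evalC_iterate_monomial]
  have h3 : (Nat.factorial (d 0) : ℂ) ≠ 0 := Nat.cast_ne_zero.mpr (Nat.factorial_ne_zero _)
  have h4 : (Nat.factorial (d 1) : ℂ) ≠ 0 := Nat.cast_ne_zero.mpr (Nat.factorial_ne_zero _)
  split_ifs
  · exact inv_mul_cancel₀ (mul_ne_zero h3 h4)
  · rw [mul_zero]

/-- The Taylor coefficients of a polynomial element are its values on the dual monomials. -/
theorem coeff_toCompleted_eq_sum (hodd : Odd p) (hp : 1 < p) (hq : IsPrimitiveRoot q p) {r : ℂ}
    (hr : r ^ p = -1) (d : Fin 2 →₀ ℕ) (X : U q p) {F : A q p} (hF : F ∈ A.polyPart q p) :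
    MvPowerSeries.coeff d (toCompleted (X ⊗ₜ[ℂ] F)) =
      ∑ j : Fin p × Fin p × Fin p,
        pairing hodd hp hq r (U.dualMonomial q p r (d 0) (d 1) j.1 j.2.1 j.2.2) F •
          (X ⊗ₜ[ℂ] Ared.monomial q p j.1 j.2.1 j.2.2) := by
  rw [← A.span_monomial hodd hq] at hF
  induction hF using Submodule.span_induction with
  | mem F hF =>
    obtain ⟨⟨t, s, n, m, k⟩, rfl⟩ := hF
    simp only [pairing_dualMonomial hodd hp hq r hr]
    rw [A.monomial_eq_tmul, coeff_toCompleted_tmul, taylorCoeff_monomial]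
    rw [Finset.sum_eq_single (n, m, k)]
    · simp only [Prod.mk.injEq, and_true]
    · rintro ⟨n', m', k'⟩ _ hne
      rw [if_neg, zero_smul]
      intro h
      exact hne (Prod.ext_iff.mp (Prod.ext_iff.mp h).2).2
    · intro h
      exact absurd (Finset.mem_univ _) h
  | zero => simp only [tmul_zero, map_zero, zero_smul, Finset.sum_const_zero]
  | add x y _ _ hx hy =>
    rw [tmul_add, map_add, map_add, hx, hy, ← Finset.sum_add_distrib]
    simp only [map_add, add_smul]
  | smul c x _ hx =>
    rw [tmul_smul, map_smul, LinearMap.map_smul_of_tower, hx, Finset.smul_sum]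
    simp only [map_smul, smul_assoc]

theorem AreDualBases.apply_eq_repr {B : U q p →ₗ[ℂ] A q p →ₗ[ℂ] ℂ} {ι : Type}
    {X : Module.Basis ι ℂ (U q p)} {x : Module.Basis ι ℂ (A.polyPart q p)}
    (h : AreDualBases B X x) (Y : U q p) (a : ι) : B Y (x a) = X.repr Y a := by
  classical
  have h1 : B.flip (x a) = Finsupp.lapply a ∘ₗ X.repr.toLinearMap := by
    refine X.ext fun b => ?_
    change B (X b) (x a) = X.repr (X b) a
    rw [X.repr_self, Finsupp.single_apply]
    split_ifs with hab
    · rw [hab]; exact h.1 a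
    · exact h.2 b a hab
  exact LinearMap.congr_fun h1 Y

/-- The sum over dual bases does not depend on the bases: expanding the dual monomials `Yⱼ` in the
basis `X` turns `∑ₐ Xᵃ ⊗ xₐ` into `∑ⱼ Yⱼ ⊗ η₊ⁿ η₋ᵐ ζ(k)`, in each degree in `z₊, z₋`. -/
theorem hasFormalSum_of_areDualBases (hodd : Odd p) (hp : 1 < p) (hq : IsPrimitiveRoot q p) {r : ℂ}
    (hr : r ^ p = -1) {ι : Type} {X : Module.Basis ι ℂ (U q p)}
    {x : Module.Basis ι ℂ (A.polyPart q p)} (h : AreDualBases (pairing hodd hp hq r) X x)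
    {T : Completed q p} (hT : ∀ d, MvPowerSeries.coeff d T = ∑ j : Fin p × Fin p × Fin p,
      U.dualMonomial q p r (d 0) (d 1) j.1 j.2.1 j.2.2 ⊗ₜ[ℂ]
        Ared.monomial q p j.1 j.2.1 j.2.2) :
    HasFormalSum (fun a => toCompleted (X a ⊗ₜ[ℂ] (x a : A q p))) T := by
  classical
  intro d
  set Y : Fin p × Fin p × Fin p → U q p :=
    fun j => U.dualMonomial q p r (d 0) (d 1) j.1 j.2.1 j.2.2 with hY
  have hc : ∀ a, MvPowerSeries.coeff d (toCompleted (X a ⊗ₜ[ℂ] (x a : A q p))) =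
      ∑ j : Fin p × Fin p × Fin p,
        X.repr (Y j) a • (X a ⊗ₜ[ℂ] Ared.monomial q p j.1 j.2.1 j.2.2) := fun a => by
    rw [coeff_toCompleted_eq_sum hodd hp hq hr d (X a) (x a).2]
    exact Finset.sum_congr rfl fun j _ => by rw [← h.apply_eq_repr]
  set s : Finset ι := Finset.univ.biUnion fun j => (X.repr (Y j)).support with hs
  have hsub : ∀ j, (X.repr (Y j)).support ⊆ s := fun j =>
    Finset.subset_biUnion_of_mem (fun j => (X.repr (Y j)).support) (Finset.mem_univ j)
  have hzero : {a | MvPowerSeries.coeff d (toCompleted (X a ⊗ₜ[ℂ] (x a : A q p))) ≠ 0} ⊆ ↑s := by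
    intro a ha
    by_contra has
    refine ha ((hc a).trans (Finset.sum_eq_zero fun j _ => ?_))
    rw [Finsupp.notMem_support_iff.mp fun hj => has (hsub j hj), zero_smul]
  refine ⟨s.finite_toSet.subset hzero, ?_⟩
  rw [finsum_eq_sum_of_support_subset _ hzero, Finset.sum_congr rfl fun a _ => hc a,
    Finset.sum_comm, hT]
  refine Finset.sum_congr rfl fun j _ => ?_
  have h1 : ∑ a ∈ s, X.repr (Y j) a • X a = Y j := by
    conv_rhs => rw [← X.linearCombination_repr (Y j), Finsupp.linearCombination_apply]
    exact (Finsupp.sum_of_support_subset _ (hsub j) (fun a c => c • X a)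
      fun a _ => zero_smul ℂ (X a)).symm
  change _ = Y j ⊗ₜ[ℂ] _
  nth_rewrite 2 [← h1]
  rw [sum_tmul]
  exact Finset.sum_congr rfl fun a _ => by rw [smul_tmul']

theorem exists_areDualBases (hodd : Odd p) (hp : 1 < p) (hq : IsPrimitiveRoot q p) {r : ℂ}
    (hr : r ^ p = -1) :
    ∃ (ι : Type) (X : Module.Basis ι ℂ (U q p)) (x : Module.Basis ι ℂ (A.polyPart q p)),
      AreDualBases (pairing hodd hp hq r) X x := by
  have hspan := A.span_dualMonomial hodd hp hq hr
  refine ⟨MonIdx p, Module.Basis.mk (U.linearIndependent_monomial hodd hp hq r hr)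
    (U.span_monomial hodd (hq.ne_zero hodd.pos.ne')).ge,
    (Module.Basis.span (A.linearIndependent_dualMonomial hodd hp hq r hr)).map
      (LinearEquiv.ofEq _ _ hspan), ?_, ?_⟩
  · rintro ⟨t, s, n, m, k⟩
    rw [Module.Basis.mk_apply, Module.Basis.map_apply, LinearEquiv.coe_ofEq_apply,
      Module.Basis.span_apply]
    exact (pairing_monomial_dual hodd hp hq r hr t s t s n m k n m k).trans (if_pos rfl)
  · rintro ⟨t, s, n, m, k⟩ ⟨t', s', n', m', k'⟩ hne
    rw [Module.Basis.mk_apply, Module.Basis.map_apply, LinearEquiv.coe_ofEq_apply,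
      Module.Basis.span_apply]
    exact (pairing_monomial_dual hodd hp hq r hr t s t' s' n m k n' m' k').trans (if_neg hne)

/-! ### The product formula for the universal T-matrix -/

theorem toCompleted_tmul_one (X : U q p) (a : Ared q p) :
    toCompleted (X ⊗ₜ[ℂ] (a ⊗ₜ[ℂ] (1 : Smooth Plane))) = MvPowerSeries.C (X ⊗ₜ[ℂ] a) := by
  classical
  ext d
  have h := taylorCoeff_monomial d 0 0
  rw [pow_zero, pow_zero, one_mul] at h
  rw [coeff_toCompleted_tmul, MvPowerSeries.coeff_C, h]
  have hd : (d 0 = 0 ∧ d 1 = 0) ↔ d = 0 := by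
    rw [Finsupp.ext_iff, Fin.forall_fin_two]
    rfl
  simp only [hd]
  split_ifs
  · rw [one_smul]
  · rw [zero_smul]

theorem C_smul (c : ℂ) (w : U q p ⊗[ℂ] Ared q p) :
    (MvPowerSeries.C (c • w) : Completed q p) = c • MvPowerSeries.C w := by
  classical
  ext d
  rw [LinearMap.map_smul_of_tower, MvPowerSeries.coeff_C, MvPowerSeries.coeff_C]
  split_ifs
  · rfl
  · rw [smul_zero]

theorem finsupp_fin_two_eq_iff (d : Fin 2 →₀ ℕ) (t s : ℕ) :
    d = Finsupp.single 0 t + Finsupp.single 1 s ↔ d 0 = t ∧ d 1 = s := by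
  rw [Finsupp.ext_iff, Fin.forall_fin_two]
  simp

theorem toCompleted_coord (X Y : U q p) :
    toCompleted (X ⊗ₜ[ℂ] A.zPlus q p + Y ⊗ₜ[ℂ] A.zMinus q p) =
      MvPowerSeries.monomial (Finsupp.single 0 1) (X ⊗ₜ[ℂ] (1 : Ared q p)) +
        MvPowerSeries.monomial (Finsupp.single 1 1) (Y ⊗ₜ[ℂ] (1 : Ared q p)) := by
  classical
  ext d
  have h1 := taylorCoeff_monomial d 1 0
  have h2 := taylorCoeff_monomial d 0 1
  rw [pow_one, pow_zero, mul_one] at h1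
  rw [pow_one, pow_zero, one_mul] at h2
  have e1 := finsupp_fin_two_eq_iff d 1 0
  have e2 := finsupp_fin_two_eq_iff d 0 1
  rw [Finsupp.single_zero, add_zero] at e1
  rw [Finsupp.single_zero, zero_add] at e2
  rw [map_add, map_add, A.zPlus, A.zMinus, A.ofSmooth, A.ofSmooth, coeff_toCompleted_tmul,
    coeff_toCompleted_tmul, h1, h2, map_add, MvPowerSeries.coeff_monomial,
    MvPowerSeries.coeff_monomial]
  simp only [e1, e2, ite_smul, one_smul, zero_smul]

theorem monomial_single_pow {R : Type*} [Semiring R] (i : Fin 2) (a : R) (n : ℕ) :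
    (MvPowerSeries.monomial (Finsupp.single i 1) a) ^ n =
      MvPowerSeries.monomial (Finsupp.single i n) (a ^ n) := by
  induction n with
  | zero => rw [pow_zero, pow_zero, Finsupp.single_zero]; rfl
  | succ n ih =>
    rw [pow_succ, ih, MvPowerSeries.monomial_mul_monomial, ← Finsupp.single_add, pow_succ]

/-- The exponential of `α z₊ + β z₋`, for commuting `α` and `β`. -/
theorem coeff_formalExp {α β : U q p ⊗[ℂ] Ared q p} (h : Commute α β) (d : Fin 2 →₀ ℕ) :
    MvPowerSeries.coeff d (formalExp
      (MvPowerSeries.monomial (Finsupp.single 0 1) α +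
        MvPowerSeries.monomial (Finsupp.single 1 1) β)) =
      ((Nat.factorial (d 0) : ℂ) * (Nat.factorial (d 1) : ℂ))⁻¹ • (α ^ d 0 * β ^ d 1) := by
  classical
  have hc : Commute (MvPowerSeries.monomial (Finsupp.single (0 : Fin 2) 1) α)
      (MvPowerSeries.monomial (Finsupp.single (1 : Fin 2) 1) β) := by
    rw [Commute, SemiconjBy, MvPowerSeries.monomial_mul_monomial,
      MvPowerSeries.monomial_mul_monomial, h.eq, add_comm]
  have hn : ∀ n, MvPowerSeries.coeff d ((MvPowerSeries.monomial (Finsupp.single 0 1) α +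
        MvPowerSeries.monomial (Finsupp.single 1 1) β) ^ n) =
      if n = d 0 + d 1 then (n.choose (d 0)) • (α ^ d 0 * β ^ d 1) else 0 := by
    intro n
    rw [hc.add_pow, map_sum]
    have hterm : ∀ m, MvPowerSeries.coeff d
        (MvPowerSeries.monomial (Finsupp.single 0 1) α ^ m *
          MvPowerSeries.monomial (Finsupp.single 1 1) β ^ (n - m) * (n.choose m : Completed q p)) =
        if d 0 = m ∧ d 1 = n - m then n.choose m • (α ^ m * β ^ (n - m)) else 0 := by
      intro m
      rw [← nsmul_eq_mul', map_nsmul, monomial_single_pow, monomial_single_pow,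
        MvPowerSeries.monomial_mul_monomial, MvPowerSeries.coeff_monomial]
      simp only [finsupp_fin_two_eq_iff]
      split_ifs
      · rfl
      · rw [smul_zero]
    rw [Finset.sum_congr rfl fun m _ => hterm m]
    split_ifs with hnd
    · rw [Finset.sum_eq_single (d 0), if_pos ⟨rfl, by omega⟩, show n - d 0 = d 1 by omega]
      · intro m _ hm
        exact if_neg fun h => hm h.1.symm
      · intro hm
        exact absurd (Finset.mem_range.mpr (by omega)) hm
    · refine Finset.sum_eq_zero fun m hm => if_neg fun h => hnd ?_
      have := Finset.mem_range.mp hm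
      omega
  change ∑ᶠ n : ℕ, (Nat.factorial n : ℂ)⁻¹ • MvPowerSeries.coeff d (_ ^ n) = _
  rw [finsum_eq_single _ (d 0 + d 1) fun n hne => by rw [hn, if_neg hne, smul_zero], hn, if_pos rfl,
    ← Nat.cast_smul_eq_nsmul ℂ, smul_smul]
  congr 1
  have h1 := congrArg (Nat.cast (R := ℂ)) (Nat.add_choose_mul_factorial_mul_factorial (d 0) (d 1))
  rw [Nat.choose_symm_add.symm] at h1
  push_cast at h1
  have h2 : ((d 0 + d 1).factorial : ℂ) ≠ 0 := Nat.cast_ne_zero.mpr (Nat.factorial_ne_zero _)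
  have h3 : ((d 0).factorial : ℂ) ≠ 0 := Nat.cast_ne_zero.mpr (Nat.factorial_ne_zero _)
  have h4 : ((d 1).factorial : ℂ) ≠ 0 := Nat.cast_ne_zero.mpr (Nat.factorial_ne_zero _)
  rw [← h1] at h2 ⊢
  have h5 := left_ne_zero_of_mul (left_ne_zero_of_mul h2)
  field_simp

/-- Reordering `(xy)ⁿ` produces `c` to the power `0 + 1 + ⋯ + (n - 1)`. -/
theorem mul_pow_of_qcomm {R : Type*} [Ring R] [Algebra ℂ R] {c : ℂ} {x y : R}
    (h : y * x = c • (x * y)) (n : ℕ) : (x * y) ^ n = c ^ (n * (n - 1) / 2) • (x ^ n * y ^ n) := by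
  simp only [← Nat.choose_two_right]
  induction n with
  | zero => simp
  | succ n ih =>
    rw [pow_succ, ih, smul_mul_assoc, mul_assoc, ← mul_assoc (y ^ n), qcomm_pow_left h,
      smul_mul_assoc, mul_smul_comm, smul_smul, mul_assoc x, ← pow_succ, ← mul_assoc, ← pow_succ,
      ← pow_add, Nat.choose_succ_succ' n 1, Nat.choose_one_right, add_comm]

/-- The cut off exponential of `i ε_s ⊗ η_s`, where `ε_s = -ρ⁻¹ p_s κ⁻¹`: the powers of `q`
collected from reordering `(p_s κ⁻¹)ⁿ` cancel those of the series. -/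
theorem cutExp_term (hodd : Odd p) (hq : IsPrimitiveRoot q p) (ρ : ℂ) (s : Bool) (n : ℕ) :
    (wt q s ^ (n * (n - 1) / 2) / qFact q n) •
      (toCompleted (Complex.I • (((-ρ) • (U.pS q p s * U.kapInv q p)) ⊗ₜ[ℂ]
        ((Ared.etaS q p s) ⊗ₜ[ℂ] (1 : Smooth Plane))))) ^ n =
    MvPowerSeries.C (((-Complex.I * ρ) ^ n / qFact q n) •
      ((U.pS q p s ^ n * U.kapInv q p ^ n) ⊗ₜ[ℂ] (Ared.etaS q p s ^ n))) := by
  have hw := pow_ne_zero (n * (n - 1) / 2) (wt_ne_zero hodd hq s)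
  rw [← smul_tmul', smul_smul, map_smul, toCompleted_tmul_one, ← C_smul, ← map_pow,
    ← C_smul, smul_pow, Algebra.TensorProduct.tmul_pow,
    mul_pow_of_qcomm (U.kapInv_mul_pS hodd.pos s),
    ← smul_tmul', smul_smul, smul_smul]
  congr 2
  rw [inv_pow, show Complex.I * -ρ = -Complex.I * ρ by ring]
  field_simp

/-- Summing over the powers of `δ` first turns `D(κ, δ)` into `∑ κᵏ ⊗ ζ(k)`. -/
theorem toCompleted_Dmat : toCompleted (Dmat q p) = MvPowerSeries.C
    (∑ k ∈ Finset.range p, (U.kap q p ^ k) ⊗ₜ[ℂ] Ared.zeta q p k) := by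
  have h : Dmat q p = ∑ k ∈ Finset.range p,
      (U.kap q p ^ k) ⊗ₜ[ℂ] (Ared.zeta q p k ⊗ₜ[ℂ] (1 : Smooth Plane)) := by
    rw [Dmat, Finset.smul_sum]
    refine Finset.sum_congr rfl fun k _ => ?_
    rw [← A.zeta_eq, A.zeta, tmul_smul, tmul_sum]
    congr 1
    refine Finset.sum_congr rfl fun n _ => ?_
    rw [tmul_smul, mul_comm]
  rw [h, map_sum, map_sum]
  exact Finset.sum_congr rfl fun k _ => toCompleted_tmul_one _ _

/-- Moving all powers of `κ` to the right, with `κ⁻¹ = κᵖ⁻¹`. -/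
theorem pow_mul_kapInv_mul (hodd : Odd p) (n m k : ℕ) :
    U.pS q p true ^ n * U.kapInv q p ^ n * (U.pS q p false ^ m * U.kapInv q p ^ m) *
      U.kap q p ^ k = q ^ (n * m) • (U.pS q p true ^ n * U.pS q p false ^ m *
        U.kap q p ^ (k + (p - 1) * (n + m))) := by
  have h := qcomm_pow_pow (U.kapInv_mul_pS (q := q) hodd.pos false) n m
  have hw : (wt q false)⁻¹ = q := inv_inv q
  rw [hw] at h
  have hk : U.kapInv q p ^ n * U.kapInv q p ^ m * U.kap q p ^ k =
      U.kap q p ^ (k + (p - 1) * (n + m)) := by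
    rw [U.kapInv, ← pow_mul, ← pow_mul, ← pow_add, ← pow_add]
    congr 1
    ring
  rw [mul_assoc (_ ^ n), ← mul_assoc (_ ^ n) (_ ^ m), h, ← hk]
  simp only [smul_mul_assoc, mul_smul_comm, mul_assoc]

theorem cutExpPlus_eq (hodd : Odd p) (hq : IsPrimitiveRoot q p) (r : ℂ) :
    cutExpPlus (toCompleted (Complex.I • (epsPlus q p r ⊗ₜ[ℂ] A.etaPlus q p))) =
      MvPowerSeries.C (∑ n ∈ Finset.range p, ((-Complex.I * r⁻¹) ^ n / qFact q n) •
        ((U.pS q p true ^ n * U.kapInv q p ^ n) ⊗ₜ[ℂ] (Ared.etaS q p true ^ n))) := by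
  rw [map_sum]
  exact Finset.sum_congr rfl fun n _ => cutExp_term hodd hq r⁻¹ true n

theorem cutExpMinus_eq (hodd : Odd p) (hq : IsPrimitiveRoot q p) (r : ℂ) :
    cutExpMinus (toCompleted (Complex.I • (epsMinus q p r ⊗ₜ[ℂ] A.etaMinus q p))) =
      MvPowerSeries.C (∑ n ∈ Finset.range p, ((-Complex.I * r) ^ n / qFact q n) •
        ((U.pS q p false ^ n * U.kapInv q p ^ n) ⊗ₜ[ℂ] (Ared.etaS q p false ^ n))) := by
  rw [map_sum]
  exact Finset.sum_congr rfl fun n _ => cutExp_term hodd hq r false n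

theorem pairCoeff_inv (q r : ℂ) (t s n m : ℕ) : (pairCoeff q r t s n m)⁻¹ =
    ((Nat.factorial t : ℂ) * (Nat.factorial s : ℂ))⁻¹ * (-Complex.I) ^ (t + s) *
      ((-Complex.I * r⁻¹) ^ n / qFact q n) * ((-Complex.I * r) ^ m / qFact q m) * q ^ (n * m) := by
  rw [pairCoeff, ← Complex.inv_I]
  simp only [mul_inv, mul_pow, inv_pow, inv_inv, div_eq_mul_inv, pow_add]
  ring

theorem mul_sum_mul_sum_mul_sum {R : Type*} [Semiring R] (x : R) (a b c : ℕ → R) (N : ℕ) :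
    x * (∑ n ∈ Finset.range N, a n) * (∑ m ∈ Finset.range N, b m) * (∑ k ∈ Finset.range N, c k) =
      ∑ j : Fin N × Fin N × Fin N, x * a j.1 * b j.2.1 * c j.2.2 := by
  simp only [Fintype.sum_prod_type, Finset.sum_range]
  simp only [← Finset.mul_sum, ← Finset.sum_mul]

/-- The coefficients of the product of exponentials are the same sums over the dual monomials. -/
theorem coeff_universalT (hodd : Odd p) (hq : IsPrimitiveRoot q p) (r : ℂ) (d : Fin 2 →₀ ℕ) :
    MvPowerSeries.coeff d (formalExp (toCompleted
          ((-Complex.I) • (U.PPlus q p ⊗ₜ[ℂ] A.zPlus q p) -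
            Complex.I • (U.PMinus q p ⊗ₜ[ℂ] A.zMinus q p))) *
        cutExpPlus (toCompleted (Complex.I • (epsPlus q p r ⊗ₜ[ℂ] A.etaPlus q p))) *
        cutExpMinus (toCompleted (Complex.I • (epsMinus q p r ⊗ₜ[ℂ] A.etaMinus q p))) *
        toCompleted (Dmat q p)) =
      ∑ j : Fin p × Fin p × Fin p, U.dualMonomial q p r (d 0) (d 1) j.1 j.2.1 j.2.2 ⊗ₜ[ℂ]
        Ared.monomial q p j.1 j.2.1 j.2.2 := by
  have hx : (-Complex.I) • (U.PPlus q p ⊗ₜ[ℂ] A.zPlus q p) -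
      Complex.I • (U.PMinus q p ⊗ₜ[ℂ] A.zMinus q p) =
      ((-Complex.I) • U.PPlus q p) ⊗ₜ[ℂ] A.zPlus q p +
        ((-Complex.I) • U.PMinus q p) ⊗ₜ[ℂ] A.zMinus q p := by
    simp only [smul_tmul', sub_eq_add_neg, neg_smul, neg_tmul]
  have hc : Commute (U.PPlus q p) (U.PMinus q p) :=
    (show Commute (U.pPlus q p) (U.pMinus q p) from U.comm q p).pow_pow p p
  have hαβ : Commute (((-Complex.I) • U.PPlus q p) ⊗ₜ[ℂ] (1 : Ared q p))
      (((-Complex.I) • U.PMinus q p) ⊗ₜ[ℂ] (1 : Ared q p)) := by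
    rw [Commute, SemiconjBy, Algebra.TensorProduct.tmul_mul_tmul,
      Algebra.TensorProduct.tmul_mul_tmul, ((hc.smul_left _).smul_right _).eq]
  rw [hx, toCompleted_coord, cutExpPlus_eq hodd hq, cutExpMinus_eq hodd hq, toCompleted_Dmat,
    MvPowerSeries.coeff_mul_C, MvPowerSeries.coeff_mul_C, MvPowerSeries.coeff_mul_C,
    coeff_formalExp hαβ, mul_sum_mul_sum_mul_sum]
  refine Finset.sum_congr rfl fun ⟨n, m, k⟩ _ => ?_
  have h := pow_mul_kapInv_mul (q := q) hodd n m k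
  simp only [Algebra.TensorProduct.tmul_pow, one_pow, smul_pow, ← smul_tmul', smul_mul_assoc,
    mul_smul_comm, smul_smul, Algebra.TensorProduct.tmul_mul_tmul, one_mul]
  rw [mul_assoc (_ * _) (_ * _) (_ * _), mul_assoc (_ * _) (_ * _) (_ ^ _), h, mul_smul_comm,
    U.dualMonomial, pairCoeff_inv, ← smul_tmul', ← smul_tmul', smul_smul]
  congr 1
  · ring
  · rw [U.monomial, ← mul_assoc, ← mul_assoc]
    rfl

end QPoincare

end

theorem proposition1 (p : ℕ) (hodd : Odd p) (hp : 1 < p) (q r : ℂ)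
    (hq : IsPrimitiveRoot q p) (hr : r ^ 2 = q) (hrp : r ^ p = -1) :
    ∃ B : QPoincare.U q p →ₗ[ℂ] QPoincare.A q p →ₗ[ℂ] ℂ,
      -- `B` is the duality pairing
      QPoincare.IsDualityPairing hodd hq r B ∧
      (∀ B' : QPoincare.U q p →ₗ[ℂ] QPoincare.A q p →ₗ[ℂ] ℂ,
        QPoincare.IsDualityPairing hodd hq r B' → B' = B) ∧
      -- the monomials are linear bases
      LinearIndependent ℂ (fun a : QPoincare.MonIdx p =>
        QPoincare.U.monomial q p a.1 a.2.1 a.2.2.1 a.2.2.2.1 a.2.2.2.2) ∧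
      Submodule.span ℂ (Set.range fun a : QPoincare.MonIdx p =>
        QPoincare.U.monomial q p a.1 a.2.1 a.2.2.1 a.2.2.2.1 a.2.2.2.2) = ⊤ ∧
      LinearIndependent ℂ (fun a : QPoincare.MonIdx p =>
        QPoincare.A.monomial q p a.1 a.2.1 a.2.2.1 a.2.2.2.1 a.2.2.2.2) ∧
      Submodule.span ℂ (Set.range fun a : QPoincare.MonIdx p =>
        QPoincare.A.monomial q p a.1 a.2.1 a.2.2.1 a.2.2.2.1 a.2.2.2.2) =
          QPoincare.A.polyPart q p ∧
      -- the duality relations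
      (∀ t s t' s' n m k n' m' k' : ℕ, n < p → m < p → k < p → n' < p → m' < p → k' < p →
        B (QPoincare.U.monomial q p t s n m k) (QPoincare.A.monomial q p t' s' n' m' k') =
          if n = n' ∧ m = m' ∧ t = t' ∧ s = s' ∧ k + n + m ≡ k' [MOD p] then
            Complex.I ^ (n + m + t + s) * r ^ ((n : ℤ) - (m : ℤ)) * q ^ (-((n : ℤ) * (m : ℤ))) *
              (Nat.factorial t : ℂ) * (Nat.factorial s : ℂ) * QPoincare.qFact q n * QPoincare.qFact q m
          else 0) ∧
      -- the universal T-matrix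
      QPoincare.IsUniversalT B
        (QPoincare.formalExp (QPoincare.toCompleted
            ((-Complex.I) • (QPoincare.U.PPlus q p ⊗ₜ[ℂ] QPoincare.A.zPlus q p) -
              Complex.I • (QPoincare.U.PMinus q p ⊗ₜ[ℂ] QPoincare.A.zMinus q p))) *
          QPoincare.cutExpPlus (QPoincare.toCompleted
            (Complex.I • (QPoincare.epsPlus q p r ⊗ₜ[ℂ] QPoincare.A.etaPlus q p))) *
          QPoincare.cutExpMinus (QPoincare.toCompleted
            (Complex.I • (QPoincare.epsMinus q p r ⊗ₜ[ℂ] QPoincare.A.etaMinus q p))) *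
          QPoincare.toCompleted (QPoincare.Dmat q p)) := by
  have hq0 : q ≠ 0 := hq.ne_zero hodd.pos.ne'
  have hr0 : r ≠ 0 := by
    rintro rfl
    exact hq0 (hr.symm.trans (zero_pow two_ne_zero))
  refine ⟨QPoincare.pairing hodd hp hq r, QPoincare.isDualityPairing hodd hp hq r,
    fun B' h' => QPoincare.isDualityPairing_unique (QPoincare.isDualityPairing hodd hp hq r) h',
    QPoincare.U.linearIndependent_monomial hodd hp hq r hrp,
    QPoincare.U.span_monomial hodd hq0, QPoincare.A.linearIndependent_monomial hodd hp hq r hrp,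
    QPoincare.A.span_monomial hodd hq, ?_, QPoincare.exists_areDualBases hodd hp hq hrp,
    fun _ _ _ h => QPoincare.hasFormalSum_of_areDualBases hodd hp hq hrp h
      (QPoincare.coeff_universalT hodd hq r)⟩
  intro t s t' s' n m k n' m' k' hn hm _ _ _ _
  have h1 : r ^ ((n : ℤ) - (m : ℤ)) = r ^ n * r⁻¹ ^ m := by
    rw [zpow_sub₀ hr0, zpow_natCast, zpow_natCast, div_eq_mul_inv, inv_pow]
  have h2 : q ^ (-((n : ℤ) * (m : ℤ))) = q⁻¹ ^ (n * m) := by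
    rw [zpow_neg, ← Nat.cast_mul, zpow_natCast, inv_pow]
  rw [h1, h2, ← mul_assoc (Complex.I ^ _)]
  exact QPoincare.pairing_monomial hodd hp hq r hrp t s t' s' n m k n' m' k' hn hm
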